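/- Let $M$ be a connected smooth manifold of dimension $n\ge 2$, let $A\subseteq TM\setminus\mathbf 0$ be open and conic ($\lambda v\in A$ for $v\in A$, $\lambda>0$) with $\pi(A)=M$, and let $L\colon A\to\mathbb R\setminus\{0\}$ be a pseudo-Finsler metric: $L$ is smooth, positively $2$-homogeneous, and $g_{ij}=\tfrac12L_{\cdot i\cdot j}$ is non-degenerate on $A$ (here ${}_{\cdot i}=\partial/\partial y^i$). Put $y_i=g_{ia}y^a$, $\mathrm C_i=\tfrac12g^{ab}g_{ab\cdot i}$, $(\mathrm G^L)^i=\tfrac14g^{ia}(2\partial_cg_{ab}-\partial_ag_{bc})y^by^c$, $(\mathrm N^L)^k_i=(\mathrm G^L)^k_{\cdot i}$, and let $\mathrm{Lan}_i=\tfrac12g^{ab}\nabla^L_ig_{ab}$ be the mean Landsberg tensor, where $\nabla^L$ is the covariant derivative of the anisotropic connection $\Gamma^k_{ij}=(\mathrm N^L)^k_{i\cdot j}$. A homogeneous nonlinear connection $\mathrm N$ on $A$ is given by smooth, $1$-homogeneous coefficients $\mathrm N_i^k(x,y)$ in each chart that transform like those of $\mathrm N^L$. It is a solution of the affine equation if $\mathcal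 J=\mathrm N-\mathrm N^L$ satisfies, on $A$, $$\Big\{2\,\mathrm{Lan}_b+(n+2)\tfrac{y_a}{L}\mathcal J^a_b-2\,\mathrm C_a\mathcal J^a_b-\big(\mathcal J^a_{b\cdot a}+\mathcal J^a_{a\cdot b}\big)\Big\}\big(\delta^b_iy^j-y^b\delta^j_i\big)-\big(\mathcal J^j_{i\cdot a}-\mathcal J^j_{a\cdot i}\big)y^a=0 .$$ $\mathrm N$-geodesics are the curves $\gamma$ (on open intervals) with $\ddot\gamma^k+\mathrm N^k_c(\gamma,\dot\gamma)\dot\gamma^c=0$ and velocities in $A$; pregeodesics are the curves that become geodesics after a positive reparametrization; two connections share (pre)geodesics if they have the same ones. 1. $\mathrm N^L$ is a solution of the affine equation if and only if $\mathrm{Lan}_i=0$ on $A$. 2. If $\mathrm{Lan}_i=0$, then a solution $\mathrm N$ shares pregeodesics with $\mathrm N^L$ if and only if $\mathrm N_i^k=(\mathrm N^L)_i^k+\mathcal A_i\,y^k$ for some smooth $0$-homogeneous anisotropic $1$-form $\mathcal A$ on $A$; and in that case it shares geodesics with $\mathrm N^L$ if and only if $\mathcal A_ay^a=0$. 3. If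 $\mathrm{Lan}_i$ does not vanish identically, then $\mathrm N^L$ is not a solution and no solution shares pregeodesics with $\mathrm N^L$. For the rest let $\overline A$ be the closure of $A$ in $TM\setminus\mathbf 0$ and $\partial A=\overline A\setminus A$. The metric $L$ is proper if each $A\cap T_pM$ is connected, $L>0$ on $A$, and $L$ extends smoothly to $\overline A$ with $L=0$ and $g$ non-degenerate on $\partial A$; it is Lorentz–Finsler if moreover $g$ has signature $(+,-,\dots,-)$ on $\overline A$. A proper solution is a solution on $A$ that extends smoothly to $\overline A$; its geodesics are now allowed to have velocities in $\overline A$, and likewise for $\mathrm N^L$. 4. If $L$ is proper and $\mathrm N$ is a proper solution, then along every $\mathrm N$-geodesic $\gamma$ the sign of $L(\dot\gamma)$ is constant. 5. Let $L$ be Lorentz–Finsler and $\mathrm N$ a proper solution (with no condition on $\mathrm{Lan}_i$). The causal character of an $\mathrm N$-geodesic $\gamma$ does not change: either $\dot\gamma\in A$ everywhere (timelike) or $\dot\gamma\in\partial A$ everywhere (lightlike). If $n\ge3$ and $\mathrm N$ is symmetric ($\mathrm N^k_{i\cdot j}=\mathrm N^k_{j\cdot i}$), then a curve whose velocity lies in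 $\partial A$ at some instant is an $\mathrm N$-geodesic if and only if it is an $L$-geodesic (a geodesic of $\mathrm N^L$). For every proper solution $\mathrm N$, symmetric or not, the lightlike $\mathrm N$-pregeodesics are the lightlike pregeodesics of $L$ and are inherent to its cone: they are also the lightlike pregeodesics of every Lorentz–Finsler metric $L'$ on the same $A$. -/

import Mathlib

open scoped Manifold ContDiff

noncomputable section

namespace Palatini

/-- The model space of an `n`-dimensional manifold. -/
abbrev Model (n : ℕ) : Type := EuclideanSpace ℝ (Fin n)

/-- The tangent bundle of an `n`-dimensional manifold. -/
abbrev TM (n : ℕ) (M : Type*) [TopologicalSpace M] [ChartedSpace (Model n) M]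
    [IsManifold (𝓡 n) ∞ M] : Type _ :=
  TangentBundle (𝓡 n) M

/-- The charts `(U, x)` of the atlas of `M`. -/
abbrev Chart (n : ℕ) (M : Type*) [TopologicalSpace M] [ChartedSpace (Model n) M] : Type _ :=
  ↥(atlas (Model n) M)

/-- The `i`-th vector of the canonical basis. -/
def stdVec {n : ℕ} (i : Fin n) : Model n := EuclideanSpace.single i (1 : ℝ)

/-- The partial derivative `∂_i = ∂/∂x^i` of a function `f (x, y)`. -/
def dH {n : ℕ} (i : Fin n) (f : Model n → Model n → ℝ) (x y : Model n) : ℝ :=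
  fderiv ℝ (fun x' => f x' y) x (stdVec i)

/-- The vertical derivative `∂/∂y^i` of a function `f (x, y)`, written `f_{·i}`. -/
def dV {n : ℕ} (i : Fin n) (f : Model n → Model n → ℝ) (x y : Model n) : ℝ :=
  fderiv ℝ (f x) y (stdVec i)

section Bundle

variable {n : ℕ} {M : Type*} [TopologicalSpace M] [ChartedSpace (Model n) M]
  [IsManifold (𝓡 n) ∞ M]

/-- The vector `y^a ∂_a` at the point of coordinates `x` in the chart `e`, as a vector of
the tangent space of `M` at that point. -/
def coordVec (e : Chart n M) (x y : Model n) : TangentSpace (𝓡 n) (e.1.symm x) :=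
  mfderiv 𝓘(ℝ, Model n) (𝓡 n) e.1.symm x y

/-- The point of `TM` with natural coordinates `(x, y)` in the chart `e`. -/
def tvec (e : Chart n M) (x y : Model n) : TM n M :=
  ⟨e.1.symm x, coordVec e x y⟩

/-- The set `S ∩ TU` in the natural coordinates `(x, y)` of the chart `e`. -/
def dom (e : Chart n M) (S : Set (TM n M)) : Set (Model n × Model n) :=
  {p | p.1 ∈ e.1.target ∧ tvec e p.1 p.2 ∈ S}

/-- `A` is open and conic in `TM` without the zero section, and it projects onto `M`. -/
structure IsConicDomain (A : Set (TM n M)) : Prop where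
  isOpen : IsOpen A
  ne_zero : ∀ (p : M) (u : TangentSpace (𝓡 n) p), (⟨p, u⟩ : TM n M) ∈ A → u ≠ 0
  smul_mem : ∀ (p : M) (u : TangentSpace (𝓡 n) p), (⟨p, u⟩ : TM n M) ∈ A →
    ∀ c : ℝ, 0 < c → (⟨p, c • u⟩ : TM n M) ∈ A
  surj : ∀ p : M, ∃ u : TangentSpace (𝓡 n) p, (⟨p, u⟩ : TM n M) ∈ A

/-- The closure of `A` in `TM` without the zero section. -/
def closA (A : Set (TM n M)) : Set (TM n M) := closure A ∩ {v | v.2 ≠ 0}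

/-- The boundary of `A` in `TM` without the zero section (for open `A`). -/
def bdA (A : Set (TM n M)) : Set (TM n M) := closA A \ A

/-! ### Pseudo-Finsler metrics -/

/-- The coordinate expression `L (x, y)`. -/
def coordL (L : TM n M → ℝ) (e : Chart n M) (x y : Model n) : ℝ := L (tvec e x y)

/-- The fundamental tensor `g_{ij} = L_{·i·j} / 2`. -/
def gMat (L : TM n M → ℝ) (e : Chart n M) (x y : Model n) : Matrix (Fin n) (Fin n) ℝ :=
  Matrix.of fun i j => (1 / 2 : ℝ) * dV j (dV i (coordL L e)) x y

/-- The inverse `g^{ij}` of the fundamental tensor. -/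
def gInv (L : TM n M → ℝ) (e : Chart n M) (x y : Model n) : Matrix (Fin n) (Fin n) ℝ :=
  (gMat L e x y)⁻¹

/-- A pseudo-Finsler metric on `A` without lightlike directions in `A`: only the values of `L`
on `A` matter. -/
structure IsPseudoFinsler (A : Set (TM n M)) (L : TM n M → ℝ) : Prop where
  conic : IsConicDomain A
  smooth : ContMDiffOn (𝓡 n).tangent 𝓘(ℝ, ℝ) ∞ L A
  homog : ∀ (p : M) (u : TangentSpace (𝓡 n) p), (⟨p, u⟩ : TM n M) ∈ A →
    ∀ c : ℝ, 0 < c → L ⟨p, c • u⟩ = c ^ 2 * L ⟨p, u⟩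
  nondeg : ∀ e : Chart n M, ∀ p ∈ dom e A, (gMat L e p.1 p.2).det ≠ 0
  ne_zero : ∀ v ∈ A, L v ≠ 0

/-- A proper pseudo-Finsler metric. The function `L` already carries the values of the smooth
extension on the closure of `A`: it is smooth on an open neighbourhood of that closure. The
derivatives of `L` of all orders at boundary points are then determined by `L` on `A`. -/
structure IsProper (A : Set (TM n M)) (L : TM n M → ℝ) : Prop extends IsPseudoFinsler A L where
  fiber_connected : ∀ p : M,
    IsConnected {u : TangentSpace (𝓡 n) p | (⟨p, u⟩ : TM n M) ∈ A}
  pos : ∀ v ∈ A, 0 < L v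
  extends_smoothly : ∃ B : Set (TM n M), IsOpen B ∧ closA A ⊆ B ∧
    ContMDiffOn (𝓡 n).tangent 𝓘(ℝ, ℝ) ∞ L B
  zero_bdry : ∀ v ∈ bdA A, L v = 0
  nondeg_bdry : ∀ e : Chart n M, ∀ p ∈ dom e (bdA A), (gMat L e p.1 p.2).det ≠ 0

/-- A symmetric matrix has signature `(+, -, ..., -)`. -/
def IsLorentzMatrix (g : Matrix (Fin n) (Fin n) ℝ) : Prop :=
  ∃ P : Matrix (Fin n) (Fin n) ℝ, P.det ≠ 0 ∧
    P.transpose * g * P = Matrix.diagonal fun i : Fin n => if (i : ℕ) = 0 then (1 : ℝ) else -1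

/-- A (properly) Lorentz-Finsler metric. -/
structure IsLorentzFinsler (A : Set (TM n M)) (L : TM n M → ℝ) : Prop extends IsProper A L where
  lorentz : ∀ e : Chart n M, ∀ p ∈ dom e (closA A), IsLorentzMatrix (gMat L e p.1 p.2)

/-! ### Nonlinear connections -/

/-- Families of coefficients `N_i^k (x, y)`, one for each chart: `N e x y i k` is `N_i^k`. -/
abbrev Coeffs (n : ℕ) (M : Type*) [TopologicalSpace M] [ChartedSpace (Model n) M] : Type _ :=
  Chart n M → Model n → Model n → Fin n → Fin n → ℝ

/-- The change of coordinates from the chart `e` to the chart `e'`. -/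
def chg (e e' : Chart n M) (x : Model n) : Model n := e'.1 (e.1.symm x)

/-- `N` is a homogeneous nonlinear connection on `A`: its coefficients are smooth and
`1`-homogeneous in `y` and, with `x̄ = chg e e' x`, `ȳ^b = (∂x̄^b/∂x^c) y^c`,
`N̄_i^k = (∂x̄^k/∂x^c) (∂²x^c/∂x̄^i∂x̄^b) ȳ^b + (∂x̄^k/∂x^c) (∂x^a/∂x̄^i) N_a^c`. -/
structure IsNonlinearConnection (A : Set (TM n M)) (N : Coeffs n M) : Prop where
  smooth : ∀ (e : Chart n M) (i k : Fin n),
    ContDiffOn ℝ ∞ (fun p : Model n × Model n => N e p.1 p.2 i k) (dom e A)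
  homog : ∀ (e : Chart n M), ∀ p ∈ dom e A, ∀ c : ℝ, 0 < c → ∀ i k : Fin n,
    N e p.1 (c • p.2) i k = c * N e p.1 p.2 i k
  cocycle : ∀ (e e' : Chart n M) (x y : Model n), (x, y) ∈ dom e A →
    e.1.symm x ∈ e'.1.source → ∀ i k : Fin n,
    N e' (chg e e' x) (fderiv ℝ (chg e e') x y) i k =
      ∑ c, fderiv ℝ (chg e e') x (stdVec c) k *
        ∑ b, fderiv ℝ (fun z => fderiv ℝ (chg e' e) z (stdVec b) c) (chg e e' x) (stdVec i) *
          fderiv ℝ (chg e e') x y b +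
      ∑ c, ∑ a, fderiv ℝ (chg e e') x (stdVec c) k *
        fderiv ℝ (chg e' e) (chg e e' x) (stdVec i) a * N e x y a c

/-- `N` extends smoothly to the closure of `A`: the coefficients already carry the values of the
extension, being smooth on an open neighbourhood of that closure. -/
def ExtendsToClosure (A : Set (TM n M)) (N : Coeffs n M) : Prop :=
  ∀ e : Chart n M, ∃ B : Set (Model n × Model n), IsOpen B ∧ dom e (closA A) ⊆ B ∧
    ∀ i k : Fin n, ContDiffOn ℝ ∞ (fun p : Model n × Model n => N e p.1 p.2 i k) B

/-- `N` is symmetric: `Tor_{ij}^k = N_{i·j}^k - N_{j·i}^k = 0` on `A`. -/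
def IsSymmetricConn (A : Set (TM n M)) (N : Coeffs n M) : Prop :=
  ∀ e : Chart n M, ∀ p ∈ dom e A, ∀ i j k : Fin n,
    dV j (fun x y => N e x y i k) p.1 p.2 - dV i (fun x y => N e x y j k) p.1 p.2 = 0

/-- The coefficients `(G^L)^i = g^{ia} (2 ∂_c g_{ab} - ∂_a g_{bc}) y^b y^c / 4` of the metric
spray. -/
def metricSpray (L : TM n M → ℝ) (e : Chart n M) (x y : Model n) (i : Fin n) : ℝ :=
  (1 / 4 : ℝ) * ∑ a, gInv L e x y i a * ∑ b, ∑ c,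
    (2 * dH c (fun x y => gMat L e x y a b) x y - dH a (fun x y => gMat L e x y b c) x y) *
      y b * y c

/-- The metric nonlinear connection `(N^L)_i^k = (G^L)^k_{·i}`. -/
def metricConn (L : TM n M → ℝ) : Coeffs n M := fun e x y i k =>
  dV i (fun x y => metricSpray L e x y k) x y

/-! ### The affine equation -/

/-- The mean Cartan tensor `C_i = g^{ab} C_{abi}`, where `C_{abi} = g_{ab·i} / 2`. -/
def meanCartan (L : TM n M → ℝ) (e : Chart n M) (i : Fin n) (x y : Model n) : ℝ :=
  ∑ a, ∑ b, gInv L e x y a b * ((1 / 2 : ℝ) * dV i (fun x y => gMat L e x y a b) x y)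

/-- The horizontal derivative `δ_k f = ∂_k f - N_k^a f_{·a}`. -/
def delta (N : Coeffs n M) (e : Chart n M) (k : Fin n) (f : Model n → Model n → ℝ)
    (x y : Model n) : ℝ :=
  dH k f x y - ∑ a, N e x y k a * dV a f x y

/-- The Landsberg tensor `Lan_{ijk} = ∇^L_k g_{ij} / 2`, with `∇^L` the covariant derivative of
the anisotropic connection `Γ_{ij}^k = (N^L)_{i·j}^k`. -/
def landsberg (L : TM n M → ℝ) (e : Chart n M) (i j k : Fin n) (x y : Model n) : ℝ :=
  (1 / 2 : ℝ) * (delta (metricConn L) e k (fun x y => gMat L e x y i j) x y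
    - ∑ a, dV i (fun x y => metricConn L e x y k a) x y * gMat L e x y a j
    - ∑ a, dV j (fun x y => metricConn L e x y k a) x y * gMat L e x y i a)

/-- The mean Landsberg tensor `Lan_i = g^{ab} Lan_{abi}`. -/
def meanLandsberg (L : TM n M → ℝ) (e : Chart n M) (i : Fin n) (x y : Model n) : ℝ :=
  ∑ a, ∑ b, gInv L e x y a b * landsberg L e a b i x y

/-- `Lan_i = 0` on `A`. -/
def MeanLandsbergVanishes (A : Set (TM n M)) (L : TM n M → ℝ) : Prop :=
  ∀ e : Chart n M, ∀ p ∈ dom e A, ∀ i : Fin n, meanLandsberg L e i p.1 p.2 = 0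

/-- The difference `J_i^k = N_i^k - (N^L)_i^k`. -/
def diffJ (L : TM n M → ℝ) (N : Coeffs n M) (e : Chart n M) (i k : Fin n) (x y : Model n) : ℝ :=
  N e x y i k - metricConn L e x y i k

/-- The lowered index `y_a = g_{ab} y^b`. -/
def lowY (L : TM n M → ℝ) (e : Chart n M) (a : Fin n) (x y : Model n) : ℝ :=
  ∑ b, gMat L e x y a b * y b

/-- The bracket
`2 Lan_b + (n + 2) (y_a / L) J_b^a - 2 C_a J_b^a - (J_{b·a}^a + J_{a·b}^a)`. -/
def bracket (L : TM n M → ℝ) (N : Coeffs n M) (e : Chart n M) (b : Fin n) (x y : Model n) : ℝ :=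
  2 * meanLandsberg L e b x y
    + ((n : ℝ) + 2) * ∑ a, lowY L e a x y / coordL L e x y * diffJ L N e b a x y
    - 2 * ∑ a, meanCartan L e a x y * diffJ L N e b a x y
    - ∑ a, (dV a (diffJ L N e b a) x y + dV b (diffJ L N e a a) x y)

/-- The left-hand side, with free indices `i` and `j`, of the affine equation
`{2 Lan_b + (n + 2) (y_a / L) J_b^a - 2 C_a J_b^a - (J_{b·a}^a + J_{a·b}^a)}
(δ_i^b y^j - y^b δ_i^j) - (J_{i·a}^j - J_{a·i}^j) y^a = 0`. -/
def affineLHS (L : TM n M → ℝ) (N : Coeffs n M) (e : Chart n M) (i j : Fin n)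
    (x y : Model n) : ℝ :=
  ∑ b, bracket L N e b x y *
      ((if i = b then (1 : ℝ) else 0) * y j - y b * (if i = j then (1 : ℝ) else 0))
    - ∑ a, (dV a (diffJ L N e i j) x y - dV i (diffJ L N e a j) x y) * y a

/-- `N` is a homogeneous nonlinear connection on `A` that solves the affine equation of `L`. -/
structure IsAffineSolution (A : Set (TM n M)) (L : TM n M → ℝ) (N : Coeffs n M) : Prop where
  conn : IsNonlinearConnection A N
  eqn : ∀ e : Chart n M, ∀ p ∈ dom e A, ∀ i j : Fin n, affineLHS L N e i j p.1 p.2 = 0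

/-- A proper solution: a solution on `A` that extends smoothly to the closure of `A`. -/
structure IsProperSolution (A : Set (TM n M)) (L : TM n M → ℝ) (N : Coeffs n M) : Prop
    extends IsAffineSolution A L N where
  ext : ExtendsToClosure A N

/-! ### Anisotropic one-forms -/

/-- Assignments `v ↦ 𝒜_v` of a covector at `p` to each `v` tangent at `p`. -/
abbrev OneForm (n : ℕ) (M : Type*) [TopologicalSpace M] [ChartedSpace (Model n) M]
    [IsManifold (𝓡 n) ∞ M] : Type _ :=
  (p : M) → TangentSpace (𝓡 n) p → (TangentSpace (𝓡 n) p →L[ℝ] ℝ)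

/-- The component `𝒜_i (x, y)`. -/
def formComp (𝒜 : OneForm n M) (e : Chart n M) (i : Fin n) (x y : Model n) : ℝ :=
  𝒜 (e.1.symm x) (coordVec e x y) (coordVec e x (stdVec i))

/-- `𝒜` is a smooth `0`-homogeneous anisotropic one-form on `A`. -/
structure IsAnisotropicForm (A : Set (TM n M)) (𝒜 : OneForm n M) : Prop where
  smooth : ∀ (e : Chart n M) (i : Fin n),
    ContDiffOn ℝ ∞ (fun p : Model n × Model n => formComp 𝒜 e i p.1 p.2) (dom e A)
  homog : ∀ (p : M) (u : TangentSpace (𝓡 n) p), (⟨p, u⟩ : TM n M) ∈ A →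
    ∀ c : ℝ, 0 < c → 𝒜 p (c • u) = 𝒜 p u

/-- `N = N₀ + 𝒜 ⊗ ℂ` on `A`, that is, `N_i^k = (N₀)_i^k + 𝒜_i y^k`. -/
def IsTranslate (A : Set (TM n M)) (N N₀ : Coeffs n M) (𝒜 : OneForm n M) : Prop :=
  ∀ e : Chart n M, ∀ p ∈ dom e A, ∀ i k : Fin n,
    N e p.1 p.2 i k = N₀ e p.1 p.2 i k + formComp 𝒜 e i p.1 p.2 * p.2 k

/-! ### Geodesics and pregeodesics -/

/-- The velocity of a curve, as a point of `TM`. -/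
def velocity (γ : ℝ → M) (t : ℝ) : TM n M :=
  ⟨γ t, mfderiv 𝓘(ℝ, ℝ) (𝓡 n) γ t (1 : ℝ)⟩

/-- `γ`, defined on the open interval `s`, is an `N`-geodesic with velocities in `D`: in every
chart, `d²γ^k/dt² + N_c^k (γ, dγ/dt) dγ^c/dt = 0`. -/
structure IsGeodesicOn (D : Set (TM n M)) (N : Coeffs n M) (γ : ℝ → M) (s : Set ℝ) : Prop where
  isOpen : IsOpen s
  ordConnected : s.OrdConnected
  regular : ContMDiffOn 𝓘(ℝ, ℝ) (𝓡 n) 2 γ s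
  velocity_mem : ∀ t ∈ s, velocity γ t ∈ D
  eqn : ∀ t ∈ s, ∀ e : Chart n M, γ t ∈ e.1.source → ∀ k : Fin n,
    deriv (deriv fun τ => e.1 (γ τ) k) t +
      ∑ c, N e (e.1 (γ t)) (deriv (fun τ => e.1 (γ τ)) t) c k *
        deriv (fun τ => e.1 (γ τ) c) t = 0

/-- `γ`, defined on `s`, can be positively reparametrized to an `N`-geodesic with velocities
in `D`. -/
def IsPregeodesicOn (D : Set (TM n M)) (N : Coeffs n M) (γ : ℝ → M) (s : Set ℝ) : Prop :=
  ∃ (r : Set ℝ) (φ : ℝ → ℝ), ContDiffOn ℝ 2 φ r ∧ (∀ t ∈ r, 0 < deriv φ t) ∧ φ '' r = s ∧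
    IsGeodesicOn D N (fun t => γ (φ t)) r

/-- The two connections have the same geodesics with velocities in `D`. -/
def ShareGeodesics (D : Set (TM n M)) (N N₀ : Coeffs n M) : Prop :=
  ∀ (γ : ℝ → M) (s : Set ℝ), IsGeodesicOn D N γ s ↔ IsGeodesicOn D N₀ γ s

/-- The two connections have the same pregeodesics with velocities in `D`. -/
def SharePregeodesics (D : Set (TM n M)) (N N₀ : Coeffs n M) : Prop :=
  ∀ (γ : ℝ → M) (s : Set ℝ), IsPregeodesicOn D N γ s ↔ IsPregeodesicOn D N₀ γ s

end Bundle

end Palatini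

end

open Palatini

set_option linter.unusedSectionVars false

noncomputable section

namespace Palatini

/-! ### Calculus of functions of position and velocity -/

section Calculus

variable {n : ℕ}

/-! Put J = N - N^L and Q^k = J_a^k y^a, and let B_b be the bracket and T_i^j the torsion term, so
that the affine equation reads B_i y^j - (B_b y^b) δ_i^j = T_i^j. Its trace (n ≥ 2) and then its
Euclidean contraction with y^j express τ = B_b y^b and B_b through the torsion alone
(`bracketTrace`, `bracketExt`). Solving the definition of B_b for its term in 1/L gives y_a J_b^a =
L q_b, where q (`quotJ`) is computed without dividing by L. With λ = q_b y^b (`quotQ`), y_a Q^a = L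
λ.

By homogeneity the equation is also B_i y^j - τ δ_i^j = 2 J_i^j - Q^j_{·i}. Contracting with y_j and
using the vertical derivative of y_a Q^a = L λ gives the central formula Q^k = (2 λ - τ) y^k + L κ^k
(`gMat_quadJ`, `quadJ_eq`), whose coefficients are smooth up to the boundary for a proper solution.
Identities are proved on A, where homogeneity and L ≠ 0 are available, and pass to the closure by
density (`eqOn_dom_closA`).

On A, sharing pregeodesics means that Q is proportional to y: one direction evaluates the geodesic
equations at an arbitrary initial vector, the other absorbs the factor by a reparametrization. If Q
= f y, then f = λ = τ, the equation collapses to J_i^j = q_i y^j (`diffJ_eq_of_parallel`), and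
substitution in the bracket leaves Lan = 0 (`meanLandsberg_eq_zero_of_parallel`). Applied to J = 0
and to an arbitrary solution, this gives the first three claims.

L is constant along its own spray, so along N-geodesics dL/dt = -2 y_a Q^a = -2 λ L. By uniqueness
for this linear equation L vanishes everywhere or nowhere along a geodesic
(`TransportsMetric.eq_zero`), which gives the constancy of sign and of causal character.

On the boundary L = 0, so Q = (2 λ - τ) y and the lightlike pregeodesics are those of N^L. Without
torsion τ = 0, and the contracted bracket gives (2 - n) λ = L (...) (`symm_quotQ`), so that Q = 0
there when n ≥ 3. For another metric L' with the same cone, the cone is a regular level set of L and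
dL' is proportional to dL on it. The spray of L' is tangent to it, and differentiating this
proportionality along that spray shows that the two sprays differ by a multiple of y
(`parallelOn_metricConn`). -/

/-- `f (x, y)` is smooth on `W`. -/
def SmoothOn (W : Set (Model n × Model n)) (f : Model n → Model n → ℝ) : Prop :=
  ContDiffOn ℝ ∞ (fun p : Model n × Model n => f p.1 p.2) W

variable {W : Set (Model n × Model n)} {f g : Model n → Model n → ℝ}

theorem SmoothOn.mono {V : Set (Model n × Model n)} (hf : SmoothOn W f) (h : V ⊆ W) :
    SmoothOn V f := ContDiffOn.mono hf h

theorem SmoothOn.continuousOn (hf : SmoothOn W f) :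
    ContinuousOn (fun p : Model n × Model n => f p.1 p.2) W := ContDiffOn.continuousOn hf

theorem SmoothOn.contDiffAt (hf : SmoothOn W f) (hW : IsOpen W) {x y : Model n}
    (h : (x, y) ∈ W) : ContDiffAt ℝ ∞ (fun p : Model n × Model n => f p.1 p.2) (x, y) :=
  ContDiffOn.contDiffAt hf (hW.mem_nhds h)

theorem SmoothOn.differentiableAt (hf : SmoothOn W f) (hW : IsOpen W) {x y : Model n}
    (h : (x, y) ∈ W) : DifferentiableAt ℝ (fun p : Model n × Model n => f p.1 p.2) (x, y) :=
  (hf.contDiffAt hW h).differentiableAt (by simp)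

theorem SmoothOn.congr (hf : SmoothOn W f) (h : ∀ p ∈ W, g p.1 p.2 = f p.1 p.2) :
    SmoothOn W g := ContDiffOn.congr hf h

theorem SmoothOn.add (hf : SmoothOn W f) (hg : SmoothOn W g) :
    SmoothOn W (fun x y => f x y + g x y) := ContDiffOn.add hf hg

theorem SmoothOn.sub (hf : SmoothOn W f) (hg : SmoothOn W g) :
    SmoothOn W (fun x y => f x y - g x y) := ContDiffOn.sub hf hg

theorem SmoothOn.mul (hf : SmoothOn W f) (hg : SmoothOn W g) :
    SmoothOn W (fun x y => f x y * g x y) := ContDiffOn.mul hf hg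

theorem SmoothOn.div (hf : SmoothOn W f) (hg : SmoothOn W g) (h : ∀ p ∈ W, g p.1 p.2 ≠ 0) :
    SmoothOn W (fun x y => f x y / g x y) := ContDiffOn.div hf hg h

theorem smoothOn_const (c : ℝ) : SmoothOn W (fun _ _ => c) := contDiffOn_const

theorem SmoothOn.const_mul (hf : SmoothOn W f) (c : ℝ) :
    SmoothOn W (fun x y => c * f x y) := (smoothOn_const c).mul hf

theorem SmoothOn.sum {ι : Type*} {s : Finset ι} {F : ι → Model n → Model n → ℝ}
    (h : ∀ i ∈ s, SmoothOn W (F i)) : SmoothOn W (fun x y => ∑ i ∈ s, F i x y) :=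
  ContDiffOn.sum h

theorem SmoothOn.prod {ι : Type*} {s : Finset ι} {F : ι → Model n → Model n → ℝ}
    (h : ∀ i ∈ s, SmoothOn W (F i)) : SmoothOn W (fun x y => ∏ i ∈ s, F i x y) :=
  contDiffOn_prod h

theorem smoothOn_snd (i : Fin n) : SmoothOn W (fun _ y => y i) := by
  have : ContDiff ℝ ∞ (fun p : Model n × Model n => p.2 i) := by fun_prop
  exact this.contDiffOn

theorem dV_eq (hf : SmoothOn W f) (hW : IsOpen W) {x y : Model n} (h : (x, y) ∈ W) (i : Fin n) :
    dV i f x y = fderiv ℝ (fun p : Model n × Model n => f p.1 p.2) (x, y) (0, stdVec i) := by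
  have h1 := (hf.differentiableAt hW h).hasFDerivAt
  have h2 : HasFDerivAt (f x) _ y := h1.comp y (hasFDerivAt_prodMk_right x y)
  rw [dV, h2.fderiv]
  simp

theorem dH_eq (hf : SmoothOn W f) (hW : IsOpen W) {x y : Model n} (h : (x, y) ∈ W) (i : Fin n) :
    dH i f x y = fderiv ℝ (fun p : Model n × Model n => f p.1 p.2) (x, y) (stdVec i, 0) := by
  have h1 := (hf.differentiableAt hW h).hasFDerivAt
  have h2 : HasFDerivAt (fun x' => f x' y) _ x :=
    HasFDerivAt.comp (g := fun p : Model n × Model n => f p.1 p.2) (f := fun x' => (x', y)) x h1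
      (hasFDerivAt_prodMk_left x y)
  rw [dH, h2.fderiv]
  simp

theorem SmoothOn.fderiv_apply {F : Model n × Model n → ℝ} (hF : ContDiffOn ℝ ∞ F W)
    (hW : IsOpen W) (v : Model n × Model n) :
    SmoothOn W (fun x y => fderiv ℝ F (x, y) v) := by
  have := hF.fderiv_of_isOpen hW (m := ∞) (by simp)
  exact this.clm_apply contDiffOn_const

theorem SmoothOn.dV (hf : SmoothOn W f) (hW : IsOpen W) (i : Fin n) : SmoothOn W (dV i f) :=
  (SmoothOn.fderiv_apply hf hW (0, stdVec i)).congr fun _ hp => dV_eq hf hW hp i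

theorem SmoothOn.dH (hf : SmoothOn W f) (hW : IsOpen W) (i : Fin n) : SmoothOn W (dH i f) :=
  (SmoothOn.fderiv_apply hf hW (stdVec i, 0)).congr fun _ hp => dH_eq hf hW hp i

theorem eventually_mem_right (hW : IsOpen W) {x y : Model n} (h : (x, y) ∈ W) :
    ∀ᶠ z in nhds y, (x, z) ∈ W :=
  (Continuous.prodMk_right x).continuousAt.eventually (hW.mem_nhds h)

theorem eventually_mem_left (hW : IsOpen W) {x y : Model n} (h : (x, y) ∈ W) :
    ∀ᶠ z in nhds x, (z, y) ∈ W :=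
  (Continuous.prodMk_left y).continuousAt.eventually (hW.mem_nhds h)

theorem dV_congr (hW : IsOpen W) (h : ∀ p ∈ W, f p.1 p.2 = g p.1 p.2) {x y : Model n}
    (hp : (x, y) ∈ W) (i : Fin n) : dV i f x y = dV i g x y := by
  have : f x =ᶠ[nhds y] g x := by
    filter_upwards [eventually_mem_right hW hp] with z hz using h _ hz
  rw [dV, dV, this.fderiv_eq]

theorem dH_congr (hW : IsOpen W) (h : ∀ p ∈ W, f p.1 p.2 = g p.1 p.2) {x y : Model n}
    (hp : (x, y) ∈ W) (i : Fin n) : dH i f x y = dH i g x y := by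
  have : (fun x' => f x' y) =ᶠ[nhds x] fun x' => g x' y := by
    filter_upwards [eventually_mem_left hW hp] with z hz using h _ hz
  rw [dH, dH, this.fderiv_eq]

theorem SmoothOn.hasFDerivAt_right (hf : SmoothOn W f) (hW : IsOpen W) {x y : Model n}
    (h : (x, y) ∈ W) : DifferentiableAt ℝ (f x) y :=
  ((hf.differentiableAt hW h).hasFDerivAt.comp y (hasFDerivAt_prodMk_right x y)).differentiableAt

theorem SmoothOn.hasFDerivAt_left (hf : SmoothOn W f) (hW : IsOpen W) {x y : Model n}
    (h : (x, y) ∈ W) : DifferentiableAt ℝ (fun x' => f x' y) x :=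
  (HasFDerivAt.comp (g := fun p : Model n × Model n => f p.1 p.2) (f := fun x' => (x', y)) x
    (hf.differentiableAt hW h).hasFDerivAt (hasFDerivAt_prodMk_left x y)).differentiableAt

/-! ### Linearity and product rules for the partial derivatives. -/

section Rules

variable (hW : IsOpen W) {x y : Model n} (h : (x, y) ∈ W) (i : Fin n)
include hW h

theorem dV_add (hf : SmoothOn W f) (hg : SmoothOn W g) :
    dV i (fun x y => f x y + g x y) x y = dV i f x y + dV i g x y := by
  simp only [dV]
  rw [fderiv_fun_add (hf.hasFDerivAt_right hW h) (hg.hasFDerivAt_right hW h)]; rfl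

theorem dV_sub (hf : SmoothOn W f) (hg : SmoothOn W g) :
    dV i (fun x y => f x y - g x y) x y = dV i f x y - dV i g x y := by
  simp only [dV]
  rw [fderiv_fun_sub (hf.hasFDerivAt_right hW h) (hg.hasFDerivAt_right hW h)]; rfl

theorem dV_mul (hf : SmoothOn W f) (hg : SmoothOn W g) :
    dV i (fun x y => f x y * g x y) x y = dV i f x y * g x y + f x y * dV i g x y := by
  simp only [dV]
  rw [fderiv_fun_mul (hf.hasFDerivAt_right hW h) (hg.hasFDerivAt_right hW h)]
  simp; ring

theorem dV_const_mul (hf : SmoothOn W f) (c : ℝ) :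
    dV i (fun x y => c * f x y) x y = c * dV i f x y := by
  simp only [dV]
  rw [fderiv_const_mul (hf.hasFDerivAt_right hW h)]; rfl

theorem dV_sum {ι : Type*} {s : Finset ι} {F : ι → Model n → Model n → ℝ}
    (hF : ∀ i ∈ s, SmoothOn W (F i)) :
    dV i (fun x y => ∑ j ∈ s, F j x y) x y = ∑ j ∈ s, dV i (F j) x y := by
  simp only [dV]
  rw [fderiv_fun_sum fun j hj => (hF j hj).hasFDerivAt_right hW h]
  simp

theorem dH_const_mul (hf : SmoothOn W f) (c : ℝ) :
    dH i (fun x y => c * f x y) x y = c * dH i f x y := by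
  simp only [dH]
  rw [fderiv_const_mul (hf.hasFDerivAt_left hW h)]; rfl

theorem dH_sum {ι : Type*} {s : Finset ι} {F : ι → Model n → Model n → ℝ}
    (hF : ∀ i ∈ s, SmoothOn W (F i)) :
    dH i (fun x y => ∑ j ∈ s, F j x y) x y = ∑ j ∈ s, dH i (F j) x y := by
  simp only [dH]
  rw [fderiv_fun_sum fun j hj => (hF j hj).hasFDerivAt_left hW h]
  simp

theorem dH_mul (hf : SmoothOn W f) (hg : SmoothOn W g) :
    dH i (fun x y => f x y * g x y) x y = dH i f x y * g x y + f x y * dH i g x y := by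
  simp only [dH]
  rw [fderiv_fun_mul (hf.hasFDerivAt_left hW h) (hg.hasFDerivAt_left hW h)]
  simp; ring

end Rules

theorem dV_snd (i j : Fin n) (x y : Model n) :
    dV i (fun _ y => y j) x y = if i = j then 1 else 0 := by
  have : HasFDerivAt (fun y : Model n => y j)
      (EuclideanSpace.proj j : EuclideanSpace ℝ (Fin n) →L[ℝ] ℝ) y :=
    (EuclideanSpace.proj j : EuclideanSpace ℝ (Fin n) →L[ℝ] ℝ).hasFDerivAt
  rw [dV, this.fderiv]
  simp [stdVec, eq_comm]

theorem dH_snd (i j : Fin n) (x y : Model n) : dH i (fun _ y => y j) x y = 0 := by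
  simp [dH]

theorem dV_mul_snd (hW : IsOpen W) {x y : Model n} (h : (x, y) ∈ W) (i j : Fin n)
    (hf : SmoothOn W f) :
    dV i (fun x y => f x y * y j) x y = dV i f x y * y j + if i = j then f x y else 0 := by
  rw [dV_mul hW h i hf (smoothOn_snd j), dV_snd]; simp

theorem dH_mul_snd (hW : IsOpen W) {x y : Model n} (h : (x, y) ∈ W) (i j : Fin n)
    (hf : SmoothOn W f) :
    dH i (fun x y => f x y * y j) x y = dH i f x y * y j := by
  rw [dH_mul hW h i hf (smoothOn_snd j), dH_snd]; simp

/-- The derivative of `∑ a, F a * y^a` in the direction `y^i`. -/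
theorem dV_sum_mul_snd (hW : IsOpen W) {x y : Model n} (h : (x, y) ∈ W) (i : Fin n)
    {F : Fin n → Model n → Model n → ℝ} (hF : ∀ a, SmoothOn W (F a)) :
    dV i (fun x y => ∑ a, F a x y * y a) x y = ∑ a, dV i (F a) x y * y a + F i x y := by
  rw [dV_sum hW h i fun a _ => (hF a).mul (smoothOn_snd a)]
  simp [dV_mul_snd hW h i _ (hF _), Finset.sum_add_distrib]

theorem dH_sum_mul_snd (hW : IsOpen W) {x y : Model n} (h : (x, y) ∈ W) (i : Fin n)
    {F : Fin n → Model n → Model n → ℝ} (hF : ∀ a, SmoothOn W (F a)) :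
    dH i (fun x y => ∑ a, F a x y * y a) x y = ∑ a, dH i (F a) x y * y a := by
  rw [dH_sum hW h i fun a _ => (hF a).mul (smoothOn_snd a)]
  simp [dH_mul_snd hW h i _ (hF _)]

/-! ### Second derivatives and their symmetry. -/

theorem fderiv_fderiv_apply (hf : SmoothOn W f) (hW : IsOpen W) {x y : Model n}
    (h : (x, y) ∈ W) (u v : Model n × Model n) :
    fderiv ℝ (fun p => fderiv ℝ (fun p : Model n × Model n => f p.1 p.2) p v) (x, y) u =
      fderiv ℝ (fderiv ℝ (fun p : Model n × Model n => f p.1 p.2)) (x, y) u v := by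
  have hd : DifferentiableAt ℝ (fderiv ℝ (fun p : Model n × Model n => f p.1 p.2)) (x, y) :=
    ((hf.contDiffAt hW h).fderiv_right (m := ∞) (by simp)).differentiableAt (by simp)
  rw [(hd.hasFDerivAt.clm_apply (hasFDerivAt_const v _)).fderiv]
  simp

theorem fderiv_fderiv_symm (hf : SmoothOn W f) (hW : IsOpen W) {x y : Model n}
    (h : (x, y) ∈ W) (u v : Model n × Model n) :
    fderiv ℝ (fderiv ℝ (fun p : Model n × Model n => f p.1 p.2)) (x, y) u v =
      fderiv ℝ (fderiv ℝ (fun p : Model n × Model n => f p.1 p.2)) (x, y) v u :=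
  ((hf.contDiffAt hW h).isSymmSndFDerivAt (by simpa using ENat.LEInfty.out)).eq u v

theorem dV_dV (hf : SmoothOn W f) (hW : IsOpen W) {x y : Model n} (h : (x, y) ∈ W)
    (i j : Fin n) : dV i (dV j f) x y =
      fderiv ℝ (fderiv ℝ (fun p : Model n × Model n => f p.1 p.2)) (x, y)
        (0, stdVec i) (0, stdVec j) := by
  rw [dV_eq (hf.dV hW j) hW h i, ← fderiv_fderiv_apply hf hW h]
  congr 1
  refine Filter.EventuallyEq.fderiv_eq ?_
  filter_upwards [hW.mem_nhds h] with p hp using dV_eq hf hW hp j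

theorem dH_dV (hf : SmoothOn W f) (hW : IsOpen W) {x y : Model n} (h : (x, y) ∈ W)
    (i j : Fin n) : dH i (dV j f) x y =
      fderiv ℝ (fderiv ℝ (fun p : Model n × Model n => f p.1 p.2)) (x, y)
        (stdVec i, 0) (0, stdVec j) := by
  rw [dH_eq (hf.dV hW j) hW h i, ← fderiv_fderiv_apply hf hW h]
  congr 1
  refine Filter.EventuallyEq.fderiv_eq ?_
  filter_upwards [hW.mem_nhds h] with p hp using dV_eq hf hW hp j

theorem dV_dH (hf : SmoothOn W f) (hW : IsOpen W) {x y : Model n} (h : (x, y) ∈ W)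
    (i j : Fin n) : dV i (dH j f) x y =
      fderiv ℝ (fderiv ℝ (fun p : Model n × Model n => f p.1 p.2)) (x, y)
        (0, stdVec i) (stdVec j, 0) := by
  rw [dV_eq (hf.dH hW j) hW h i, ← fderiv_fderiv_apply hf hW h]
  congr 1
  refine Filter.EventuallyEq.fderiv_eq ?_
  filter_upwards [hW.mem_nhds h] with p hp using dH_eq hf hW hp j

theorem dV_comm (hf : SmoothOn W f) (hW : IsOpen W) {x y : Model n} (h : (x, y) ∈ W)
    (i j : Fin n) : dV i (dV j f) x y = dV j (dV i f) x y := by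
  rw [dV_dV hf hW h, dV_dV hf hW h, fderiv_fderiv_symm hf hW h]

theorem dV_dH_comm (hf : SmoothOn W f) (hW : IsOpen W) {x y : Model n} (h : (x, y) ∈ W)
    (i j : Fin n) : dV i (dH j f) x y = dH j (dV i f) x y := by
  rw [dV_dH hf hW h, dH_dV hf hW h, fderiv_fderiv_symm hf hW h]

theorem sum_smul_stdVec (y : Model n) : ∑ a, y a • stdVec a = y := by
  ext i
  simp [stdVec, Pi.single_apply]

theorem sum_dV_mul (hf : SmoothOn W f) (hW : IsOpen W) {x y : Model n} (h : (x, y) ∈ W)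
    (v : Model n) : ∑ a, dV a f x y * v a =
      fderiv ℝ (fun p : Model n × Model n => f p.1 p.2) (x, y) (0, v) := by
  have : ((0 : Model n), v) = ∑ a, v a • ((0 : Model n), (stdVec a : Model n)) := by
    refine Prod.ext ?_ ?_
    · simp [Prod.fst_sum]
    · simp [Prod.snd_sum, sum_smul_stdVec]
  rw [this, map_sum]
  refine Finset.sum_congr rfl fun a _ => ?_
  rw [map_smul, dV_eq hf hW h, smul_eq_mul, mul_comm]

theorem sum_dH_mul (hf : SmoothOn W f) (hW : IsOpen W) {x y : Model n} (h : (x, y) ∈ W)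
    (v : Model n) : ∑ a, dH a f x y * v a =
      fderiv ℝ (fun p : Model n × Model n => f p.1 p.2) (x, y) (v, 0) := by
  have : (v, (0 : Model n)) = ∑ a, v a • ((stdVec a : Model n), (0 : Model n)) := by
    refine Prod.ext ?_ ?_
    · simp [Prod.fst_sum, sum_smul_stdVec]
    · simp [Prod.snd_sum]
  rw [this, map_sum]
  refine Finset.sum_congr rfl fun a _ => ?_
  rw [map_smul, dH_eq hf hW h, smul_eq_mul, mul_comm]

/-! ### Positive homogeneity in y and Euler's theorem. -/

/-- `f (x, y)` is positively homogeneous in `y`, of degree `k`, on `W`. -/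
def HomogOn (k : ℤ) (W : Set (Model n × Model n)) (f : Model n → Model n → ℝ) : Prop :=
  ∀ p ∈ W, ∀ c : ℝ, 0 < c → f p.1 (c • p.2) = c ^ k * f p.1 p.2

/-- `W` is stable under positive scaling of `y`. -/
def Conic (W : Set (Model n × Model n)) : Prop :=
  ∀ p ∈ W, ∀ c : ℝ, 0 < c → (p.1, c • p.2) ∈ W

theorem HomogOn.congr {k : ℤ} (hf : HomogOn k W f) (hc : Conic W)
    (h : ∀ p ∈ W, g p.1 p.2 = f p.1 p.2) : HomogOn k W g := fun p hp c hc' => by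
  rw [h p hp, h _ (hc p hp c hc'), hf p hp c hc']

theorem HomogOn.mul {k l : ℤ} (hf : HomogOn k W f) (hg : HomogOn l W g) :
    HomogOn (k + l) W (fun x y => f x y * g x y) := fun p hp c hc => by
  simp only [hf p hp c hc, hg p hp c hc, zpow_add₀ hc.ne']; ring

theorem HomogOn.div {k l : ℤ} (hf : HomogOn k W f) (hg : HomogOn l W g) :
    HomogOn (k - l) W (fun x y => f x y / g x y) := fun p hp c hc => by
  simp only [hf p hp c hc, hg p hp c hc, zpow_sub₀ hc.ne']
  rw [mul_div_mul_comm]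

theorem HomogOn.sub {k : ℤ} (hf : HomogOn k W f) (hg : HomogOn k W g) :
    HomogOn k W (fun x y => f x y - g x y) := fun p hp c hc => by
  simp only [hf p hp c hc, hg p hp c hc]; ring

theorem HomogOn.const_mul {k : ℤ} (hf : HomogOn k W f) (r : ℝ) :
    HomogOn k W (fun x y => r * f x y) := fun p hp c hc => by
  simp only [hf p hp c hc]; ring

theorem HomogOn.sum {k : ℤ} {ι : Type*} {s : Finset ι} {F : ι → Model n → Model n → ℝ}
    (h : ∀ i ∈ s, HomogOn k W (F i)) : HomogOn k W (fun x y => ∑ i ∈ s, F i x y) :=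
  fun p hp c hc => by
    simp only [Finset.mul_sum]
    exact Finset.sum_congr rfl fun i hi => h i hi p hp c hc

theorem homogOn_snd (i : Fin n) : HomogOn 1 W (fun _ y => y i) := fun p _ c _ => by simp

theorem HomogOn.mul_snd {k : ℤ} (hf : HomogOn k W f) (j : Fin n) :
    HomogOn (k + 1) W (fun x y => f x y * y j) := hf.mul (homogOn_snd j)

/-- Differentiating f (x, c y) = c^k f (x, y) in y produces a factor c on the left, so the degree
drops by one. -/
theorem HomogOn.dV {k : ℤ} (hf : HomogOn k W f) (hW : IsOpen W) (hc : Conic W)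
    (hs : SmoothOn W f) (i : Fin n) : HomogOn (k - 1) W (dV i f) := by
  rintro ⟨x, y⟩ hp c hc'
  have h1 : HasFDerivAt (f x) (fderiv ℝ (f x) (c • y)) (c • y) :=
    (hs.hasFDerivAt_right hW (hc _ hp c hc')).hasFDerivAt
  have h2 : HasFDerivAt (fun z => f x (c • z))
      ((fderiv ℝ (f x) (c • y)).comp (c • ContinuousLinearMap.id ℝ (Model n))) y :=
    HasFDerivAt.comp y h1 ((hasFDerivAt_id y).const_smul c)
  have h3 : HasFDerivAt (fun z => c ^ k * f x z) (c ^ k • fderiv ℝ (f x) y) y :=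
    (hs.hasFDerivAt_right hW hp).hasFDerivAt.const_mul _
  have h4 := (h3.congr_of_eventuallyEq (by
    filter_upwards [eventually_mem_right hW hp] with z hz using hf _ hz c hc')).unique h2
  have h5 := congrArg (fun T => T (stdVec i)) h4
  simp only [_root_.smul_apply, ContinuousLinearMap.comp_apply,
    ContinuousLinearMap.id_apply, map_smul, smul_eq_mul] at h5
  simp only [Palatini.dV, zpow_sub₀ hc'.ne', zpow_one]
  field_simp
  linarith

theorem HomogOn.dH {k : ℤ} (hf : HomogOn k W f) (hW : IsOpen W) (hs : SmoothOn W f) (i : Fin n) :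
    HomogOn k W (dH i f) := by
  rintro ⟨x, y⟩ hp c hc'
  have h3 : (fun x' => f x' (c • y)) =ᶠ[nhds x] fun x' => c ^ k * f x' y := by
    filter_upwards [eventually_mem_left hW hp] with z hz using hf _ hz c hc'
  simp only [Palatini.dH]
  rw [h3.fderiv_eq, fderiv_const_mul (hs.hasFDerivAt_left hW hp)]; rfl

/-- Euler's theorem. -/
theorem HomogOn.euler {k : ℤ} (hf : HomogOn k W f) (hW : IsOpen W)
    (hs : SmoothOn W f) {x y : Model n} (hp : (x, y) ∈ W) :
    ∑ a, Palatini.dV a f x y * y a = k * f x y := by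
  have h1 : HasFDerivAt (f x) (fderiv ℝ (f x) y) ((1 : ℝ) • y) := by
    rw [one_smul]; exact (hs.hasFDerivAt_right hW hp).hasFDerivAt
  have h2 : HasDerivAt (fun t : ℝ => f x (t • y)) (fderiv ℝ (f x) y y) 1 := by
    have h0 : HasDerivAt (fun t : ℝ => t • y) y 1 := by
      simpa using (hasDerivAt_id (1 : ℝ)).smul_const y
    exact HasFDerivAt.comp_hasDerivAt (l := f x) (1 : ℝ) h1 h0
  have h3 : HasDerivAt (fun t : ℝ => t ^ k * f x y) (k * f x y) 1 := by
    simpa using (hasDerivAt_zpow k (1 : ℝ) (Or.inl one_ne_zero)).mul_const (f x y)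
  have h4 := (h3.congr_of_eventuallyEq (by
    filter_upwards [Ioi_mem_nhds (zero_lt_one (α := ℝ))] with t ht using hf _ hp t ht)).unique h2
  rw [h4]
  conv_rhs => rw [← sum_smul_stdVec y, map_sum]
  rw [sum_smul_stdVec]
  refine Finset.sum_congr rfl fun a _ => ?_
  simp [Palatini.dV, mul_comm]

end Calculus

/-! ### The metric in a chart -/

section LocalMetric

variable {n : ℕ} {M : Type*} [TopologicalSpace M] [ChartedSpace (Model n) M]
  [IsManifold (𝓡 n) ∞ M] {L : TM n M → ℝ} {e : Chart n M} {W : Set (Model n × Model n)}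

/-- On the open set `W` of coordinates, `L` is smooth with non-degenerate fundamental tensor. -/
structure RegularMetric (L : TM n M → ℝ) (e : Chart n M) (W : Set (Model n × Model n)) :
    Prop where
  isOpen : IsOpen W
  smooth : SmoothOn W (coordL L e)
  nondeg : ∀ p ∈ W, (gMat L e p.1 p.2).det ≠ 0

/-- A regular metric, `2`-homogeneous on a conic set of coordinates. -/
structure ConicMetric (L : TM n M → ℝ) (e : Chart n M) (W : Set (Model n × Model n)) : Prop
    extends RegularMetric L e W where
  conic : Conic W
  homog : HomogOn 2 W (coordL L e)

theorem SmoothOn.det {F : Model n → Model n → Matrix (Fin n) (Fin n) ℝ}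
    (h : ∀ i j, SmoothOn W fun x y => F x y i j) : SmoothOn W fun x y => (F x y).det := by
  simp only [Matrix.det_apply']
  exact SmoothOn.sum fun σ _ => (SmoothOn.prod fun i _ => h _ _).const_mul _

/-- Cramer's rule: adjugate and determinant are polynomials in the entries, and the inverse is their
quotient. -/
theorem SmoothOn.matrix_inv {F : Model n → Model n → Matrix (Fin n) (Fin n) ℝ}
    (h : ∀ i j, SmoothOn W fun x y => F x y i j) (hd : ∀ p ∈ W, (F p.1 p.2).det ≠ 0)
    (i j : Fin n) : SmoothOn W fun x y => (F x y)⁻¹ i j := by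
  have h1 : SmoothOn W fun x y => (F x y).adjugate i j := by
    simp only [Matrix.adjugate_apply]
    refine SmoothOn.det fun k l => ?_
    by_cases hk : k = j
    · subst hk
      simpa using smoothOn_const _
    · simpa [Matrix.updateRow_ne hk] using h k l
  have h2 := h1.div (SmoothOn.det h) hd
  refine h2.congr fun p hp => ?_
  rw [Matrix.inv_def]
  simp [Ring.inverse_eq_inv', div_eq_inv_mul]

/-! ### Consequences of smoothness and non-degeneracy alone, valid on a neighbourhood of the closure
of A. -/

namespace RegularMetric

variable (R : RegularMetric L e W)
include R

theorem mono {V : Set (Model n × Model n)} (hV : IsOpen V) (h : V ⊆ W) : RegularMetric L e V :=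
  ⟨hV, R.smooth.mono h, fun p hp => R.nondeg p (h hp)⟩

theorem smooth_gMat (i j : Fin n) : SmoothOn W fun x y => gMat L e x y i j :=
  ((R.smooth.dV R.isOpen i).dV R.isOpen j).const_mul _

theorem smooth_gInv (i j : Fin n) : SmoothOn W fun x y => gInv L e x y i j :=
  SmoothOn.matrix_inv R.smooth_gMat R.nondeg i j

theorem smooth_lowY (a : Fin n) : SmoothOn W (lowY L e a) :=
  SmoothOn.sum fun b _ => (R.smooth_gMat a b).mul (smoothOn_snd b)

theorem smooth_metricSpray (i : Fin n) : SmoothOn W fun x y => metricSpray L e x y i := by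
  refine SmoothOn.const_mul (SmoothOn.sum fun a _ => (R.smooth_gInv i a).mul
    (SmoothOn.sum fun b _ => SmoothOn.sum fun c _ => ?_)) _
  exact (((((R.smooth_gMat a b).dH R.isOpen c).const_mul 2).sub
    ((R.smooth_gMat b c).dH R.isOpen a)).mul (smoothOn_snd b)).mul (smoothOn_snd c)

theorem smooth_metricConn (i k : Fin n) : SmoothOn W fun x y => metricConn L e x y i k :=
  (R.smooth_metricSpray k).dV R.isOpen i

theorem smooth_meanCartan (i : Fin n) : SmoothOn W (meanCartan L e i) :=
  SmoothOn.sum fun a _ => SmoothOn.sum fun b _ => (R.smooth_gInv a b).mul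
    (((R.smooth_gMat a b).dV R.isOpen i).const_mul _)

theorem smooth_landsberg (i j k : Fin n) : SmoothOn W (landsberg L e i j k) := by
  refine SmoothOn.const_mul (SmoothOn.sub (SmoothOn.sub (SmoothOn.sub ?_ ?_) ?_) ?_) _
  · exact (R.smooth_gMat i j).dH R.isOpen k
  · exact SmoothOn.sum fun a _ => (R.smooth_metricConn k a).mul ((R.smooth_gMat i j).dV R.isOpen a)
  · exact SmoothOn.sum fun a _ => ((R.smooth_metricConn k a).dV R.isOpen i).mul (R.smooth_gMat a j)
  · exact SmoothOn.sum fun a _ => ((R.smooth_metricConn k a).dV R.isOpen j).mul (R.smooth_gMat i a)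

theorem smooth_meanLandsberg (i : Fin n) : SmoothOn W (meanLandsberg L e i) :=
  SmoothOn.sum fun a _ => SmoothOn.sum fun b _ => (R.smooth_gInv a b).mul (R.smooth_landsberg a b i)

theorem gMat_symm {x y : Model n} (h : (x, y) ∈ W) (i j : Fin n) :
    gMat L e x y i j = gMat L e x y j i := by
  simp [gMat, dV_comm R.smooth R.isOpen h i j]

theorem gInv_mul {x y : Model n} (h : (x, y) ∈ W) (i j : Fin n) :
    ∑ a, gInv L e x y i a * gMat L e x y a j = if i = j then 1 else 0 := by
  have := Matrix.nonsing_inv_mul _ (isUnit_iff_ne_zero.2 (R.nondeg _ h))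
  rw [← Matrix.one_apply, ← this, Matrix.mul_apply]; rfl

theorem mul_gInv {x y : Model n} (h : (x, y) ∈ W) (i j : Fin n) :
    ∑ a, gMat L e x y i a * gInv L e x y a j = if i = j then 1 else 0 := by
  have := Matrix.mul_nonsing_inv _ (isUnit_iff_ne_zero.2 (R.nondeg _ h))
  rw [← Matrix.one_apply, ← this, Matrix.mul_apply]; rfl

/-- Vectors are determined by their contractions with the fundamental tensor. -/
theorem eq_gInv {x y : Model n} (h : (x, y) ∈ W) {u w : Fin n → ℝ}
    (hu : ∀ i, ∑ j, gMat L e x y i j * u j = w i) (k : Fin n) :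
    u k = ∑ i, gInv L e x y k i * w i := by
  simp only [← hu, Finset.mul_sum]
  rw [Finset.sum_comm]
  simp only [← mul_assoc, ← Finset.sum_mul, R.gInv_mul h]
  simp

theorem gMat_injective {x y : Model n} (h : (x, y) ∈ W) {u w : Fin n → ℝ}
    (hu : ∀ i, ∑ j, gMat L e x y i j * u j = ∑ j, gMat L e x y i j * w j) : u = w := by
  funext k
  rw [R.eq_gInv h hu k, ← R.eq_gInv h (fun _ => rfl) k]

theorem gMat_gInv_apply {x y : Model n} (h : (x, y) ∈ W) (w : Fin n → ℝ) (i : Fin n) :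
    ∑ j, gMat L e x y i j * ∑ k, gInv L e x y j k * w k = w i := by
  simp only [Finset.mul_sum]
  rw [Finset.sum_comm]
  simp only [← mul_assoc, ← Finset.sum_mul, R.mul_gInv h]
  simp

/-- Non-degeneracy alone suffices, so this applies on the boundary too, where y_a y^a = 0. -/
theorem exists_lowY_ne_zero {x y : Model n} (h : (x, y) ∈ W) (hy : y ≠ 0) : ∃ a, lowY L e a x y ≠ 0 := by
  by_contra! H
  apply hy
  have := R.gMat_injective h (u := y) (w := 0) fun i => by simpa [lowY] using H i
  ext i
  exact congrFun this i

/-- N^L is a vertical gradient of the spray, so its lack of torsion is the symmetry of second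
derivatives. -/
theorem metricConn_symm {x y : Model n} (h : (x, y) ∈ W) (i j k : Fin n) :
    dV j (fun x y => metricConn L e x y i k) x y = dV i (fun x y => metricConn L e x y j k) x y :=
  dV_comm (R.smooth_metricSpray k) R.isOpen h j i

end RegularMetric

/-! ### Consequences of 2-homogeneity: Euler identities and the geometry of the metric spray. -/

namespace ConicMetric

variable (R : ConicMetric L e W)
include R

theorem homog_gMat (i j : Fin n) : HomogOn 0 W fun x y => gMat L e x y i j :=
  ((R.homog.dV R.isOpen R.conic R.smooth i).dV R.isOpen R.conic (R.smooth.dV R.isOpen i) j).const_mul _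

theorem homog_gInv (i j : Fin n) : HomogOn 0 W fun x y => gInv L e x y i j := by
  intro p hp c hc
  have : gMat L e p.1 (c • p.2) = gMat L e p.1 p.2 := by
    ext i j; simpa using R.homog_gMat i j p hp c hc
  simp [gInv, this]

theorem homog_lowY (a : Fin n) : HomogOn 1 W (lowY L e a) :=
  HomogOn.sum fun b _ => (R.homog_gMat a b).mul_snd b

theorem homog_metricSpray (i : Fin n) : HomogOn 2 W fun x y => metricSpray L e x y i := by
  refine HomogOn.const_mul (HomogOn.sum fun a _ => (R.homog_gInv i a).mul (l := 2)
    (HomogOn.sum fun b _ => HomogOn.sum fun c _ => ?_)) _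
  exact (HomogOn.mul_snd (k := 0) (HomogOn.sub
    (((R.homog_gMat a b).dH R.isOpen (R.smooth_gMat a b) c).const_mul 2)
    ((R.homog_gMat b c).dH R.isOpen (R.smooth_gMat b c) a)) b).mul_snd c

theorem homog_metricConn (i k : Fin n) : HomogOn 1 W fun x y => metricConn L e x y i k :=
  (R.homog_metricSpray k).dV R.isOpen R.conic (R.smooth_metricSpray k) i

variable {x y : Model n} (h : (x, y) ∈ W)
include h

/-- Euler's theorem for L_{·a}, which has degree one. -/
theorem lowY_eq (a : Fin n) : lowY L e a x y = 1 / 2 * dV a (coordL L e) x y := by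
  have := (R.homog.dV R.isOpen R.conic R.smooth a).euler R.isOpen (R.smooth.dV R.isOpen a) h
  simp only [lowY, gMat, Matrix.of_apply, mul_assoc, ← Finset.mul_sum, this]
  push_cast; ring

theorem dV_coordL (a : Fin n) : dV a (coordL L e) x y = 2 * lowY L e a x y := by
  rw [R.lowY_eq h]; ring

theorem sum_lowY_mul : ∑ a, lowY L e a x y * y a = coordL L e x y := by
  have := R.homog.euler R.isOpen R.smooth h
  simp only [R.lowY_eq h, mul_assoc, ← Finset.mul_sum, this]
  push_cast; ring

theorem dV_lowY (a b : Fin n) : dV b (lowY L e a) x y = gMat L e x y a b := by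
  rw [dV_congr (g := fun x y => 1 / 2 * dV a (coordL L e) x y) R.isOpen
      (fun p hp => R.lowY_eq hp a) h,
    dV_const_mul R.isOpen h b (R.smooth.dV R.isOpen a)]
  rfl

/-- Each g_{ab} has degree zero, so g_{ab·c} y^c = 0. -/
theorem sum_meanCartan_mul : ∑ a, meanCartan L e a x y * y a = 0 := by
  simp only [meanCartan, Finset.sum_mul]
  rw [Finset.sum_comm]
  refine Finset.sum_eq_zero fun a _ => ?_
  rw [Finset.sum_comm]
  refine Finset.sum_eq_zero fun b _ => ?_
  have := (R.homog_gMat a b).euler R.isOpen (R.smooth_gMat a b) h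
  simp only [mul_assoc, ← Finset.mul_sum, this]
  simp

/-- The metric spray satisfies the Euler-Lagrange equations. -/
theorem gMat_metricSpray (a : Fin n) :
    4 * ∑ i, gMat L e x y a i * metricSpray L e x y i =
      ∑ c, dH c (dV a (coordL L e)) x y * y c - dH a (coordL L e) x y := by
  have h1 : ∑ i, gMat L e x y a i * metricSpray L e x y i = 1 / 4 * ∑ b, ∑ c,
      (2 * dH c (fun x y => gMat L e x y a b) x y - dH a (fun x y => gMat L e x y b c) x y) *
      y b * y c := by
    rw [← R.gMat_gInv_apply h (fun a => ∑ b, ∑ c,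
      (2 * dH c (fun x y => gMat L e x y a b) x y - dH a (fun x y => gMat L e x y b c) x y) *
      y b * y c) a, Finset.mul_sum]
    refine Finset.sum_congr rfl fun i _ => ?_
    simp only [metricSpray]; ring
  -- Writing L_{·a} = 2 g_{ab} y^b and L = g_{bc} y^b y^c turns the position derivatives of L into
  -- those of g that define the spray.
  have h2 : ∀ c, dH c (dV a (coordL L e)) x y =
      2 * ∑ b, dH c (fun x y => gMat L e x y a b) x y * y b := by
    intro c
    rw [dH_congr (g := fun x y => 2 * lowY L e a x y) R.isOpen (fun p hp => R.dV_coordL hp a) h,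
      dH_const_mul R.isOpen h c (R.smooth_lowY a)]
    congr 1
    exact dH_sum_mul_snd R.isOpen h c fun b => R.smooth_gMat a b
  have h3 : dH a (coordL L e) x y =
      ∑ c, ∑ b, dH a (fun x y => gMat L e x y b c) x y * y b * y c := by
    rw [dH_congr (g := fun x y => ∑ a, lowY L e a x y * y a) R.isOpen
      (fun p hp => (R.sum_lowY_mul hp).symm) h,
      dH_sum_mul_snd R.isOpen h a fun b => R.smooth_lowY b]
    refine Finset.sum_congr rfl fun c _ => ?_
    rw [← Finset.sum_mul]
    congr 1
    have := dH_sum_mul_snd R.isOpen h a fun b => R.smooth_gMat c b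
    refine this.trans (Finset.sum_congr rfl fun b _ => ?_)
    congr 1
    exact dH_congr R.isOpen (fun p hp => R.gMat_symm hp c b) h a
  rw [h1, h3, Finset.sum_comm]
  simp only [h2, Finset.mul_sum, Finset.sum_mul, ← Finset.sum_sub_distrib]
  refine Finset.sum_congr rfl fun c _ => Finset.sum_congr rfl fun b _ => ?_
  ring

theorem sum_metricConn_mul (k : Fin n) :
    ∑ a, metricConn L e x y a k * y a = 2 * metricSpray L e x y k := by
  have := (R.homog_metricSpray k).euler R.isOpen (R.smooth_metricSpray k) h
  simpa [metricConn] using this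

/-- `L` is constant along the metric spray. -/
theorem sum_dH_coordL_mul : ∑ c, dH c (coordL L e) x y * y c =
    ∑ c, 2 * metricSpray L e x y c * dV c (coordL L e) x y := by
  -- This is the left side of the Euler-Lagrange equations contracted with y^a; on the right,
  -- Euler's theorem leaves 2 ∂_c L y^c - ∂_c L y^c.
  have h1 : ∑ a, (4 * ∑ i, gMat L e x y a i * metricSpray L e x y i) * y a =
      ∑ c, 2 * metricSpray L e x y c * dV c (coordL L e) x y := by
    simp only [R.dV_coordL h, lowY, Finset.mul_sum, Finset.sum_mul]
    rw [Finset.sum_comm]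
    refine Finset.sum_congr rfl fun c _ => Finset.sum_congr rfl fun b _ => ?_
    rw [R.gMat_symm h b c]; ring
  have h2 : ∀ c, dH c (coordL L e) x y = 1 / 2 * ∑ a, dH c (dV a (coordL L e)) x y * y a := by
    intro c
    rw [← dH_sum_mul_snd R.isOpen h c fun a => R.smooth.dV R.isOpen a,
      ← dH_const_mul R.isOpen h c
        (SmoothOn.sum fun a _ => (R.smooth.dV R.isOpen a).mul (smoothOn_snd a))]
    refine dH_congr R.isOpen (fun p hp => ?_) h c
    rw [R.homog.euler R.isOpen R.smooth hp]; push_cast; ring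
  have h3 : ∑ a, (∑ c, dH c (dV a (coordL L e)) x y * y c) * y a =
      2 * ∑ c, dH c (coordL L e) x y * y c := by
    simp only [h2, Finset.sum_mul, Finset.mul_sum]
    rw [Finset.sum_comm]
    refine Finset.sum_congr rfl fun c _ => Finset.sum_congr rfl fun b _ => ?_
    ring
  simp only [R.gMat_metricSpray h, sub_mul, Finset.sum_sub_distrib, h3] at h1
  linarith

/-- The derivative of the fundamental tensor along the metric spray. -/
theorem metricSpray_compat (a b : Fin n) :
    ∑ c, dH c (fun x y => gMat L e x y a b) x y * y c -
        ∑ c, 2 * metricSpray L e x y c * dV c (fun x y => gMat L e x y a b) x y =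
      ∑ c, gMat L e x y a c * metricConn L e x y b c +
        ∑ c, gMat L e x y b c * metricConn L e x y a c := by
  -- The Euler-Lagrange equations differentiated in y^b. Adding the same identity with a and b
  -- exchanged cancels the antisymmetric part ∂_b L_{·a} - ∂_a L_{·b}.
  have key : ∀ a b, 4 * (∑ i, dV b (fun x y => gMat L e x y a i) x y * metricSpray L e x y i +
      ∑ i, gMat L e x y a i * metricConn L e x y b i) =
      2 * ∑ c, dH c (fun x y => gMat L e x y a b) x y * y c + dH b (dV a (coordL L e)) x y -
        dH a (dV b (coordL L e)) x y := by
    intro a b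
    have hs : ∀ i, SmoothOn W fun x y => gMat L e x y a i * metricSpray L e x y i :=
      fun i => (R.smooth_gMat a i).mul (R.smooth_metricSpray i)
    have h1 := dV_congr (f := fun x y => 4 * ∑ i, gMat L e x y a i * metricSpray L e x y i)
      (g := fun x y => ∑ c, dH c (dV a (coordL L e)) x y * y c - dH a (coordL L e) x y)
      R.isOpen (fun p hp => R.gMat_metricSpray hp a) h b
    rw [dV_const_mul R.isOpen h b (SmoothOn.sum fun i _ => hs i),
      dV_sum R.isOpen h b (fun i _ => hs i),
      dV_sub R.isOpen h b (SmoothOn.sum fun c _ =>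
        ((R.smooth.dV R.isOpen a).dH R.isOpen c).mul (smoothOn_snd c)) (R.smooth.dH R.isOpen a),
      dV_sum_mul_snd R.isOpen h b fun c => (R.smooth.dV R.isOpen a).dH R.isOpen c,
      dV_dH_comm R.smooth R.isOpen h] at h1
    rw [← Finset.sum_add_distrib]
    refine Eq.trans ?_ (h1.trans ?_)
    · congr 1
      exact Finset.sum_congr rfl fun i _ =>
        (dV_mul R.isOpen h b (R.smooth_gMat a i) (R.smooth_metricSpray i)).symm
    · rw [Finset.mul_sum]
      congr 2
      refine Finset.sum_congr rfl fun c _ => ?_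
      rw [dV_dH_comm (R.smooth.dV R.isOpen a) R.isOpen h, ← mul_assoc]
      congr 1
      rw [← dH_const_mul R.isOpen h c (R.smooth_gMat a b)]
      refine dH_congr R.isOpen (fun p hp => ?_) h c
      simp [gMat]
  -- Total symmetry of g_{ab·i}, half a third vertical derivative of L.
  have cart : ∀ a b i, dV b (fun x y => gMat L e x y a i) x y =
      dV i (fun x y => gMat L e x y a b) x y := by
    intro a b i
    have := dV_comm (R.smooth.dV R.isOpen a) R.isOpen h b i
    have hs := R.smooth.dV R.isOpen a
    simp only [gMat, Matrix.of_apply]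
    rw [dV_const_mul R.isOpen h b (hs.dV R.isOpen i), dV_const_mul R.isOpen h i (hs.dV R.isOpen b),
      this]
  have e1 := key a b
  have e2 := key b a
  have h5 : ∀ c, dH c (fun x y => gMat L e x y b a) x y = dH c (fun x y => gMat L e x y a b) x y :=
    fun c => dH_congr R.isOpen (fun p hp => R.gMat_symm hp b a) h c
  have h6 : ∀ c, dV c (fun x y => gMat L e x y b a) x y = dV c (fun x y => gMat L e x y a b) x y :=
    fun c => dV_congr R.isOpen (fun p hp => R.gMat_symm hp b a) h c
  simp only [cart, h5, h6] at e1 e2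
  have h7 : ∑ c, 2 * metricSpray L e x y c * dV c (fun x y => gMat L e x y a b) x y =
      2 * ∑ i, dV i (fun x y => gMat L e x y a b) x y * metricSpray L e x y i := by
    rw [Finset.mul_sum]
    exact Finset.sum_congr rfl fun i _ => by ring
  rw [h7]
  linarith

/-- Contraction with y^k turns N_k^a into 2 G^a and, by symmetry of Γ and homogeneity of N^L, turns
Γ_{ki}^a y^k into N_i^a. What remains is `metricSpray_compat`. -/
theorem sum_landsberg_mul (a b : Fin n) : ∑ k, landsberg L e a b k x y * y k = 0 := by
  have h1 := R.metricSpray_compat h a b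
  have h2 : ∀ i c, ∑ k, dV i (fun x y => metricConn L e x y k c) x y * y k =
      metricConn L e x y i c := by
    intro i c
    have := (R.homog_metricConn i c).euler R.isOpen (R.smooth_metricConn i c) h
    simp only [Int.cast_one, one_mul] at this
    rw [← this]
    exact Finset.sum_congr rfl fun k _ => by rw [R.metricConn_symm h k i c]
  have h3 : ∀ c, ∑ k, metricConn L e x y k c * y k = 2 * metricSpray L e x y c :=
    R.sum_metricConn_mul h
  have h4 : ∑ k, delta (metricConn L) e k (fun x y => gMat L e x y a b) x y * y k =
      ∑ c, dH c (fun x y => gMat L e x y a b) x y * y c -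
        ∑ c, 2 * metricSpray L e x y c * dV c (fun x y => gMat L e x y a b) x y := by
    simp only [delta, sub_mul, Finset.sum_sub_distrib, ← h3, Finset.sum_mul]
    congr 1
    rw [Finset.sum_comm]
    exact Finset.sum_congr rfl fun c _ => Finset.sum_congr rfl fun k _ => by ring
  have h5 : ∀ i (g : Fin n → ℝ), ∑ k, (∑ c, dV i (fun x y => metricConn L e x y k c) x y * g c) * y k
      = ∑ c, g c * metricConn L e x y i c := by
    intro i g
    simp only [← h2, Finset.sum_mul, Finset.mul_sum]
    rw [Finset.sum_comm]
    exact Finset.sum_congr rfl fun c _ => Finset.sum_congr rfl fun k _ => by ring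
  simp only [landsberg, mul_assoc, ← Finset.mul_sum]
  simp only [sub_mul, Finset.sum_sub_distrib, h5, h4, h1]
  have h6 : ∑ c, gMat L e x y c b * metricConn L e x y a c =
      ∑ c, gMat L e x y b c * metricConn L e x y a c :=
    Finset.sum_congr rfl fun c _ => by rw [R.gMat_symm h c b]
  rw [h6]; ring

theorem sum_meanLandsberg_mul : ∑ k, meanLandsberg L e k x y * y k = 0 := by
  simp only [meanLandsberg, Finset.sum_mul]
  rw [Finset.sum_comm]
  refine Finset.sum_eq_zero fun a _ => ?_
  rw [Finset.sum_comm]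
  refine Finset.sum_eq_zero fun b _ => ?_
  simp only [mul_assoc, ← Finset.mul_sum, R.sum_landsberg_mul h, mul_zero]

end ConicMetric

end LocalMetric

/-! ### The affine equation in a chart -/

section LocalSolution

variable {n : ℕ} {M : Type*} [TopologicalSpace M] [ChartedSpace (Model n) M]
  [IsManifold (𝓡 n) ∞ M]

/-- The vector `𝒥_a^k y^a`. -/
def quadJ (L : TM n M → ℝ) (N : Coeffs n M) (e : Chart n M) (k : Fin n) (x y : Model n) : ℝ :=
  ∑ a, diffJ L N e a k x y * y a

/-- The torsion term `(𝒥_{i·a}^j - 𝒥_{a·i}^j) y^a`. -/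
def torJ (L : TM n M → ℝ) (N : Coeffs n M) (e : Chart n M) (i j : Fin n) (x y : Model n) : ℝ :=
  ∑ a, (dV a (diffJ L N e i j) x y - dV i (diffJ L N e a j) x y) * y a

/-- The contraction of the bracket with `y`, expressed by the torsion. -/
def bracketTrace (L : TM n M → ℝ) (N : Coeffs n M) (e : Chart n M) (x y : Model n) : ℝ :=
  (1 - (n : ℝ))⁻¹ * ∑ i, torJ L N e i i x y

/-- The bracket of the affine equation, expressed by the torsion. -/
def bracketExt (L : TM n M → ℝ) (N : Coeffs n M) (e : Chart n M) (b : Fin n)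
    (x y : Model n) : ℝ :=
  (∑ j, (torJ L N e b j x y + bracketTrace L N e x y * (if b = j then 1 else 0)) * y j) /
    ∑ j, y j * y j

/-- The quotient of `y_a 𝒥_b^a` by `L`. -/
def quotJ (L : TM n M → ℝ) (N : Coeffs n M) (e : Chart n M) (b : Fin n) (x y : Model n) : ℝ :=
  ((n : ℝ) + 2)⁻¹ * (bracketExt L N e b x y - 2 * meanLandsberg L e b x y
    + 2 * ∑ a, meanCartan L e a x y * diffJ L N e b a x y
    + ∑ a, (dV a (diffJ L N e b a) x y + dV b (diffJ L N e a a) x y))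

/-- The quotient of `y_a 𝒥_b^a y^b` by `L`. -/
def quotQ (L : TM n M → ℝ) (N : Coeffs n M) (e : Chart n M) (x y : Model n) : ℝ :=
  ∑ b, quotJ L N e b x y * y b

/-- The one-form `κ` in `g_{ij} 𝒥_a^j y^a = (2 λ - τ) y_i + L κ_i`. -/
def remForm (L : TM n M → ℝ) (N : Coeffs n M) (e : Chart n M) (i : Fin n) (x y : Model n) : ℝ :=
  dV i (quotQ L N e) x y + bracketExt L N e i x y - 2 * quotJ L N e i x y

/-- The vector `κ^k`. -/
def remVec (L : TM n M → ℝ) (N : Coeffs n M) (e : Chart n M) (k : Fin n) (x y : Model n) : ℝ :=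
  ∑ i, gInv L e x y k i * remForm L N e i x y

variable {L : TM n M → ℝ} {N : Coeffs n M} {e : Chart n M} {W : Set (Model n × Model n)}

/-- A regular metric and a smooth connection on a set of coordinates of non-zero vectors. -/
structure RegularPair (L : TM n M → ℝ) (N : Coeffs n M) (e : Chart n M)
    (W : Set (Model n × Model n)) : Prop extends RegularMetric L e W where
  smooth_conn : ∀ i k, SmoothOn W fun x y => N e x y i k
  vec_ne_zero : ∀ p ∈ W, p.2 ≠ 0

/-- A solution of the affine equation of a homogeneous metric without lightlike vectors. -/
structure LocalSolution (L : TM n M → ℝ) (N : Coeffs n M) (e : Chart n M)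
    (W : Set (Model n × Model n)) : Prop extends ConicMetric L e W where
  smooth_conn : ∀ i k, SmoothOn W fun x y => N e x y i k
  vec_ne_zero : ∀ p ∈ W, p.2 ≠ 0
  homog_conn : ∀ i k, HomogOn 1 W fun x y => N e x y i k
  metric_ne_zero : ∀ p ∈ W, coordL L e p.1 p.2 ≠ 0
  eqn : ∀ p ∈ W, ∀ i j, affineLHS L N e i j p.1 p.2 = 0
  two_le : 2 ≤ n

theorem sum_mul_self_ne_zero {y : Model n} (hy : y ≠ 0) : ∑ j, y j * y j ≠ 0 := by
  intro h
  apply hy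
  ext j
  have := (Finset.sum_eq_zero_iff_of_nonneg fun j _ => mul_self_nonneg (y j)).1 h j
    (Finset.mem_univ j)
  simpa using this

/-! ### Smoothness of the auxiliary quantities wherever the metric and the connection are smooth. -/

namespace RegularPair

variable (R : RegularPair L N e W)
include R

theorem smooth_diffJ (i k : Fin n) : SmoothOn W (diffJ L N e i k) :=
  (R.smooth_conn i k).sub (R.smooth_metricConn i k)

theorem smooth_quadJ (k : Fin n) : SmoothOn W (quadJ L N e k) :=
  SmoothOn.sum fun a _ => (R.smooth_diffJ a k).mul (smoothOn_snd a)

theorem smooth_torJ (i j : Fin n) : SmoothOn W (torJ L N e i j) :=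
  SmoothOn.sum fun a _ => (((R.smooth_diffJ i j).dV R.isOpen a).sub
    ((R.smooth_diffJ a j).dV R.isOpen i)).mul (smoothOn_snd a)

theorem smooth_bracketTrace : SmoothOn W (bracketTrace L N e) :=
  (SmoothOn.sum fun i _ => R.smooth_torJ i i).const_mul _

theorem smooth_bracketExt (b : Fin n) : SmoothOn W (bracketExt L N e b) := by
  refine SmoothOn.div (SmoothOn.sum fun j _ => ((R.smooth_torJ b j).add
    (R.smooth_bracketTrace.mul (smoothOn_const _))).mul (smoothOn_snd j))
    (SmoothOn.sum fun j _ => (smoothOn_snd j).mul (smoothOn_snd j)) fun p hp => ?_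
  exact sum_mul_self_ne_zero (R.vec_ne_zero p hp)

theorem smooth_quotJ (b : Fin n) : SmoothOn W (quotJ L N e b) := by
  refine SmoothOn.const_mul (SmoothOn.add (SmoothOn.add (SmoothOn.sub (R.smooth_bracketExt b)
    ((R.smooth_meanLandsberg b).const_mul 2)) (SmoothOn.const_mul (SmoothOn.sum fun a _ =>
    (R.smooth_meanCartan a).mul (R.smooth_diffJ b a)) 2)) (SmoothOn.sum fun a _ => ?_)) _
  exact ((R.smooth_diffJ b a).dV R.isOpen a).add ((R.smooth_diffJ a a).dV R.isOpen b)

theorem smooth_quotQ : SmoothOn W (quotQ L N e) :=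
  SmoothOn.sum fun b _ => (R.smooth_quotJ b).mul (smoothOn_snd b)

theorem smooth_remForm (i : Fin n) : SmoothOn W (remForm L N e i) :=
  ((R.smooth_quotQ.dV R.isOpen i).add (R.smooth_bracketExt i)).sub ((R.smooth_quotJ i).const_mul 2)

theorem smooth_remVec (k : Fin n) : SmoothOn W (remVec L N e k) :=
  SmoothOn.sum fun i _ => (R.smooth_gInv k i).mul (R.smooth_remForm i)

end RegularPair

/-! ### Algebraic consequences of the affine equation on A. -/

namespace LocalSolution

variable (R : LocalSolution L N e W)
include R

theorem toRegularPair : RegularPair L N e W :=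
  { R.toRegularMetric with smooth_conn := R.smooth_conn, vec_ne_zero := R.vec_ne_zero }

theorem homog_diffJ (i k : Fin n) : HomogOn 1 W (diffJ L N e i k) :=
  (R.homog_conn i k).sub (R.homog_metricConn i k)

variable {x y : Model n} (h : (x, y) ∈ W)
include h

theorem bracket_mul (i j : Fin n) : bracket L N e i x y * y j -
    (∑ b, bracket L N e b x y * y b) * (if i = j then 1 else 0) = torJ L N e i j x y := by
  have := R.eqn _ h i j
  simp only [affineLHS, sub_eq_zero] at this
  rw [torJ, ← this, Finset.sum_mul]
  simp only [mul_sub, Finset.sum_sub_distrib]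
  congr 1
  · rw [Finset.sum_eq_single i]
    · simp
    · intro b _ hb; simp [hb.symm]
    · simp
  · exact Finset.sum_congr rfl fun b _ => by ring

/-- The trace of the affine equation is (1 - n) B_b y^b = T_i^i, and n ≠ 1. -/
theorem bracketTrace_eq : bracketTrace L N e x y = ∑ b, bracket L N e b x y * y b := by
  have h2 : (1 - (n : ℝ)) ≠ 0 := by
    have := R.two_le
    have : (2 : ℝ) ≤ n := by exact_mod_cast this
    linarith
  simp only [bracketTrace, ← R.bracket_mul h, if_true, Finset.sum_sub_distrib]
  simp
  field_simp

/-- Contracting with y^j and dividing by the Euclidean square of y, instead of contracting with y_j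
and dividing by L, recovers B_b by an expression that still makes sense on the boundary. -/
theorem bracketExt_eq (b : Fin n) : bracketExt L N e b x y = bracket L N e b x y := by
  have h3 := sum_mul_self_ne_zero (R.vec_ne_zero _ h)
  rw [bracketExt, div_eq_iff h3, R.bracketTrace_eq h]
  simp only [← R.bracket_mul h, sub_add_cancel, Finset.mul_sum, mul_assoc]

/-- The definition of the bracket is solved for its only term with L in the denominator. Since
`quotJ` contains no division by L, this is a divisibility statement that remains meaningful at L =
0. -/
theorem sum_lowY_diffJ (b : Fin n) : ∑ a, lowY L e a x y * diffJ L N e b a x y =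
    coordL L e x y * quotJ L N e b x y := by
  have h1 := R.metric_ne_zero _ h
  have h2 : (n : ℝ) + 2 ≠ 0 := by positivity
  have h3 : ∑ a, lowY L e a x y / coordL L e x y * diffJ L N e b a x y =
      (∑ a, lowY L e a x y * diffJ L N e b a x y) / coordL L e x y := by
    rw [Finset.sum_div]
    exact Finset.sum_congr rfl fun a _ => by ring
  rw [quotJ, R.bracketExt_eq h, bracket, h3]
  field_simp
  ring

theorem sum_lowY_quadJ : ∑ a, lowY L e a x y * quadJ L N e a x y =
    coordL L e x y * quotQ L N e x y := by
  simp only [quadJ, quotQ, Finset.mul_sum, ← mul_assoc, ← R.sum_lowY_diffJ h, Finset.sum_mul]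
  rw [Finset.sum_comm]

theorem sum_dV_diffJ_mul (i j : Fin n) : ∑ a, dV a (diffJ L N e i j) x y * y a =
    diffJ L N e i j x y := by
  have := (R.homog_diffJ i j).euler R.isOpen (R.toRegularPair.smooth_diffJ i j) h
  simpa using this

theorem dV_quadJ (i j : Fin n) : dV i (quadJ L N e j) x y =
    ∑ a, dV i (diffJ L N e a j) x y * y a + diffJ L N e i j x y :=
  dV_sum_mul_snd R.isOpen h i fun a => R.toRegularPair.smooth_diffJ a j

/-- The affine equation, with `𝒥_a^j y^a` in place of the torsion. -/
theorem affine_eqn (i j : Fin n) : bracketExt L N e i x y * y j -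
    bracketTrace L N e x y * (if i = j then 1 else 0) =
      2 * diffJ L N e i j x y - dV i (quadJ L N e j) x y := by
  rw [R.bracketExt_eq h, R.bracketTrace_eq h, R.bracket_mul h, R.dV_quadJ h, torJ]
  simp only [sub_mul, Finset.sum_sub_distrib, R.sum_dV_diffJ_mul h]
  ring

/-- In the bracket contracted with y the Landsberg term drops out, and the last two terms combine
into the divergence Q^a_{·a}: by 1-homogeneity J_{a·b}^a y^b = J_a^a, which is the part of the
divergence coming from the derivative of y. -/
theorem sum_bracket_mul : bracketTrace L N e x y = ((n : ℝ) + 2) * quotQ L N e x y -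
    2 * ∑ a, meanCartan L e a x y * quadJ L N e a x y - ∑ a, dV a (quadJ L N e a) x y := by
  have h1 := R.metric_ne_zero _ h
  have h3 : ∀ b, ∑ a, lowY L e a x y / coordL L e x y * diffJ L N e b a x y =
      quotJ L N e b x y := fun b => by
    have : ∑ a, lowY L e a x y / coordL L e x y * diffJ L N e b a x y =
        (∑ a, lowY L e a x y * diffJ L N e b a x y) / coordL L e x y := by
      rw [Finset.sum_div]
      exact Finset.sum_congr rfl fun a _ => by ring
    rw [this, R.sum_lowY_diffJ h]; field_simp
  have h4 : ∑ b, (∑ a, meanCartan L e a x y * diffJ L N e b a x y) * y b =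
      ∑ a, meanCartan L e a x y * quadJ L N e a x y := by
    simp only [quadJ, Finset.mul_sum, Finset.sum_mul, mul_assoc]
    rw [Finset.sum_comm]
  have h5 : ∑ b, (∑ a, (dV a (diffJ L N e b a) x y + dV b (diffJ L N e a a) x y)) * y b =
      ∑ a, dV a (quadJ L N e a) x y := by
    simp only [R.dV_quadJ h, ← R.sum_dV_diffJ_mul h, Finset.sum_mul]
    rw [Finset.sum_comm]
    refine Finset.sum_congr rfl fun a _ => ?_
    rw [← Finset.sum_add_distrib]
    exact Finset.sum_congr rfl fun b _ => by ring
  rw [R.bracketTrace_eq h, ← h5, ← h4]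
  simp only [bracket, h3, sub_mul, add_mul, Finset.sum_sub_distrib, Finset.sum_add_distrib,
    mul_assoc, ← Finset.mul_sum, R.sum_meanLandsberg_mul h]
  simp only [quotQ]
  ring

/-- The lowered vector `g_{ij} 𝒥_a^j y^a` is a combination of `y_i` and a multiple of `L`. -/
theorem gMat_quadJ (i : Fin n) : ∑ j, gMat L e x y i j * quadJ L N e j x y =
    (2 * quotQ L N e x y - bracketTrace L N e x y) * lowY L e i x y +
      coordL L e x y * remForm L N e i x y := by
  have P := R.toRegularPair
  -- The affine equation contracted with y_j, using y_j y^j = L.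
  have h1 : ∑ j, lowY L e j x y * (bracketExt L N e i x y * y j -
      bracketTrace L N e x y * (if i = j then 1 else 0)) =
      bracketExt L N e i x y * coordL L e x y - bracketTrace L N e x y * lowY L e i x y := by
    simp only [mul_sub, Finset.sum_sub_distrib]
    congr 1
    · rw [← R.sum_lowY_mul h, Finset.mul_sum]
      exact Finset.sum_congr rfl fun b _ => by ring
    · rw [Finset.sum_eq_single i]
      · simp [mul_comm]
      · intro b _ hb; simp [hb.symm]
      · simp
  simp only [R.affine_eqn h, mul_sub, Finset.sum_sub_distrib] at h1
  have h2 : ∑ j, lowY L e j x y * (2 * diffJ L N e i j x y) =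
      2 * (coordL L e x y * quotJ L N e i x y) := by
    rw [← R.sum_lowY_diffJ h, Finset.mul_sum]
    exact Finset.sum_congr rfl fun b _ => by ring
  -- The vertical derivative of y_a Q^a = L λ. Its term y_a Q^a_{·i} is eliminated by means of the
  -- contracted equation.
  have h3 := dV_congr (f := fun x y => ∑ a, lowY L e a x y * quadJ L N e a x y)
    (g := fun x y => coordL L e x y * quotQ L N e x y) R.isOpen
    (fun p hp => R.sum_lowY_quadJ hp) h i
  rw [dV_mul R.isOpen h i R.smooth P.smooth_quotQ,
    dV_sum R.isOpen h i fun a _ => (R.smooth_lowY a).mul (P.smooth_quadJ a), R.dV_coordL h] at h3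
  have h4 : ∀ a, dV i (fun x y => lowY L e a x y * quadJ L N e a x y) x y =
      gMat L e x y i a * quadJ L N e a x y + lowY L e a x y * dV i (quadJ L N e a) x y := by
    intro a
    rw [dV_mul R.isOpen h i (R.smooth_lowY a) (P.smooth_quadJ a), R.dV_lowY h, R.gMat_symm h]
  simp only [h4, Finset.sum_add_distrib] at h3
  rw [remForm]
  linarith

/-- The index of `gMat_quadJ` is raised. Once extended to the boundary, where L = 0, only the
multiple of y survives, and pregeodesics do not see it. -/
theorem quadJ_eq (k : Fin n) : quadJ L N e k x y =
    (2 * quotQ L N e x y - bracketTrace L N e x y) * y k +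
      coordL L e x y * remVec L N e k x y := by
  rw [R.eq_gInv h (fun i => R.gMat_quadJ h i) k]
  have hy := R.eq_gInv h (u := y) (w := fun i => lowY L e i x y) (fun i => rfl) k
  rw [hy, remVec, Finset.mul_sum, Finset.mul_sum, ← Finset.sum_add_distrib]
  exact Finset.sum_congr rfl fun b _ => by ring

-- On A, q_b is the quotient of y_a J_b^a by L, both of degree two; the degrees of the separate
-- terms of `quotJ` need not be tracked.
omit h in
theorem homog_quotJ (b : Fin n) : HomogOn 0 W (quotJ L N e b) := by
  have : HomogOn (1 + 1 - 2) W fun x y =>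
      (∑ a, lowY L e a x y * diffJ L N e b a x y) / coordL L e x y :=
    HomogOn.div (HomogOn.sum fun a _ => (R.homog_lowY a).mul (R.homog_diffJ b a)) R.homog
  refine HomogOn.congr (k := 1 + 1 - 2) this R.conic fun p hp => ?_
  rw [R.sum_lowY_diffJ hp, mul_div_cancel_left₀ _ (R.metric_ne_zero p hp)]

theorem sum_dV_quotJ_mul (b : Fin n) : ∑ a, dV a (quotJ L N e b) x y * y a = 0 := by
  simpa using (R.homog_quotJ b).euler R.isOpen (R.toRegularPair.smooth_quotJ b) h

theorem sum_dV_quotQ_mul : ∑ a, dV a (quotQ L N e) x y * y a = quotQ L N e x y := by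
  have : HomogOn (0 + 1) W (quotQ L N e) := HomogOn.sum fun b _ => (R.homog_quotJ b).mul_snd b
  simpa using this.euler R.isOpen R.toRegularPair.smooth_quotQ h

/-- N is symmetric by hypothesis and N^L always is, hence so is their difference. -/
theorem torJ_eq_zero_of_symm (hs : ∀ i j k : Fin n, dV j (fun x y => N e x y i k) x y -
      dV i (fun x y => N e x y j k) x y = 0) (i j : Fin n) : torJ L N e i j x y = 0 := by
  refine Finset.sum_eq_zero fun a _ => ?_
  have h1 : ∀ i a, dV a (diffJ L N e i j) x y = dV a (fun x y => N e x y i j) x y -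
      dV a (fun x y => metricConn L e x y i j) x y := fun i a =>
    dV_sub R.isOpen h a (R.smooth_conn i j) (R.smooth_metricConn i j)
  simp only [h1]
  rw [R.metricConn_symm h i a j]
  linear_combination (y a) * hs i a j

theorem bracketTrace_eq_zero_of_symm (hs : ∀ i j k : Fin n, dV j (fun x y => N e x y i k) x y -
      dV i (fun x y => N e x y j k) x y = 0) : bracketTrace L N e x y = 0 := by
  simp [bracketTrace, R.torJ_eq_zero_of_symm h hs]

/-- For a symmetric solution, `L` divides `(2 - n) y_a 𝒥_b^a y^b / L`. -/
theorem symm_quotQ (hs : ∀ p ∈ W, ∀ i j k : Fin n, dV j (fun x y => N e x y i k) p.1 p.2 -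
      dV i (fun x y => N e x y j k) p.1 p.2 = 0) :
    (2 - (n : ℝ)) * quotQ L N e x y = coordL L e x y *
      (2 * ∑ a, meanCartan L e a x y * remVec L N e a x y + ∑ a, dV a (remVec L N e a) x y) := by
  have P := R.toRegularPair
  have htor : ∀ p ∈ W, ∀ i j, torJ L N e i j p.1 p.2 = 0 := fun p hp =>
    R.torJ_eq_zero_of_symm hp (hs p hp)
  have htr : ∀ p ∈ W, bracketTrace L N e p.1 p.2 = 0 := fun p hp =>
    R.bracketTrace_eq_zero_of_symm hp (hs p hp)
  have hbr : ∀ b, bracketExt L N e b x y = 0 := fun b => by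
    simp [bracketExt, htor _ h, htr _ h]
  have hQ : ∀ k, ∀ p ∈ W, quadJ L N e k p.1 p.2 =
      2 * quotQ L N e p.1 p.2 * p.2 k + coordL L e p.1 p.2 * remVec L N e k p.1 p.2 :=
    fun k p hp => by rw [R.quadJ_eq hp, htr p hp, sub_zero]
  have hdQ : ∀ a, dV a (quadJ L N e a) x y = 2 * (dV a (quotQ L N e) x y * y a) +
      2 * quotQ L N e x y + (2 * (lowY L e a x y * remVec L N e a x y) +
        coordL L e x y * dV a (remVec L N e a) x y) := by
    intro a
    rw [dV_congr (g := fun x y => 2 * quotQ L N e x y * y a +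
        coordL L e x y * remVec L N e a x y) R.isOpen (hQ a) h,
      dV_add R.isOpen h a ((P.smooth_quotQ.const_mul 2).mul (smoothOn_snd a))
        (R.smooth.mul (P.smooth_remVec a)),
      dV_mul_snd R.isOpen h a a (P.smooth_quotQ.const_mul 2),
      dV_const_mul R.isOpen h a P.smooth_quotQ, dV_mul R.isOpen h a R.smooth (P.smooth_remVec a),
      R.dV_coordL h, if_pos rfl]
    ring
  -- Without torsion B = 0 and κ_i = λ_{·i} - 2 q_i; Euler's theorem for λ, of degree one, gives κ_i
  -- y^i = λ - 2 λ.
  have hrem : ∑ a, lowY L e a x y * remVec L N e a x y = - quotQ L N e x y := by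
    have h1 : ∑ a, lowY L e a x y * remVec L N e a x y = ∑ i, remForm L N e i x y * y i := by
      have h2 : ∀ i, remForm L N e i x y = ∑ a, gMat L e x y i a * remVec L N e a x y :=
        fun i => (R.gMat_gInv_apply h (fun i => remForm L N e i x y) i).symm
      simp only [h2, lowY, Finset.sum_mul]
      rw [Finset.sum_comm]
      refine Finset.sum_congr rfl fun a _ => Finset.sum_congr rfl fun b _ => ?_
      rw [R.gMat_symm h b a]; ring
    rw [h1]
    simp only [remForm, hbr, add_zero, sub_mul, Finset.sum_sub_distrib, R.sum_dV_quotQ_mul h,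
      mul_assoc, ← Finset.mul_sum]
    simp only [quotQ]
    ring
  have hC : ∑ a, meanCartan L e a x y * quadJ L N e a x y =
      coordL L e x y * ∑ a, meanCartan L e a x y * remVec L N e a x y := by
    have h1 : ∀ a, meanCartan L e a x y * quadJ L N e a x y =
        2 * quotQ L N e x y * (meanCartan L e a x y * y a) +
          coordL L e x y * (meanCartan L e a x y * remVec L N e a x y) := fun a => by
      rw [hQ a _ h]; ring
    simp only [h1, Finset.sum_add_distrib, ← Finset.mul_sum, R.sum_meanCartan_mul h]
    ring
  -- The divergence of Q is 2 n λ + L κ^a_{·a}, because the contributions 2 λ_{·a} y^a and 2 y_a κ^a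
  -- cancel. Subtracted from (n + 2) λ, it leaves the coefficient 2 - n.
  have main := R.sum_bracket_mul h
  simp only [hdQ, Finset.sum_add_distrib, ← Finset.mul_sum, R.sum_dV_quotQ_mul h, hrem, hC,
    htr _ h, Finset.sum_const, Finset.card_univ, Fintype.card_fin, nsmul_eq_mul] at main
  linarith

/-- If `𝒥_a^k y^a` is proportional to `y^k`, then `𝒥_i^j = 𝒜_i y^j`. -/
theorem diffJ_eq_of_parallel (hp : ∀ p ∈ W, ∃ f : ℝ, ∀ k, quadJ L N e k p.1 p.2 = f * p.2 k)
    (i j : Fin n) : diffJ L N e i j x y = quotJ L N e i x y * y j ∧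
      bracketExt L N e i x y = 2 * quotJ L N e i x y - dV i (quotQ L N e) x y := by
  have P := R.toRegularPair
  -- Contraction with y_a identifies the pointwise factor f with the smooth function λ, which can be
  -- differentiated.
  have hQ : ∀ k, ∀ p ∈ W, quadJ L N e k p.1 p.2 = quotQ L N e p.1 p.2 * p.2 k := by
    intro k p hp'
    obtain ⟨f, hf⟩ := hp p hp'
    have h1 := R.sum_lowY_quadJ hp'
    have h2 : ∑ a, lowY L e a p.1 p.2 * (f * p.2 a) = coordL L e p.1 p.2 * f := by
      rw [← R.sum_lowY_mul hp', Finset.sum_mul]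
      exact Finset.sum_congr rfl fun b _ => by ring
    simp only [hf, h2] at h1
    rw [hf, mul_left_cancel₀ (R.metric_ne_zero p hp') h1]
  have hdQ : ∀ i j, dV i (quadJ L N e j) x y = dV i (quotQ L N e) x y * y j +
      if i = j then quotQ L N e x y else 0 := by
    intro i j
    rw [dV_congr (g := fun x y => quotQ L N e x y * y j) R.isOpen (hQ j) h,
      dV_mul_snd R.isOpen h i j P.smooth_quotQ]
  -- The divergence of λ y is (n + 1) λ, so τ = (n + 2) λ - (n + 1) λ.
  have htr : bracketTrace L N e x y = quotQ L N e x y := by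
    have h1 : ∑ a, meanCartan L e a x y * quadJ L N e a x y = 0 := by
      have h2 : ∀ a, meanCartan L e a x y * quadJ L N e a x y =
          quotQ L N e x y * (meanCartan L e a x y * y a) := fun a => by rw [hQ a _ h]; ring
      simp only [h2, ← Finset.mul_sum, R.sum_meanCartan_mul h, mul_zero]
    rw [R.sum_bracket_mul h, h1]
    simp only [hdQ, if_true, Finset.sum_add_distrib, R.sum_dV_quotQ_mul h]
    simp
    ring
  -- As τ = λ, the two multiples of δ_i^j in the affine equation cancel and only a multiple of y^j
  -- is left. Contraction with y_j then identifies its factor.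
  have hJ : ∀ i j, diffJ L N e i j x y =
      1 / 2 * (bracketExt L N e i x y + dV i (quotQ L N e) x y) * y j := by
    intro i j
    have := R.affine_eqn h i j
    rw [hdQ, htr] at this
    split_ifs at this <;> linarith
  have hA : 1 / 2 * (bracketExt L N e i x y + dV i (quotQ L N e) x y) = quotJ L N e i x y := by
    have h1 := R.sum_lowY_diffJ h i
    have h2 : ∀ r : ℝ, ∑ a, lowY L e a x y * (r * y a) = coordL L e x y * r := fun r => by
      rw [← R.sum_lowY_mul h, Finset.sum_mul]
      exact Finset.sum_congr rfl fun b _ => by ring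
    simp only [hJ, h2] at h1
    exact mul_left_cancel₀ (R.metric_ne_zero _ h) h1
  refine ⟨by rw [hJ, hA], by linarith⟩

/-- For J_i^j = q_i y^j the bracket is by definition 2 Lan_b + (n + 2) q_b - n q_b - λ_{·b}, since q
has degree zero and C_a y^a = 0. The affine equation makes it 2 q_b - λ_{·b}, so the Landsberg term
must vanish. -/
theorem meanLandsberg_eq_zero_of_parallel
    (hp : ∀ p ∈ W, ∃ f : ℝ, ∀ k, quadJ L N e k p.1 p.2 = f * p.2 k) (b : Fin n) :
    meanLandsberg L e b x y = 0 := by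
  have P := R.toRegularPair
  have hJ : ∀ i j, ∀ p ∈ W, diffJ L N e i j p.1 p.2 = quotJ L N e i p.1 p.2 * p.2 j :=
    fun i j p hp' => (R.diffJ_eq_of_parallel hp' hp i j).1
  have h1 : ∑ a, dV a (diffJ L N e b a) x y = n * quotJ L N e b x y := by
    have h2 : ∀ a, dV a (diffJ L N e b a) x y =
        dV a (quotJ L N e b) x y * y a + quotJ L N e b x y := fun a => by
      rw [dV_congr (g := fun x y => quotJ L N e b x y * y a) R.isOpen (hJ b a) h,
        dV_mul_snd R.isOpen h a a (P.smooth_quotJ b), if_pos rfl]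
    simp [h2, Finset.sum_add_distrib, R.sum_dV_quotJ_mul h]
  have h3 : ∑ a, dV b (diffJ L N e a a) x y = dV b (quotQ L N e) x y := by
    rw [← dV_sum R.isOpen h b fun a _ => P.smooth_diffJ a a]
    exact dV_congr R.isOpen (fun p hp' => Finset.sum_congr rfl fun a _ => hJ a a p hp') h b
  have h4 : ∑ a, meanCartan L e a x y * diffJ L N e b a x y = 0 := by
    have h2 : ∀ a, meanCartan L e a x y * diffJ L N e b a x y =
        quotJ L N e b x y * (meanCartan L e a x y * y a) := fun a => by rw [hJ b a _ h]; ring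
    simp only [h2, ← Finset.mul_sum, R.sum_meanCartan_mul h, mul_zero]
  have h5 : quotJ L N e b x y = ((n : ℝ) + 2)⁻¹ * (bracketExt L N e b x y -
      2 * meanLandsberg L e b x y + 2 * 0 + (n * quotJ L N e b x y + dV b (quotQ L N e) x y)) := by
    conv_lhs => rw [quotJ, h4, Finset.sum_add_distrib, h1, h3]
  have h6 := (R.diffJ_eq_of_parallel h hp b b).2
  have h7 : (n : ℝ) + 2 ≠ 0 := by positivity
  rw [eq_inv_mul_iff_mul_eq₀ h7] at h5
  linarith

end LocalSolution

end LocalSolution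

/-! ### Natural coordinates on the tangent bundle -/

section Coordinates

variable {n : ℕ} {M : Type*} [TopologicalSpace M] [ChartedSpace (Model n) M]
  [IsManifold (𝓡 n) ∞ M] {e e' : Chart n M}

theorem contMDiffOn_chart (e : Chart n M) : ContMDiffOn (𝓡 n) 𝓘(ℝ, Model n) ∞ e.1 e.1.source :=
  contMDiffOn_of_mem_maximalAtlas (IsManifold.subset_maximalAtlas e.2)

theorem contMDiffOn_chart_symm (e : Chart n M) :
    ContMDiffOn 𝓘(ℝ, Model n) (𝓡 n) ∞ e.1.symm e.1.target :=
  contMDiffOn_symm_of_mem_maximalAtlas (IsManifold.subset_maximalAtlas e.2)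

theorem tvec_eq_tangentMap (e : Chart n M) (x y : Model n) :
    tvec e x y = tangentMap 𝓘(ℝ, Model n) (𝓡 n) e.1.symm ⟨x, y⟩ := rfl

/-- Points of `E × E` as points of the tangent bundle of `E`. -/
def toTangent (n : ℕ) : ModelProd (Model n) (Model n) → TangentBundle 𝓘(ℝ, Model n) (Model n) :=
  (tangentBundleModelSpaceHomeomorph 𝓘(ℝ, Model n)).symm

/-- The inverse chart is smooth only on its target, so the smoothness of `tvec` is obtained from
`tangentMapWithin`. -/
theorem tvec_eqOn_tangentMapWithin (e : Chart n M) :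
    Set.EqOn (fun p : Model n × Model n => tvec e p.1 p.2)
      (tangentMapWithin 𝓘(ℝ, Model n) (𝓡 n) e.1.symm e.1.target ∘ toTangent n)
      {p | p.1 ∈ e.1.target} := by
  intro p hp
  have h1 : UniqueMDiffWithinAt 𝓘(ℝ, Model n) e.1.target (toTangent n p).proj :=
    e.1.open_target.uniqueMDiffOn p.1 hp
  have h2 : MDifferentiableAt 𝓘(ℝ, Model n) (𝓡 n) e.1.symm (toTangent n p).proj :=
    mdifferentiableAt_atlas_symm e.2 hp
  rw [Function.comp_apply, tangentMapWithin_eq_tangentMap h1 h2]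
  rfl

theorem isOpen_fst_preimage_target (e : Chart n M) :
    IsOpen {p : Model n × Model n | p.1 ∈ e.1.target} :=
  e.1.open_target.preimage continuous_fst

theorem contMDiffOn_tvec (e : Chart n M) :
    ContMDiffOn 𝓘(ℝ, Model n).tangent (𝓡 n).tangent ∞
      ((fun p => tvec e p.1 p.2) : ModelProd (Model n) (Model n) → TM n M)
      {p | p.1 ∈ e.1.target} := by
  have h1 := (contMDiffOn_chart_symm e).contMDiffOn_tangentMapWithin (m := ∞) (by simp)
    e.1.open_target.uniqueMDiffOn
  have h2 : ContMDiff 𝓘(ℝ, Model n).tangent 𝓘(ℝ, Model n).tangent ∞ (toTangent n) :=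
    contMDiff_tangentBundleModelSpaceHomeomorph_symm
  exact (h1.comp h2.contMDiffOn (fun p hp => hp)).congr (tvec_eqOn_tangentMapWithin e)

theorem continuousOn_tvec (e : Chart n M) :
    ContinuousOn (fun p : Model n × Model n => tvec e p.1 p.2) {p | p.1 ∈ e.1.target} :=
  (contMDiffOn_tvec e).continuousOn

theorem smoothOn_coordL {B : Set (TM n M)} {L : TM n M → ℝ}
    (hL : ContMDiffOn (𝓡 n).tangent 𝓘(ℝ, ℝ) ∞ L B) (e : Chart n M) :
    SmoothOn (dom e B) (coordL L e) := by
  have hs : (dom e B : Set (Model n × Model n)) ⊆ {p | p.1 ∈ e.1.target} := fun p hp => hp.1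
  have h0 := (contMDiffOn_tvec e).mono hs
  have h1 := hL.comp h0 fun p hp => hp.2
  -- The tangent model of a vector space is the model of its product with itself, so manifold
  -- smoothness becomes ordinary smoothness in (x, y).
  have h2 : (𝓘(ℝ, Model n).tangent : ModelWithCorners ℝ (Model n × Model n)
      (ModelProd (Model n) (Model n))) = 𝓘(ℝ, Model n × Model n) := modelWithCornersSelf_prod.symm
  rw [h2] at h1
  exact h1.contDiffOn

theorem isOpen_dom (e : Chart n M) {B : Set (TM n M)} (hB : IsOpen B) : IsOpen (dom e B) :=
  (continuousOn_tvec e).isOpen_inter_preimage (isOpen_fst_preimage_target e) hB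

/-! ### Inverse natural coordinates, closures and boundaries. -/

/-- The natural coordinates of a vector in the chart `e`. -/
def tcoord (e : Chart n M) (v : TM n M) : Model n × Model n :=
  (e.1 v.1, mfderiv (𝓡 n) 𝓘(ℝ, Model n) e.1 v.1 v.2)

theorem tcoord_tvec {p : Model n × Model n} (hp : p.1 ∈ e.1.target) :
    tcoord e (tvec e p.1 p.2) = p := by
  have h := (mdifferentiable_of_mem_atlas (I := 𝓡 n) e.2).comp_symm_deriv hp
  refine Prod.ext (e.1.right_inv hp) ?_
  exact congrArg (fun T => T p.2) h

theorem continuousOn_tcoord (e : Chart n M) :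
    ContinuousOn (tcoord e) {v : TM n M | v.1 ∈ e.1.source} := by
  have h1 := (contMDiffOn_chart e).continuousOn_tangentMapWithin (by simp)
    e.1.open_source.uniqueMDiffOn
  have h2 := (tangentBundleModelSpaceHomeomorph 𝓘(ℝ, Model n)).continuous.comp_continuousOn h1
  refine h2.congr fun v hv => ?_
  have h3 : tangentMapWithin (𝓡 n) 𝓘(ℝ, Model n) e.1 e.1.source v =
      tangentMap (𝓡 n) 𝓘(ℝ, Model n) e.1 v :=
    tangentMapWithin_eq_tangentMap (e.1.open_source.uniqueMDiffOn v.1 hv)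
      (mdifferentiableAt_atlas e.2 hv)
  rw [Function.comp_apply, h3]
  rfl

theorem isOpen_proj_preimage (e : Chart n M) : IsOpen {v : TM n M | v.1 ∈ e.1.source} :=
  e.1.open_source.preimage (FiberBundle.continuous_proj (Model n) (TangentSpace (𝓡 n) (M := M)))

theorem tangentMap_congr {N₁ N₂ : Type*} {H₁ H₂ E₁ E₂ : Type*} [NormedAddCommGroup E₁]
    [NormedSpace ℝ E₁] [NormedAddCommGroup E₂] [NormedSpace ℝ E₂] [TopologicalSpace H₁]
    [TopologicalSpace H₂] {I₁ : ModelWithCorners ℝ E₁ H₁} {I₂ : ModelWithCorners ℝ E₂ H₂}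
    [TopologicalSpace N₁] [ChartedSpace H₁ N₁] [TopologicalSpace N₂] [ChartedSpace H₂ N₂]
    {f g : N₁ → N₂} {v : TangentBundle I₁ N₁} (h : f =ᶠ[nhds v.1] g) :
    tangentMap I₁ I₂ f v = tangentMap I₁ I₂ g v := by
  refine Bundle.TotalSpace.ext h.eq_of_nhds (heq_of_eq ?_)
  exact congrArg (fun T : E₁ →L[ℝ] E₂ => T v.2) h.mfderiv_eq

theorem tvec_tcoord {v : TM n M} (hv : v.1 ∈ e.1.source) :
    tvec e (tcoord e v).1 (tcoord e v).2 = v := by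
  have h1 : tvec e (tcoord e v).1 (tcoord e v).2 = tangentMap 𝓘(ℝ, Model n) (𝓡 n) e.1.symm
      (tangentMap (𝓡 n) 𝓘(ℝ, Model n) e.1 v) := rfl
  rw [h1, ← tangentMap_comp_at _ (mdifferentiableAt_atlas_symm e.2 (e.1.map_source hv))
    (mdifferentiableAt_atlas e.2 hv)]
  have h2 : e.1.symm ∘ e.1 =ᶠ[nhds v.1] id := by
    filter_upwards [e.1.open_source.mem_nhds hv] with z hz using e.1.left_inv hz
  rw [tangentMap_congr h2, tangentMap_id, id]

theorem tcoord_mem_dom {S : Set (TM n M)} {v : TM n M} (hv : v.1 ∈ e.1.source) (hS : v ∈ S) :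
    tcoord e v ∈ dom e S :=
  ⟨e.1.map_source hv, by rw [tvec_tcoord hv]; exact hS⟩

/-- `tvec` and `tcoord` are continuous and mutually inverse over the chart. The closure is first
localized to the open set of vectors based there. -/
theorem tvec_mem_closure_iff {A : Set (TM n M)} {p : Model n × Model n} (hp : p.1 ∈ e.1.target) :
    tvec e p.1 p.2 ∈ closure A ↔ p ∈ closure (dom e A) := by
  constructor
  · intro h
    have hs : tvec e p.1 p.2 ∈ {v : TM n M | v.1 ∈ e.1.source} := e.1.map_target hp
    have h1 : tvec e p.1 p.2 ∈ closure ({v : TM n M | v.1 ∈ e.1.source} ∩ A) :=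
      (isOpen_proj_preimage e).inter_closure ⟨hs, h⟩
    have h2 := ((continuousOn_tcoord e).continuousAt
      ((isOpen_proj_preimage e).mem_nhds hs)).continuousWithinAt.mem_closure_image h1
    rw [tcoord_tvec hp] at h2
    refine closure_mono ?_ h2
    rintro _ ⟨v, hv, rfl⟩
    exact tcoord_mem_dom hv.1 hv.2
  · intro h
    have h2 := ((continuousOn_tvec e).continuousAt
      ((isOpen_fst_preimage_target e).mem_nhds hp)).continuousWithinAt.mem_closure_image h
    refine closure_mono ?_ h2
    rintro _ ⟨v, hv, rfl⟩
    exact hv.2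

theorem coordVec_eq_zero_iff {x y : Model n} (hx : x ∈ e.1.target) :
    coordVec e x y = 0 ↔ y = 0 := by
  constructor
  · intro h
    have h1 := tcoord_tvec (e := e) (p := (x, y)) hx
    have h2 : (tcoord e (tvec e x y)).2 = 0 := by
      have h3 : (tcoord e (tvec e x y)).2 =
        (mfderiv (𝓡 n) 𝓘(ℝ, Model n) e.1 (e.1.symm x) : Model n →L[ℝ] Model n)
          (coordVec e x y) := rfl
      rw [h3, h]
      exact map_zero _
    rw [h1] at h2
    exact h2
  · rintro rfl
    exact map_zero _

theorem mem_dom_closA {A : Set (TM n M)} {p : Model n × Model n} :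
    p ∈ dom e (closA A) ↔ p.1 ∈ e.1.target ∧ p ∈ closure (dom e A) ∧ p.2 ≠ 0 := by
  refine and_congr_right fun hp => ?_
  rw [closA, Set.mem_inter_iff, tvec_mem_closure_iff hp]
  refine and_congr_right fun _ => ?_
  exact not_congr (coordVec_eq_zero_iff hp)

theorem dom_closA_subset_closure {A : Set (TM n M)} : dom e (closA A) ⊆ closure (dom e A) :=
  fun _ hp => (mem_dom_closA.1 hp).2.1

theorem dom_mono {S T : Set (TM n M)} (h : S ⊆ T) : dom e S ⊆ dom e T :=
  fun _ hp => ⟨hp.1, h hp.2⟩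

theorem IsConicDomain.subset_closA {A : Set (TM n M)} (hA : IsConicDomain A) : A ⊆ closA A :=
  fun v hv => ⟨subset_closure hv, hA.ne_zero v.1 v.2 hv⟩

theorem IsConicDomain.conic_dom {A : Set (TM n M)} (hA : IsConicDomain A) (e : Chart n M) :
    Conic (dom e A) := by
  intro p hp c hc
  refine ⟨hp.1, ?_⟩
  have := hA.smul_mem _ _ hp.2 c hc
  rwa [← show coordVec e p.1 (c • p.2) = c • coordVec e p.1 p.2 from map_smul _ _ _] at this

theorem IsConicDomain.vec_ne_zero {A : Set (TM n M)} (hA : IsConicDomain A)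
    {p : Model n × Model n} (hp : p ∈ dom e A) : p.2 ≠ 0 := fun h =>
  hA.ne_zero _ _ hp.2 ((coordVec_eq_zero_iff hp.1).2 h)

theorem conic_dom_closA {A : Set (TM n M)} (hA : IsConicDomain A) (e : Chart n M) :
    Conic (dom e (closA A)) := by
  intro p hp c hc
  rw [mem_dom_closA] at hp ⊢
  refine ⟨hp.1, ?_, smul_ne_zero hc.ne' hp.2.2⟩
  have h1 : Continuous fun q : Model n × Model n => (q.1, c • q.2) := by fun_prop
  refine closure_mono ?_ (h1.continuousAt.continuousWithinAt.mem_closure_image hp.2.1)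
  rintro _ ⟨q, hq, rfl⟩
  exact hA.conic_dom e q hq c hc

theorem conic_dom_bdA {A : Set (TM n M)} (hA : IsConicDomain A) (e : Chart n M) :
    Conic (dom e (bdA A)) := by
  intro p hp c hc
  have h1 := conic_dom_closA hA e p ⟨hp.1, hp.2.1⟩ c hc
  refine ⟨h1.1, h1.2, fun h => hp.2.2 ?_⟩
  have := hA.conic_dom e (p.1, c • p.2) ⟨hp.1, h⟩ c⁻¹ (inv_pos.2 hc)
  simpa [smul_smul, hc.ne'] using this.2

/-! ### Changes of charts -/

/-- The coordinates of the chart `e` of the points in the domain of `e'`. -/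
def overlap (e e' : Chart n M) : Set (Model n) := e.1.target ∩ e.1.symm ⁻¹' e'.1.source

theorem isOpen_overlap (e e' : Chart n M) : IsOpen (overlap e e') :=
  e.1.isOpen_inter_preimage_symm e'.1.open_source

theorem contDiffOn_chg (e e' : Chart n M) : ContDiffOn ℝ ∞ (chg e e') (overlap e e') := by
  have h1 := (contMDiffOn_chart e').comp
    ((contMDiffOn_chart_symm e).mono (Set.inter_subset_left : overlap e e' ⊆ _)) (fun x hx => hx.2)
  exact h1.contDiffOn

theorem contDiffAt_chg {x : Model n} (hx : x ∈ overlap e e') : ContDiffAt ℝ ∞ (chg e e') x :=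
  (contDiffOn_chg e e').contDiffAt ((isOpen_overlap e e').mem_nhds hx)

theorem chg_mem_overlap {x : Model n} (hx : x ∈ overlap e e') : chg e e' x ∈ overlap e' e :=
  ⟨e'.1.map_source hx.2, by
    rw [Set.mem_preimage, chg, e'.1.left_inv hx.2]; exact e.1.map_target hx.1⟩

theorem chg_chg {x : Model n} (hx : x ∈ overlap e e') : chg e' e (chg e e' x) = x := by
  rw [chg, chg, e'.1.left_inv hx.2, e.1.right_inv hx.1]

theorem symm_chg {x : Model n} (hx : x ∈ overlap e e') :
    e'.1.symm (chg e e' x) = e.1.symm x := e'.1.left_inv hx.2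

/-- The chain rule for the inverse of `e'` composed with `chg e e'`, which agrees with the inverse
of `e` near x. -/
theorem tvec_chg {x : Model n} (hx : x ∈ overlap e e') (y : Model n) :
    tvec e' (chg e e' x) (fderiv ℝ (chg e e') x y) = tvec e x y := by
  have h1 : tvec e' (chg e e' x) (fderiv ℝ (chg e e') x y) =
      tangentMap 𝓘(ℝ, Model n) (𝓡 n) e'.1.symm
        (tangentMap 𝓘(ℝ, Model n) 𝓘(ℝ, Model n) (chg e e') ⟨x, y⟩) := by
    rw [tvec_eq_tangentMap, tangentMap, tangentMap, tangentMap, mfderiv_eq_fderiv]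
    rfl
  have h2 : MDifferentiableAt 𝓘(ℝ, Model n) 𝓘(ℝ, Model n) (chg e e') x :=
    ((contDiffAt_chg hx).differentiableAt (by simp)).mdifferentiableAt
  rw [h1, tvec_eq_tangentMap, ← tangentMap_comp_at _
    (mdifferentiableAt_atlas_symm e'.2 (chg_mem_overlap hx).1) h2]
  refine tangentMap_congr ?_
  filter_upwards [(isOpen_overlap e e').mem_nhds hx] with z hz using symm_chg hz

theorem mem_dom_chg {S : Set (TM n M)} {p : Model n × Model n} (hp : p ∈ dom e S)
    (hx : p.1 ∈ overlap e e') : (chg e e' p.1, fderiv ℝ (chg e e') p.1 p.2) ∈ dom e' S :=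
  ⟨(chg_mem_overlap hx).1, by
    have := hp.2
    rwa [← tvec_chg hx] at this⟩

theorem coordL_chg {L : TM n M → ℝ} {x : Model n} (hx : x ∈ overlap e e') (y : Model n) :
    coordL L e' (chg e e' x) (fderiv ℝ (chg e e') x y) = coordL L e x y := by
  rw [coordL, tvec_chg hx, coordL]

theorem fderiv_chg_fderiv_chg {x : Model n} (hx : x ∈ overlap e e') (y : Model n) :
    fderiv ℝ (chg e' e) (chg e e' x) (fderiv ℝ (chg e e') x y) = y := by
  have h1 : (chg e' e ∘ chg e e') =ᶠ[nhds x] id := by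
    filter_upwards [(isOpen_overlap e e').mem_nhds hx] with z hz using chg_chg hz
  have h2 := fderiv_comp x ((contDiffAt_chg (chg_mem_overlap hx)).differentiableAt (by simp))
    ((contDiffAt_chg hx).differentiableAt (by simp))
  rw [h1.fderiv_eq, fderiv_id] at h2
  exact (congrArg (fun T => T y) h2).symm

theorem fderiv_chg_fderiv_chg' {x : Model n} (hx : x ∈ overlap e e') (y : Model n) :
    fderiv ℝ (chg e e') x (fderiv ℝ (chg e' e) (chg e e' x) y) = y := by
  have := fderiv_chg_fderiv_chg (chg_mem_overlap hx) y
  rwa [chg_chg hx] at this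

/-- The second derivative of the change of charts. -/
def chgHess (e e' : Chart n M) (x : Model n) : Model n →L[ℝ] Model n →L[ℝ] Model n :=
  fderiv ℝ (fderiv ℝ (chg e e')) x

theorem hasFDerivAt_fderiv_chg {x : Model n} (hx : x ∈ overlap e e') :
    HasFDerivAt (fderiv ℝ (chg e e')) (chgHess e e' x) x :=
  (((contDiffAt_chg hx).fderiv_right (m := ∞) (by simp)).differentiableAt (by simp)).hasFDerivAt

theorem chgHess_symm {x : Model n} (hx : x ∈ overlap e e') (u v : Model n) :
    chgHess e e' x u v = chgHess e e' x v u :=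
  ((contDiffAt_chg hx).isSymmSndFDerivAt (by simpa using ENat.LEInfty.out)).eq u v

/-- Differentiating D (chg e' e) ∘ D (chg e e') = id trades the second derivatives of the inverse
change, which occur in the definition of a connection, for those of the change itself. -/
theorem chgHess_inv {x : Model n} (hx : x ∈ overlap e e') (u v : Model n) :
    fderiv ℝ (chg e e') x (chgHess e' e (chg e e' x) (fderiv ℝ (chg e e') x u)
      (fderiv ℝ (chg e e') x v)) = - chgHess e e' x u v := by
  have h1 : (fun z => fderiv ℝ (chg e' e) (chg e e' z) (fderiv ℝ (chg e e') z v)) =ᶠ[nhds x]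
      fun _ => v := by
    filter_upwards [(isOpen_overlap e e').mem_nhds hx] with z hz using fderiv_chg_fderiv_chg hz v
  have h2 : HasFDerivAt (fun z => fderiv ℝ (chg e' e) (chg e e' z))
      ((chgHess e' e (chg e e' x)).comp (fderiv ℝ (chg e e') x)) x :=
    HasFDerivAt.comp x (hasFDerivAt_fderiv_chg (chg_mem_overlap hx))
      ((contDiffAt_chg hx).differentiableAt (by simp)).hasFDerivAt
  have h3 : HasFDerivAt (fun z => fderiv ℝ (chg e e') z v) ((chgHess e e' x).flip v) x := by
    simpa using (hasFDerivAt_fderiv_chg hx).clm_apply (hasFDerivAt_const v x)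
  have h4 := ((hasFDerivAt_const v x).congr_of_eventuallyEq h1).unique (h2.clm_apply h3)
  have h5 := congrArg (fun T => T u) h4
  simp only [_root_.add_apply, ContinuousLinearMap.comp_apply,
    ContinuousLinearMap.flip_apply, _root_.zero_apply] at h5
  have h6 := congrArg (fun w => fderiv ℝ (chg e e') x w) h5
  simp only [map_add, map_zero, fderiv_chg_fderiv_chg' hx] at h6
  exact eq_neg_of_add_eq_zero_right h6.symm

end Coordinates

/-! ### The metric connection under changes of charts -/

section Transformation

variable {n : ℕ} {M : Type*} [TopologicalSpace M] [ChartedSpace (Model n) M]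
  [IsManifold (𝓡 n) ∞ M] {e e' : Chart n M} {A : Set (TM n M)} {L : TM n M → ℝ}

theorem clm_apply_coord (T : Model n →L[ℝ] Model n) (v : Model n) (k : Fin n) :
    T v k = ∑ c, T (stdVec c) k * v c := by
  conv_lhs => rw [← sum_smul_stdVec v, map_sum]
  simp [mul_comm]

theorem clm_apply_sum (T : Model n →L[ℝ] ℝ) (v : Model n) :
    T v = ∑ c, T (stdVec c) * v c := by
  conv_lhs => rw [← sum_smul_stdVec v, map_sum]
  simp [mul_comm]

theorem IsPseudoFinsler.conicMetric (hL : IsPseudoFinsler A L) (e : Chart n M) :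
    ConicMetric L e (dom e A) where
  isOpen := isOpen_dom e hL.conic.isOpen
  smooth := smoothOn_coordL hL.smooth e
  nondeg := hL.nondeg e
  conic := hL.conic.conic_dom e
  homog := fun p hp c hc => by
    have := hL.homog _ _ hp.2 c hc
    rw [← show coordVec e p.1 (c • p.2) = c • coordVec e p.1 p.2 from map_smul _ _ _] at this
    exact_mod_cast this

/-- The derivative of `L` in the chart `e`. -/
def fderivL (L : TM n M → ℝ) (e : Chart n M) : Model n × Model n → Model n × Model n →L[ℝ] ℝ :=
  fderiv ℝ fun p => coordL L e p.1 p.2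

/-- The metric spray as a vector. -/
def sprayVec (L : TM n M → ℝ) (e : Chart n M) (x y : Model n) : Model n :=
  WithLp.toLp 2 fun i => metricSpray L e x y i

theorem RegularMetric.hasFDerivAt_fderivL {W : Set (Model n × Model n)}
    (R : RegularMetric L e W) {p : Model n × Model n} (h : p ∈ W) :
    HasFDerivAt (fderivL L e) (fderiv ℝ (fderivL L e) p) p :=
  (((R.smooth.contDiffAt R.isOpen h).fderiv_right (m := ∞) (by simp)).differentiableAt
    (by simp)).hasFDerivAt

theorem RegularMetric.fderiv_fderivL_vert {W : Set (Model n × Model n)}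
    (R : RegularMetric L e W) {x y : Model n} (h : (x, y) ∈ W) (u : Model n) (a : Fin n) :
    fderiv ℝ (fderivL L e) (x, y) (0, u) (0, stdVec a) = 2 * ∑ i, gMat L e x y a i * u i := by
  have h1 := sum_dV_mul (R.smooth.dV R.isOpen a) R.isOpen h u
  have h2 : (fun p : Model n × Model n => dV a (coordL L e) p.1 p.2) =ᶠ[nhds (x, y)]
      fun p => fderivL L e p (0, stdVec a) := by
    filter_upwards [R.isOpen.mem_nhds h] with p hp using dV_eq R.smooth R.isOpen hp a
  rw [h2.fderiv_eq, fderivL, fderiv_fderiv_apply R.smooth R.isOpen h] at h1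
  rw [fderivL, ← h1, Finset.mul_sum]
  refine Finset.sum_congr rfl fun i _ => ?_
  simp [gMat]; ring

/-- The Euler-Lagrange equations of the metric spray, without coordinates. -/
theorem ConicMetric.euler_lagrange {W : Set (Model n × Model n)}
    (R : ConicMetric L e W) {x y : Model n} (h : (x, y) ∈ W) (v : Model n) :
    2 * fderiv ℝ (fderivL L e) (x, y) (0, sprayVec L e x y) (0, v) =
      fderiv ℝ (fderivL L e) (x, y) (y, 0) (0, v) - fderivL L e (x, y) (v, 0) := by
  set D := fderiv ℝ (fderivL L e) (x, y) with hD
  let inr := ContinuousLinearMap.inr ℝ (Model n) (Model n)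
  let inl := ContinuousLinearMap.inl ℝ (Model n) (Model n)
  have hb : ∀ a, 2 * D (0, sprayVec L e x y) (0, stdVec a) =
      D (y, 0) (0, stdVec a) - fderivL L e (x, y) (stdVec a, 0) := by
    intro a
    rw [hD, R.fderiv_fderivL_vert h]
    have h1 := sum_dH_mul (R.smooth.dV R.isOpen a) R.isOpen h y
    have h2 : (fun p : Model n × Model n => dV a (coordL L e) p.1 p.2) =ᶠ[nhds (x, y)]
        fun p => fderivL L e p (0, stdVec a) := by
      filter_upwards [R.isOpen.mem_nhds h] with p hp using dV_eq R.smooth R.isOpen hp a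
    rw [h2.fderiv_eq, fderivL, fderiv_fderiv_apply R.smooth R.isOpen h] at h1
    have h3 := R.gMat_metricSpray h a
    rw [dH_eq R.smooth R.isOpen h, h1] at h3
    rw [fderivL, ← h3]
    simp only [sprayVec]; ring
  have e1 := clm_apply_sum ((D (0, sprayVec L e x y)).comp inr) v
  have e2 := clm_apply_sum ((D (y, 0)).comp inr) v
  have e3 := clm_apply_sum ((fderivL L e (x, y)).comp inl) v
  simp only [ContinuousLinearMap.comp_apply, inr, inl, ContinuousLinearMap.inr_apply,
    ContinuousLinearMap.inl_apply] at e1 e2 e3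
  rw [e1, e2, e3, Finset.mul_sum, ← Finset.sum_sub_distrib]
  refine Finset.sum_congr rfl fun a _ => ?_
  linear_combination (v a) * hb a

/-- The change of natural coordinates. -/
def tchg (e e' : Chart n M) (p : Model n × Model n) : Model n × Model n :=
  (chg e e' p.1, fderiv ℝ (chg e e') p.1 p.2)

/-- The derivative of the change of natural coordinates. -/
def tchgDeriv (e e' : Chart n M) (p : Model n × Model n) :
    Model n × Model n →L[ℝ] Model n × Model n :=
  ((fderiv ℝ (chg e e') p.1).comp (ContinuousLinearMap.fst ℝ _ _)).prod
    ((fderiv ℝ (chg e e') p.1).comp (ContinuousLinearMap.snd ℝ _ _) +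
      ((chgHess e e' p.1).flip p.2).comp (ContinuousLinearMap.fst ℝ _ _))

theorem tchgDeriv_apply (p u : Model n × Model n) : tchgDeriv e e' p u =
    (fderiv ℝ (chg e e') p.1 u.1, fderiv ℝ (chg e e') p.1 u.2 + chgHess e e' p.1 u.1 p.2) := rfl

theorem hasFDerivAt_tchg {p : Model n × Model n} (hp : p.1 ∈ overlap e e') :
    HasFDerivAt (tchg e e') (tchgDeriv e e' p) p := by
  have h1 : HasFDerivAt (fun q : Model n × Model n => chg e e' q.1) _ p :=
    HasFDerivAt.comp (g := chg e e') (f := Prod.fst) p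
      ((contDiffAt_chg hp).differentiableAt (by simp)).hasFDerivAt hasFDerivAt_fst
  have h2 : HasFDerivAt (fun q : Model n × Model n => fderiv ℝ (chg e e') q.1) _ p :=
    HasFDerivAt.comp (g := fderiv ℝ (chg e e')) (f := Prod.fst) p
      (hasFDerivAt_fderiv_chg hp) hasFDerivAt_fst
  refine (h1.prodMk (h2.clm_apply hasFDerivAt_snd)).congr_fderiv ?_
  rfl

/-- The transformation law of the metric spray. -/
theorem IsPseudoFinsler.sprayVec_chg (hL : IsPseudoFinsler A L) {x y : Model n}
    (h : (x, y) ∈ dom e A) (hx : x ∈ overlap e e') :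
    sprayVec L e' (chg e e' x) (fderiv ℝ (chg e e') x y) =
      fderiv ℝ (chg e e') x (sprayVec L e x y) - (1 / 2 : ℝ) • chgHess e e' x y y := by
  have R := hL.conicMetric e
  have R' := hL.conicMetric e'
  have h' : tchg e e' (x, y) ∈ dom e' A := mem_dom_chg h hx
  have hopen : ∀ᶠ p : Model n × Model n in nhds (x, y), p ∈ dom e A ∧ p.1 ∈ overlap e e' :=
    (R.isOpen.inter ((isOpen_overlap e e').preimage continuous_fst)).mem_nhds ⟨h, hx⟩
  -- The invariance of L differentiated once, at all nearby points so that it can be differentiated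
  -- again.
  have hF : ∀ p : Model n × Model n, p ∈ dom e A → p.1 ∈ overlap e e' →
      fderivL L e p = (fderivL L e' (tchg e e' p)).comp (tchgDeriv e e' p) := by
    intro p hp hx
    have h1 : (fun p : Model n × Model n => coordL L e p.1 p.2) =ᶠ[nhds p]
        (fun p => coordL L e' p.1 p.2) ∘ tchg e e' := by
      filter_upwards [((isOpen_overlap e e').preimage continuous_fst).mem_nhds hx] with q hq
        using (coordL_chg hq q.2).symm
    have hp' : tchg e e' p ∈ dom e' A := mem_dom_chg hp hx
    rw [fderivL, h1.fderiv_eq]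
    exact ((R'.smooth.differentiableAt R'.isOpen hp').hasFDerivAt.comp p
      (hasFDerivAt_tchg hx)).fderiv
  set D := fderiv ℝ (fderivL L e) (x, y) with hD
  set D' := fderiv ℝ (fderivL L e') (tchg e e' (x, y)) with hD'
  -- With one argument vertical, the second derivatives of L involve the Hessian of the change of
  -- charts but no third derivatives.
  have hD2 : ∀ (u : Model n × Model n) (v : Model n), D u (0, v) =
      D' (tchgDeriv e e' (x, y) u) (0, fderiv ℝ (chg e e') x v) +
        fderivL L e' (tchg e e' (x, y)) (0, chgHess e e' x u.1 v) := by
    intro u v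
    have h1 : (fun p => fderivL L e p (0, v)) =ᶠ[nhds (x, y)]
        fun p => fderivL L e' (tchg e e' p) (0, fderiv ℝ (chg e e') p.1 v) := by
      filter_upwards [hopen] with p hp
      rw [hF p hp.1 hp.2, ContinuousLinearMap.comp_apply, tchgDeriv_apply]
      simp
    have h2 : HasFDerivAt (fun p => fderivL L e' (tchg e e' p))
        (D'.comp (tchgDeriv e e' (x, y))) (x, y) :=
      (R'.hasFDerivAt_fderivL h').comp (x, y) (hasFDerivAt_tchg hx)
    have h3 : HasFDerivAt (fun q : Model n × Model n => fderiv ℝ (chg e e') q.1) _ (x, y) :=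
      HasFDerivAt.comp (g := fderiv ℝ (chg e e')) (f := Prod.fst) (x, y)
        (hasFDerivAt_fderiv_chg hx) hasFDerivAt_fst
    have h4 := (hasFDerivAt_const (0 : Model n) (x, y)).prodMk
      (h3.clm_apply (hasFDerivAt_const v (x, y)))
    have h5 := (h2.clm_apply h4).congr_of_eventuallyEq h1
    have h6 := ((R.hasFDerivAt_fderivL h).clm_apply
      (hasFDerivAt_const ((0 : Model n), v) (x, y))).unique h5
    have h7 := congrArg (fun T => T u) h6
    simp only [_root_.add_apply, ContinuousLinearMap.comp_apply,
      ContinuousLinearMap.flip_apply, ContinuousLinearMap.prod_apply, _root_.zero_apply,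
      map_zero, zero_add] at h7
    rw [hD, h7, add_comm]
    simp
  -- Comparing the Euler-Lagrange equations in the two charts, twice the discrepancy in the claimed
  -- law is orthogonal to every vector. On vertical vectors D' is 2 g, which is non-degenerate.
  have E1 : ∀ v, D' (0, (2 : ℝ) • fderiv ℝ (chg e e') x (sprayVec L e x y) -
      chgHess e e' x y y - (2 : ℝ) • sprayVec L e' (chg e e' x) (fderiv ℝ (chg e e') x y))
        (0, fderiv ℝ (chg e e') x v) = 0 := by
    intro v
    have e1 := R.euler_lagrange h v
    have e2 := R'.euler_lagrange (x := chg e e' x) (y := fderiv ℝ (chg e e') x y) h'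
      (fderiv ℝ (chg e e') x v)
    rw [← hD, hD2, hD2, hF _ h hx] at e1
    simp only [tchgDeriv_apply, ContinuousLinearMap.comp_apply, map_zero, zero_add, add_zero,
      _root_.zero_apply, Prod.mk_zero_zero] at e1
    change 2 * D' _ _ = D' _ _ - fderivL L e' (tchg e e' (x, y)) _ at e2
    have s1 : ∀ a b : Model n, D' (a, b) = D' (a, 0) + D' (0, b) := fun a b => by
      rw [← map_add]; simp
    have s2 : ∀ a b : Model n, fderivL L e' (tchg e e' (x, y)) (a, b) =
      fderivL L e' (tchg e e' (x, y)) (a, 0) + fderivL L e' (tchg e e' (x, y)) (0, b) :=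
      fun a b => by rw [← map_add]; simp
    have s3 : ∀ a b : Model n, D' (0, a - b) = D' (0, a) - D' (0, b) := fun a b => by
      rw [← map_sub]; simp
    have s4 : ∀ (r : ℝ) (a : Model n), D' (0, r • a) = r • D' (0, a) := fun r a => by
      rw [← map_smul]; simp
    rw [s1 (fderiv ℝ (chg e e') x y), s2 (fderiv ℝ (chg e e') x v), chgHess_symm hx v y] at e1
    simp only [s3, s4, _root_.sub_apply, _root_.smul_apply, smul_eq_mul]
    simp only [_root_.add_apply] at e1
    linarith
  have E2 := R'.gMat_injective (x := chg e e' x) (y := fderiv ℝ (chg e e') x y) h'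
    (u := (2 : ℝ) • fderiv ℝ (chg e e') x (sprayVec L e x y) -
      chgHess e e' x y y - (2 : ℝ) • sprayVec L e' (chg e e' x) (fderiv ℝ (chg e e') x y))
    (w := 0) fun a => by
      have h1 := E1 (fderiv ℝ (chg e' e) (chg e e' x) (stdVec a))
      rw [fderiv_chg_fderiv_chg' hx, hD'] at h1
      have h2 := R'.fderiv_fderivL_vert (x := chg e e' x) (y := fderiv ℝ (chg e e') x y) h'
        ((2 : ℝ) • fderiv ℝ (chg e e') x (sprayVec L e x y) -
      chgHess e e' x y y - (2 : ℝ) • sprayVec L e' (chg e e' x) (fderiv ℝ (chg e e') x y)) a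
      have h3 := h2.symm.trans h1
      simpa using h3
  ext k
  have := congrFun E2 k
  simp only [PiLp.sub_apply, PiLp.smul_apply, Pi.sub_apply, Pi.smul_apply, smul_eq_mul,
    Pi.zero_apply] at this ⊢
  linarith

/-- The inhomogeneous term of the transformation law of a nonlinear connection. -/
theorem cocycle_hess {x : Model n} (hx : x ∈ overlap e e') (y : Model n) (i k : Fin n) :
    ∑ c, fderiv ℝ (chg e e') x (stdVec c) k *
        ∑ b, fderiv ℝ (fun z => fderiv ℝ (chg e' e) z (stdVec b) c) (chg e e' x) (stdVec i) *
          fderiv ℝ (chg e e') x y b =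
      - chgHess e e' x (fderiv ℝ (chg e' e) (chg e e' x) (stdVec i)) y k := by
  have h1 : ∀ b c, fderiv ℝ (fun z => fderiv ℝ (chg e' e) z (stdVec b) c) (chg e e' x) (stdVec i) =
      chgHess e' e (chg e e' x) (stdVec i) (stdVec b) c := by
    intro b c
    have h2 : HasFDerivAt (fun z => fderiv ℝ (chg e' e) z (stdVec b))
        ((chgHess e' e (chg e e' x)).flip (stdVec b)) (chg e e' x) := by
      simpa using (hasFDerivAt_fderiv_chg (chg_mem_overlap hx)).clm_apply
        (hasFDerivAt_const (stdVec b) (chg e e' x))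
    have h3 := (EuclideanSpace.proj c : EuclideanSpace ℝ (Fin n) →L[ℝ] ℝ).hasFDerivAt.comp
      (chg e e' x) h2
    have h4 : HasFDerivAt (fun z => fderiv ℝ (chg e' e) z (stdVec b) c) _ (chg e e' x) := h3
    rw [h4.fderiv]
    rfl
  simp only [h1]
  have h2 : ∀ c, ∑ b, chgHess e' e (chg e e' x) (stdVec i) (stdVec b) c *
      fderiv ℝ (chg e e') x y b =
      chgHess e' e (chg e e' x) (stdVec i) (fderiv ℝ (chg e e') x y) c :=
    fun c => (clm_apply_coord _ _ c).symm
  simp only [h2]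
  rw [← clm_apply_coord]
  have h3 := chgHess_inv hx (fderiv ℝ (chg e' e) (chg e e' x) (stdVec i)) y
  rw [fderiv_chg_fderiv_chg' hx] at h3
  rw [h3]
  rfl

/-- The vertical derivative of the law of the spray, in the direction v that the change of charts
sends to the i-th basis vector. The Hessian is quadratic in y with factor 1/2, so its derivative is
the inhomogeneous term. -/
theorem IsPseudoFinsler.metricConn_chg (hL : IsPseudoFinsler A L) {x y : Model n}
    (h : (x, y) ∈ dom e A) (hx : x ∈ overlap e e') (i k : Fin n) :
    metricConn L e' (chg e e' x) (fderiv ℝ (chg e e') x y) i k =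
      - chgHess e e' x (fderiv ℝ (chg e' e) (chg e e' x) (stdVec i)) y k +
        ∑ c, ∑ a, fderiv ℝ (chg e e') x (stdVec c) k *
          fderiv ℝ (chg e' e) (chg e e' x) (stdVec i) a * metricConn L e x y a c := by
  have R := hL.conicMetric e
  have R' := hL.conicMetric e'
  have h' : (chg e e' x, fderiv ℝ (chg e e') x y) ∈ dom e' A := mem_dom_chg h hx
  set v := fderiv ℝ (chg e' e) (chg e e' x) (stdVec i) with hv
  have h1 : (fun z => metricSpray L e' (chg e e' x) (fderiv ℝ (chg e e') x z) k) =ᶠ[nhds y]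
      fun z => ∑ c, fderiv ℝ (chg e e') x (stdVec c) k * metricSpray L e x z c -
        1 / 2 * chgHess e e' x z z k := by
    filter_upwards [eventually_mem_right R.isOpen h] with z hz
    have := congrArg (fun w : Model n => w k) (hL.sprayVec_chg hz hx)
    simp only [sprayVec, PiLp.sub_apply, PiLp.smul_apply, smul_eq_mul] at this
    rw [this, clm_apply_coord]
  have h2 : HasFDerivAt (fun z => metricSpray L e' (chg e e' x) (fderiv ℝ (chg e e') x z) k)
      _ y :=
    HasFDerivAt.comp (g := fun z => metricSpray L e' (chg e e' x) z k)
      (f := fderiv ℝ (chg e e') x) y ((R'.smooth_metricSpray k).hasFDerivAt_right R'.isOpen h').hasFDerivAt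
      (fderiv ℝ (chg e e') x).hasFDerivAt
  have h3 : HasFDerivAt (fun z => ∑ c, fderiv ℝ (chg e e') x (stdVec c) k *
      metricSpray L e x z c) _ y :=
    HasFDerivAt.fun_sum fun c _ =>
      ((R.smooth_metricSpray c).hasFDerivAt_right R.isOpen h).hasFDerivAt.const_mul _
  have h4 : HasFDerivAt (fun z => chgHess e e' x z z) _ y :=
    (chgHess e e' x).hasFDerivAt.clm_apply (hasFDerivAt_id y)
  have h5 : HasFDerivAt (fun z => chgHess e e' x z z k) _ y :=
    (EuclideanSpace.proj k : EuclideanSpace ℝ (Fin n) →L[ℝ] ℝ).hasFDerivAt.comp y h4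
  have h6 := (h2.unique ((h3.sub (h5.const_mul (1 / 2))).congr_of_eventuallyEq h1))
  have h7 := congrArg (fun T => T v) h6
  have h8 : fderiv ℝ (chg e e') x v = stdVec i := fderiv_chg_fderiv_chg' hx _
  simp only [ContinuousLinearMap.comp_apply, h8, _root_.sub_apply, _root_.smul_apply,
    _root_.add_apply, ContinuousLinearMap.flip_apply, ContinuousLinearMap.id_apply,
    _root_.sum_apply, smul_eq_mul] at h7
  rw [metricConn, dV, h7]
  have h9 : (EuclideanSpace.proj k : EuclideanSpace ℝ (Fin n) →L[ℝ] ℝ)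
      (chgHess e e' x y v + chgHess e e' x v y) = 2 * chgHess e e' x v y k := by
    rw [chgHess_symm hx y v]
    simp; ring
  have h10 : ∀ c, fderiv ℝ (fun z => metricSpray L e x z c) y v =
      ∑ a, v a * metricConn L e x y a c := by
    intro c
    rw [clm_apply_sum]
    exact Finset.sum_congr rfl fun a _ => mul_comm _ _
  simp only [h9, h10, Finset.mul_sum, mul_assoc]
  ring

/-- The metric connection is a homogeneous nonlinear connection. -/
theorem IsPseudoFinsler.isNonlinearConnection (hL : IsPseudoFinsler A L) :
    IsNonlinearConnection A (metricConn L) where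
  smooth := fun e i k => (hL.conicMetric e).smooth_metricConn i k
  homog := fun e p hp c hc i k => by
    simpa using (hL.conicMetric e).homog_metricConn i k p hp c hc
  cocycle := fun e e' x y h hx i k => by
    have hx' : x ∈ overlap e e' := ⟨h.1, hx⟩
    rw [hL.metricConn_chg h hx', cocycle_hess hx']

end Transformation

/-! ### Curves in charts -/

section Curves

variable {n : ℕ} {M : Type*} [TopologicalSpace M] [ChartedSpace (Model n) M]
  [IsManifold (𝓡 n) ∞ M] {e e' : Chart n M} {D : Set (TM n M)} {N : Coeffs n M}

/-- A curve in the chart `e`. -/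
def chartCurve (e : Chart n M) (γ : ℝ → M) (t : ℝ) : Model n := e.1 (γ t)

/-- The vector `N_c^k y^c`. -/
def accel (N : Coeffs n M) (e : Chart n M) (x y : Model n) : Model n :=
  WithLp.toLp 2 fun k => ∑ c, N e x y c k * y c

/-- A continuous nonlinear connection on a set `D` of tangent vectors, not necessarily open. -/
structure IsConnectionOn (D : Set (TM n M)) (N : Coeffs n M) : Prop where
  continuousOn : ∀ (e : Chart n M) (i k : Fin n),
    ContinuousOn (fun p : Model n × Model n => N e p.1 p.2 i k) (dom e D)
  homog : ∀ (e : Chart n M), ∀ p ∈ dom e D, ∀ c : ℝ, 0 < c → ∀ i k : Fin n,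
    N e p.1 (c • p.2) i k = c * N e p.1 p.2 i k
  cocycle : ∀ (e e' : Chart n M) (x y : Model n), (x, y) ∈ dom e D → x ∈ overlap e e' →
    ∀ i k : Fin n, N e' (chg e e' x) (fderiv ℝ (chg e e') x y) i k =
      - chgHess e e' x (fderiv ℝ (chg e' e) (chg e e' x) (stdVec i)) y k +
        ∑ c, ∑ a, fderiv ℝ (chg e e') x (stdVec c) k *
          fderiv ℝ (chg e' e) (chg e e' x) (stdVec i) a * N e x y a c

theorem IsNonlinearConnection.isConnectionOn (hN : IsNonlinearConnection D N) :
    IsConnectionOn D N where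
  continuousOn := fun e i k => (hN.smooth e i k).continuousOn
  homog := hN.homog
  cocycle := fun e e' x y h hx i k => by rw [hN.cocycle e e' x y h hx.2, cocycle_hess hx]

theorem IsConnectionOn.mono {S : Set (TM n M)} (hN : IsConnectionOn D N) (h : S ⊆ D) :
    IsConnectionOn S N where
  continuousOn := fun e i k => (hN.continuousOn e i k).mono (dom_mono h)
  homog := fun e p hp => hN.homog e p (dom_mono h hp)
  cocycle := fun e e' x y hp => hN.cocycle e e' x y (dom_mono h hp)

theorem IsConnectionOn.accel_smul (hN : IsConnectionOn D N) {p : Model n × Model n}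
    (hp : p ∈ dom e D) {c : ℝ} (hc : 0 < c) :
    accel N e p.1 (c • p.2) = c ^ 2 • accel N e p.1 p.2 := by
  ext k
  simp only [accel, hN.homog e p hp c hc, PiLp.smul_apply, smul_eq_mul, Finset.mul_sum]
  exact Finset.sum_congr rfl fun a _ => by ring

theorem IsConnectionOn.continuousOn_accel (hN : IsConnectionOn D N) (e : Chart n M) :
    ContinuousOn (fun p : Model n × Model n => accel N e p.1 p.2) (dom e D) := by
  refine (PiLp.continuous_toLp 2 _).comp_continuousOn (continuousOn_pi.2 fun k => ?_)
  refine continuousOn_finsetSum _ fun c _ => (hN.continuousOn e c k).mul ?_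
  exact Continuous.continuousOn (by fun_prop)

/-- When the law of N is contracted with the transformed vector, the inhomogeneous term becomes the
Hessian on (y, y), the same for every connection. -/
theorem IsConnectionOn.accel_chg (hN : IsConnectionOn D N) {x y : Model n}
    (h : (x, y) ∈ dom e D) (hx : x ∈ overlap e e') :
    accel N e' (chg e e' x) (fderiv ℝ (chg e e') x y) =
      fderiv ℝ (chg e e') x (accel N e x y) - chgHess e e' x y y := by
  set w := fderiv ℝ (chg e e') x y with hw
  set ψ := fderiv ℝ (chg e' e) (chg e e' x) with hψ
  have hy : ψ w = y := fderiv_chg_fderiv_chg hx y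
  have hy' : ∑ i, w i • ψ (stdVec i) = y := by
    rw [← hy]
    conv_rhs => rw [← sum_smul_stdVec w, map_sum]
    simp
  have hcoc := hN.cocycle e e' x y h hx
  simp only [← hw, ← hψ] at hcoc
  ext k
  simp only [accel, hcoc, add_mul, Finset.sum_add_distrib, PiLp.sub_apply]
  rw [clm_apply_coord _ (WithLp.toLp 2 _), add_comm, sub_eq_add_neg]
  congr 1
  · simp only [Finset.sum_mul, Finset.mul_sum]
    rw [Finset.sum_comm]
    refine Finset.sum_congr rfl fun c _ => ?_
    rw [Finset.sum_comm]
    refine Finset.sum_congr rfl fun a _ => ?_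
    have h1 : y a = ∑ i, ψ (stdVec i) a * w i := by rw [← clm_apply_coord, hy]
    rw [h1, Finset.mul_sum, Finset.mul_sum]
    exact Finset.sum_congr rfl fun i _ => by ring
  · have h2 : chgHess e e' x y y = ∑ i, w i • chgHess e e' x (ψ (stdVec i)) y := by
      conv_lhs => rw [← hy', map_sum]
      rw [hy']
      simp only [map_smul]
      exact Finset.sum_congr rfl fun i _ => by rw [chgHess_symm hx]
    rw [h2]
    simp [mul_comm]

variable {γ : ℝ → M} {t : ℝ}

theorem contDiffAt_chartCurve {m : ℕ∞ω} (hm : m ≤ ∞)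
    (hγ : ContMDiffAt 𝓘(ℝ, ℝ) (𝓡 n) m γ t) (ht : γ t ∈ e.1.source) :
    ContDiffAt ℝ m (chartCurve e γ) t := by
  have h1 := ((contMDiffOn_chart e).contMDiffAt (e.1.open_source.mem_nhds ht)).of_le hm
  exact (h1.comp t hγ).contDiffAt

theorem velocity_eq (hγ : ContMDiffAt 𝓘(ℝ, ℝ) (𝓡 n) 1 γ t) (ht : γ t ∈ e.1.source) :
    velocity γ t = tvec e (chartCurve e γ t) (deriv (chartCurve e γ) t) := by
  have h1 : velocity γ t = tangentMap 𝓘(ℝ, ℝ) (𝓡 n) γ ⟨t, (1 : ℝ)⟩ := rfl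
  have h2 : γ =ᶠ[nhds t] e.1.symm ∘ chartCurve e γ := by
    filter_upwards [hγ.continuousAt.eventually (e.1.open_source.mem_nhds ht)] with τ hτ
      using (e.1.left_inv hτ).symm
  have h3 : DifferentiableAt ℝ (chartCurve e γ) t :=
    (contDiffAt_chartCurve (by simp) hγ ht).differentiableAt (by simp)
  rw [h1, tangentMap_congr h2,
    tangentMap_comp_at (g := e.1.symm) (f := chartCurve e γ) _
    (mdifferentiableAt_atlas_symm e.2 (e.1.map_source ht)) h3.mdifferentiableAt,
    tvec_eq_tangentMap]
  congr 1
  rw [tangentMap, mfderiv_eq_fderiv]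
  rfl

theorem velocity_mem_iff (hγ : ContMDiffAt 𝓘(ℝ, ℝ) (𝓡 n) 1 γ t) (ht : γ t ∈ e.1.source) :
    velocity γ t ∈ D ↔ (chartCurve e γ t, deriv (chartCurve e γ) t) ∈ dom e D := by
  rw [velocity_eq hγ ht]
  exact ⟨fun h => ⟨e.1.map_source ht, h⟩, fun h => h.2⟩

/-- The geodesic equation in the chart `e`. -/
def GeodesicAt (N : Coeffs n M) (e : Chart n M) (γ : ℝ → M) (t : ℝ) : Prop :=
  deriv (deriv (chartCurve e γ)) t = - accel N e (chartCurve e γ t) (deriv (chartCurve e γ) t)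

theorem deriv_coord {x : ℝ → Model n} {t : ℝ} (hx : DifferentiableAt ℝ x t) (k : Fin n) :
    deriv (fun τ => x τ k) t = deriv x t k :=
  ((EuclideanSpace.proj k : EuclideanSpace ℝ (Fin n) →L[ℝ] ℝ).hasFDerivAt.comp_hasDerivAt t
    hx.hasDerivAt).deriv

theorem eventually_contDiffAt {x : ℝ → Model n} {t : ℝ} (hx : ContDiffAt ℝ 2 x t) :
    ∀ᶠ τ in nhds t, ContDiffAt ℝ 2 x τ := hx.eventually (by simp)

theorem differentiableAt_deriv {x : ℝ → Model n} {t : ℝ} (hx : ContDiffAt ℝ 2 x t) :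
    DifferentiableAt ℝ (deriv x) t :=
  (hx.derivWithin (m := 1) (by norm_num)).differentiableAt (by simp)

theorem geodesicAt_iff (hγ : ContMDiffAt 𝓘(ℝ, ℝ) (𝓡 n) 2 γ t) (ht : γ t ∈ e.1.source) :
    (∀ k : Fin n, deriv (deriv fun τ => e.1 (γ τ) k) t +
      ∑ c, N e (e.1 (γ t)) (deriv (fun τ => e.1 (γ τ)) t) c k *
        deriv (fun τ => e.1 (γ τ) c) t = 0) ↔ GeodesicAt N e γ t := by
  have hx := contDiffAt_chartCurve (by simpa using ENat.LEInfty.out) hγ ht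
  have h1 : ∀ k, deriv (fun τ => e.1 (γ τ) k) t = deriv (chartCurve e γ) t k := fun k =>
    deriv_coord (hx.differentiableAt (by simp)) k
  have h2 : ∀ k, deriv (deriv fun τ => e.1 (γ τ) k) t = deriv (deriv (chartCurve e γ)) t k := by
    intro k
    rw [← deriv_coord (differentiableAt_deriv hx)]
    refine Filter.EventuallyEq.deriv_eq ?_
    filter_upwards [eventually_contDiffAt hx] with τ hτ
      using deriv_coord (hτ.differentiableAt (by simp)) k
  simp only [h1, h2, GeodesicAt]
  constructor
  · intro h
    ext k
    exact eq_neg_of_add_eq_zero_left (h k)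
  · intro h k
    rw [h]
    exact neg_add_cancel _

theorem isGeodesicOn_iff {s : Set ℝ} : IsGeodesicOn D N γ s ↔
    IsOpen s ∧ s.OrdConnected ∧ ContMDiffOn 𝓘(ℝ, ℝ) (𝓡 n) 2 γ s ∧ (∀ t ∈ s, velocity γ t ∈ D) ∧
      ∀ t ∈ s, ∀ e : Chart n M, γ t ∈ e.1.source → GeodesicAt N e γ t := by
  constructor
  · intro h
    exact ⟨h.isOpen, h.ordConnected, h.regular, h.velocity_mem, fun t ht e he =>
      (geodesicAt_iff (h.regular.contMDiffAt (h.isOpen.mem_nhds ht)) he).1 (h.eqn t ht e he)⟩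
  · rintro ⟨h1, h2, h3, h4, h5⟩
    exact ⟨h1, h2, h3, h4, fun t ht e he =>
      (geodesicAt_iff (h3.contMDiffAt (h1.mem_nhds ht)) he).2 (h5 t ht e he)⟩

/-- The geodesic equation does not depend on the chart. -/
theorem GeodesicAt.chg (hN : IsConnectionOn D N) (h : GeodesicAt N e γ t)
    (hγ : ContMDiffAt 𝓘(ℝ, ℝ) (𝓡 n) 2 γ t) (ht : γ t ∈ e.1.source) (ht' : γ t ∈ e'.1.source)
    (hD : velocity γ t ∈ D) : GeodesicAt N e' γ t := by
  have hx := contDiffAt_chartCurve (by simpa using ENat.LEInfty.out) hγ ht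
  have hD' := (velocity_mem_iff (hγ.of_le (by norm_num)) ht).1 hD
  have hov : ∀ {τ}, γ τ ∈ e.1.source → γ τ ∈ e'.1.source → chartCurve e γ τ ∈ overlap e e' :=
    fun h1 h2 => ⟨e.1.map_source h1, by
      rw [Set.mem_preimage, chartCurve, e.1.left_inv h1]; exact h2⟩
  have hchg : ∀ {τ}, γ τ ∈ e.1.source → chartCurve e' γ τ = Palatini.chg e e' (chartCurve e γ τ) :=
    fun h1 => by rw [Palatini.chg, chartCurve, chartCurve, e.1.left_inv h1]
  have hev : ∀ᶠ τ in nhds t, (γ τ ∈ e.1.source ∧ γ τ ∈ e'.1.source) ∧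
      ContDiffAt ℝ 2 (chartCurve e γ) τ :=
    ((hγ.continuousAt.eventually (e.1.open_source.mem_nhds ht)).and
      (hγ.continuousAt.eventually (e'.1.open_source.mem_nhds ht'))).and (eventually_contDiffAt hx)
  have hd : deriv (chartCurve e' γ) =ᶠ[nhds t]
      fun τ => fderiv ℝ (Palatini.chg e e') (chartCurve e γ τ) (deriv (chartCurve e γ) τ) := by
    filter_upwards [hev.eventually_nhds] with τ hτ
    have h1 : chartCurve e' γ =ᶠ[nhds τ] Palatini.chg e e' ∘ chartCurve e γ := by
      filter_upwards [hτ] with σ hσ using hchg hσ.1.1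
    have h2 := hτ.self_of_nhds
    rw [h1.deriv_eq]
    exact (((contDiffAt_chg (hov h2.1.1 h2.1.2)).differentiableAt
      (by simp)).hasFDerivAt.comp_hasDerivAt τ (h2.2.differentiableAt (by simp)).hasDerivAt).deriv
  have h3 : HasDerivAt (fun τ => fderiv ℝ (Palatini.chg e e') (chartCurve e γ τ)) _ t :=
    (hasFDerivAt_fderiv_chg (hov ht ht')).comp_hasDerivAt t
      (hx.differentiableAt (by simp)).hasDerivAt
  -- The second derivative of the transformed curve contributes the Hessian at the velocity, which
  -- is the term appearing in `accel_chg`.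
  rw [GeodesicAt, hd.deriv_eq, (h3.clm_apply (differentiableAt_deriv hx).hasDerivAt).deriv,
    hd.eq_of_nhds, hchg ht, hN.accel_chg hD' (hov ht ht'), h, map_neg]
  abel

/-! ### Reparametrizations -/

section Reparam

variable {φ : ℝ → ℝ} {r s : Set ℝ}

theorem hasDerivAt_chartCurve_comp (hγ : ContMDiffAt 𝓘(ℝ, ℝ) (𝓡 n) 1 γ (φ t))
    (hφ : DifferentiableAt ℝ φ t) (ht : γ (φ t) ∈ e.1.source) :
    HasDerivAt (chartCurve e fun τ => γ (φ τ)) (deriv φ t • deriv (chartCurve e γ) (φ t)) t :=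
  HasDerivAt.scomp t ((contDiffAt_chartCurve (by simp) hγ
    ht).differentiableAt (by simp)).hasDerivAt hφ.hasDerivAt

theorem deriv_deriv_chartCurve_comp (hγ : ContMDiffAt 𝓘(ℝ, ℝ) (𝓡 n) 2 γ (φ t))
    (hφ : ContDiffAt ℝ 2 φ t) (ht : γ (φ t) ∈ e.1.source) :
    deriv (deriv (chartCurve e fun τ => γ (φ τ))) t =
      deriv φ t ^ 2 • deriv (deriv (chartCurve e γ)) (φ t) +
        deriv (deriv φ) t • deriv (chartCurve e γ) (φ t) := by
  have h1 : deriv (chartCurve e fun τ => γ (φ τ)) =ᶠ[nhds t]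
      fun τ => deriv φ τ • deriv (chartCurve e γ) (φ τ) := by
    have h2 : ∀ᶠ τ in nhds t, ContMDiffAt 𝓘(ℝ, ℝ) (𝓡 n) 2 γ (φ τ) :=
      hφ.continuousAt.eventually ((contMDiffAt_iff_contMDiffAt_nhds (by simp)).1 hγ)
    have h3 : ∀ᶠ τ in nhds t, γ (φ τ) ∈ e.1.source :=
      (hγ.continuousAt.comp hφ.continuousAt).eventually (e.1.open_source.mem_nhds ht)
    filter_upwards [h2, h3, hφ.eventually (by simp)] with τ h4 h5 h6
    exact (hasDerivAt_chartCurve_comp (h4.of_le (by norm_num)) (h6.differentiableAt (by simp))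
      h5).deriv
  have hx := contDiffAt_chartCurve (by simpa using ENat.LEInfty.out) hγ ht
  have h7 : HasDerivAt (fun τ => deriv (chartCurve e γ) (φ τ)) _ t :=
    HasDerivAt.scomp t (differentiableAt_deriv hx).hasDerivAt
      (hφ.differentiableAt (by simp)).hasDerivAt
  have h8 : HasDerivAt (deriv φ) (deriv (deriv φ) t) t :=
    ((hφ.derivWithin (m := 1) (by norm_num)).differentiableAt (by simp)).hasDerivAt
  rw [h1.deriv_eq, (h8.fun_smul h7).deriv, smul_smul, sq]

theorem contMDiffOn_comp_reparam (hγ : ContMDiffOn 𝓘(ℝ, ℝ) (𝓡 n) 2 γ s)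
    (hφ : ContDiffOn ℝ 2 φ r) (h : φ '' r ⊆ s) :
    ContMDiffOn 𝓘(ℝ, ℝ) (𝓡 n) 2 (fun t => γ (φ t)) r :=
  hγ.comp hφ.contMDiffOn (Set.image_subset_iff.1 h)

/-- A continuous function on an open interval is the acceleration, in terms of the velocity, of
a change of parameter. -/
theorem exists_reparam (hs : IsOpen s) (hc : s.OrdConnected) {f : ℝ → ℝ} (hf : ContinuousOn f s) :
    ∃ (r : Set ℝ) (φ : ℝ → ℝ), IsOpen r ∧ r.OrdConnected ∧ ContDiffOn ℝ 2 φ r ∧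
      (∀ t ∈ r, 0 < deriv φ t) ∧ φ '' r = s ∧
      ∀ t ∈ r, deriv (deriv φ) t = f (φ t) * deriv φ t ^ 2 := by
  rcases s.eq_empty_or_nonempty with rfl | ⟨t₀, ht₀⟩
  · exact ⟨∅, id, isOpen_empty, Set.ordConnected_empty, contDiffOn_empty, by simp, by simp, by simp⟩
  have ftc : ∀ {g : ℝ → ℝ}, ContinuousOn g s → ∀ t ∈ s,
      HasDerivAt (fun u => ∫ v in t₀..u, g v) (g t) t := by
    intro g hg t ht
    have hsub : Set.uIcc t₀ t ⊆ s := hc.uIcc_subset ht₀ ht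
    exact intervalIntegral.integral_hasDerivAt_right ((hg.mono hsub).intervalIntegrable)
      (hg.stronglyMeasurableAtFilter hs t ht) (hg.continuousAt (hs.mem_nhds ht))
  -- The equation φ'' = f(φ) φ'^2 integrates to φ' = exp (F ∘ φ) with F a primitive of f. Hence the
  -- inverse ψ of φ satisfies ψ' = exp (-F) and is found by quadrature.
  set F : ℝ → ℝ := fun u => ∫ v in t₀..u, f v with hF
  have hF' : ∀ t ∈ s, HasDerivAt F (f t) t := ftc hf
  have hFc : ContinuousOn F s := fun t ht => (hF' t ht).continuousAt.continuousWithinAt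
  set ψ : ℝ → ℝ := fun u => ∫ v in t₀..u, Real.exp (-F v) with hψdef
  have hψ' : ∀ t ∈ s, HasDerivAt ψ (Real.exp (-F t)) t :=
    ftc (Real.continuous_exp.comp_continuousOn hFc.neg)
  have hψc : ContinuousOn ψ s := fun t ht => (hψ' t ht).continuousAt.continuousWithinAt
  have hmono : StrictMonoOn ψ s := by
    refine strictMonoOn_of_deriv_pos hc.convex hψc fun t ht => ?_
    rw [hs.interior_eq] at ht
    rw [(hψ' t ht).deriv]; exact Real.exp_pos _
  have hFC : ContDiffOn ℝ 1 F s := by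
    rw [show (1 : ℕ∞ω) = 0 + 1 from rfl, contDiffOn_succ_iff_deriv_of_isOpen hs]
    refine ⟨fun t ht => (hF' t ht).differentiableAt.differentiableWithinAt, by simp, ?_⟩
    exact contDiffOn_zero.2 (hf.congr fun t ht => (hF' t ht).deriv)
  have hψC : ContDiffOn ℝ 2 ψ s := by
    rw [show (2 : ℕ∞ω) = 1 + 1 by norm_num, contDiffOn_succ_iff_deriv_of_isOpen hs]
    refine ⟨fun t ht => (hψ' t ht).differentiableAt.differentiableWithinAt, by simp, ?_⟩
    exact (Real.contDiff_exp.comp_contDiffOn hFC.neg).congr fun t ht => (hψ' t ht).deriv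
  -- The derivative of ψ never vanishes, so ψ is open by the inverse function theorem; being also
  -- strictly monotone, it has an inverse on the whole image.
  have hopen : IsOpenMap (s.domRestrict ψ) := by
    intro U hU
    have hV := hs.isOpenMap_subtype_val U hU
    have him : s.domRestrict ψ '' U = ψ '' (Subtype.val '' U) := by
      rw [Set.image_image]; rfl
    rw [him, isOpen_iff_mem_nhds]
    rintro _ ⟨t, ht, rfl⟩
    have hts : t ∈ s := by obtain ⟨u, _, rfl⟩ := ht; exact u.2
    have hstr := (hψC.contDiffAt (hs.mem_nhds hts)).hasStrictDerivAt' (hψ' t hts) (by simp)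
    rw [← hstr.map_nhds_eq (Real.exp_pos _).ne']
    exact Filter.image_mem_map (hV.mem_nhds ht)
  let P : PartialEquiv ℝ ℝ := hmono.injOn.toPartialEquiv ψ s
  let H : OpenPartialHomeomorph ℝ ℝ := OpenPartialHomeomorph.ofContinuousOpenRestrict P hψc hopen hs
  have hHs : H.source = s := rfl
  have hHt : H.target = ψ '' s := rfl
  have hHψ : ∀ t, H t = ψ t := fun t => rfl
  have hmaps : ∀ t ∈ ψ '' s, H.symm t ∈ s := fun t ht => H.map_target ht
  have hd : ∀ t ∈ ψ '' s, HasDerivAt H.symm (Real.exp (F (H.symm t))) t := by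
    intro t ht
    have := H.hasDerivAt_symm (a := t) ht (Real.exp_pos _).ne' (hψ' _ (hmaps t ht))
    rwa [← Real.exp_neg, neg_neg] at this
  have hopen' : IsOpen (ψ '' s) := H.open_target
  refine ⟨ψ '' s, H.symm, hopen', ?_, ?_, ?_, ?_, ?_⟩
  · exact (hc.isPreconnected.image ψ hψc).ordConnected
  · intro t ht
    exact (H.contDiffAt_symm_deriv (Real.exp_pos _).ne' ht (hψ' _ (hmaps t ht))
      (hψC.contDiffAt (hs.mem_nhds (hmaps t ht)))).contDiffWithinAt
  · intro t ht
    rw [(hd t ht).deriv]; exact Real.exp_pos _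
  · exact H.symm_image_target_eq_source
  · intro t ht
    have h1 : deriv H.symm =ᶠ[nhds t] fun τ => Real.exp (F (H.symm τ)) := by
      filter_upwards [hopen'.mem_nhds ht] with τ hτ using (hd τ hτ).deriv
    have h2 : HasDerivAt (fun τ => Real.exp (F (H.symm τ))) _ t :=
      (HasDerivAt.comp t (hF' _ (hmaps t ht)) (hd t ht)).exp
    rw [h1.deriv_eq, h2.deriv, (hd t ht).deriv]
    simp only [Function.comp_apply]
    ring

end Reparam

end Curves

/-! ### Existence of geodesics and comparison of connections -/

section Comparison

variable {n : ℕ} {M : Type*} [TopologicalSpace M] [ChartedSpace (Model n) M]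
  [IsManifold (𝓡 n) ∞ M] {e e' : Chart n M} {A D : Set (TM n M)} {N N₀ : Coeffs n M}

/-- Picard-Lindelöf for the field (y, -N_c^k y^c) on the open set of coordinates of A, on an
interval short enough for the solution to stay there. -/
theorem exists_isGeodesicOn (hA : IsConicDomain A) (hN : IsNonlinearConnection A N)
    {p : Model n × Model n} (hp : p ∈ dom e A) :
    ∃ (γ : ℝ → M) (s : Set ℝ), (0 : ℝ) ∈ s ∧ IsGeodesicOn A N γ s ∧ γ 0 ∈ e.1.source ∧
      chartCurve e γ 0 = p.1 ∧ deriv (chartCurve e γ) 0 = p.2 := by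
  have hopen := isOpen_dom e hA.isOpen
  set X : Model n × Model n → Model n × Model n := fun q => (q.2, - accel N e q.1 q.2) with hX
  have hacc : ContDiffOn ℝ ∞ (fun q : Model n × Model n => accel N e q.1 q.2) (dom e A) := by
    have h1 : ContDiffOn ℝ ∞ (fun (q : Model n × Model n) (k : Fin n) =>
        ∑ c, N e q.1 q.2 c k * q.2 c) (dom e A) := by
      rw [contDiffOn_pi]
      exact fun k => SmoothOn.sum (F := fun c x y => N e x y c k * y c)
        fun c _ => SmoothOn.mul (hN.smooth e c k) (smoothOn_snd c)
    exact (PiLp.contDiff_toLp (𝕜 := ℝ) (p := 2)).comp_contDiffOn h1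
  have hXC : ContDiffOn ℝ ∞ X (dom e A) := contDiff_snd.contDiffOn.prodMk hacc.neg
  have hXat : ContDiffAt ℝ 1 X p := (hXC.contDiffAt (hopen.mem_nhds hp)).of_le (by simp)
  obtain ⟨r, hr, ε, hε, hα⟩ :=
    hXat.exists_forall_mem_closedBall_exists_eq_forall_mem_Ioo_hasDerivAt 0
  obtain ⟨α, hα0, hα'⟩ := hα p (Metric.mem_closedBall_self hr.le)
  simp only [zero_sub, zero_add] at hα'
  have hαc : ContinuousAt α 0 := (hα' 0 ⟨by linarith, hε⟩).continuousAt
  have hev : ∀ᶠ t in nhds (0 : ℝ), α t ∈ dom e A :=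
    hαc.eventually (by rw [hα0]; exact hopen.mem_nhds hp)
  obtain ⟨δ', hδ', hball⟩ := Metric.eventually_nhds_iff.1 hev
  set δ := min δ' ε with hδ
  have hδ0 : 0 < δ := lt_min hδ' hε
  set s := Set.Ioo (-δ) δ with hs
  have hdom : ∀ t ∈ s, α t ∈ dom e A := fun t ht => hball (by
    rw [Real.dist_eq, sub_zero, abs_lt]
    exact ⟨by linarith [ht.1, min_le_left δ' ε], by linarith [ht.2, min_le_left δ' ε]⟩)
  have hder : ∀ t ∈ s, HasDerivAt α (X (α t)) t := fun t ht => hα' t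
    ⟨by linarith [ht.1, min_le_right δ' ε], by linarith [ht.2, min_le_right δ' ε]⟩
  have hso : IsOpen s := isOpen_Ioo
  have hα1 : ContDiffOn ℝ 1 α s := by
    rw [show (1 : ℕ∞ω) = 0 + 1 from rfl, contDiffOn_succ_iff_deriv_of_isOpen hso]
    refine ⟨fun t ht => (hder t ht).differentiableAt.differentiableWithinAt, by simp, ?_⟩
    refine contDiffOn_zero.2 (ContinuousOn.congr (f := fun t => X (α t)) ?_
      fun t ht => (hder t ht).deriv)
    exact hXC.continuousOn.comp
      (fun t ht => (hder t ht).continuousAt.continuousWithinAt) hdom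
  have hx1 : ∀ t ∈ s, HasDerivAt (fun τ => (α τ).1) (α t).2 t := fun t ht =>
    (ContinuousLinearMap.fst ℝ (Model n) (Model n)).hasFDerivAt.comp_hasDerivAt t (hder t ht)
  have hy1 : ∀ t ∈ s, HasDerivAt (fun τ => (α τ).2) (- accel N e (α t).1 (α t).2) t :=
    fun t ht =>
      (ContinuousLinearMap.snd ℝ (Model n) (Model n)).hasFDerivAt.comp_hasDerivAt t (hder t ht)
  have hx2 : ContDiffOn ℝ 2 (fun τ => (α τ).1) s := by
    rw [show (2 : ℕ∞ω) = 1 + 1 by norm_num, contDiffOn_succ_iff_deriv_of_isOpen hso]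
    refine ⟨fun t ht => (hx1 t ht).differentiableAt.differentiableWithinAt, by simp, ?_⟩
    exact hα1.snd.congr fun t ht => (hx1 t ht).deriv
  set γ : ℝ → M := fun t => e.1.symm (α t).1 with hγ
  have hγC : ContMDiffOn 𝓘(ℝ, ℝ) (𝓡 n) 2 γ s :=
    ((contMDiffOn_chart_symm e).of_le (by simpa using ENat.LEInfty.out)).comp hx2.contMDiffOn
      fun t ht => (hdom t ht).1
  have hγat : ∀ t ∈ s, ContMDiffAt 𝓘(ℝ, ℝ) (𝓡 n) 2 γ t := fun t ht =>
    hγC.contMDiffAt (hso.mem_nhds ht)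
  have hsrc : ∀ t ∈ s, γ t ∈ e.1.source := fun t ht => e.1.map_target (hdom t ht).1
  have hcc : ∀ t ∈ s, chartCurve e γ t = (α t).1 := fun t ht => e.1.right_inv (hdom t ht).1
  have hcd : ∀ t ∈ s, deriv (chartCurve e γ) t = (α t).2 := by
    intro t ht
    have h1 : chartCurve e γ =ᶠ[nhds t] fun τ => (α τ).1 := by
      filter_upwards [hso.mem_nhds ht] with τ hτ using hcc τ hτ
    rw [h1.deriv_eq, (hx1 t ht).deriv]
  have hgeo : ∀ t ∈ s, GeodesicAt N e γ t := by
    intro t ht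
    have h1 : deriv (chartCurve e γ) =ᶠ[nhds t] fun τ => (α τ).2 := by
      filter_upwards [hso.mem_nhds ht] with τ hτ using hcd τ hτ
    rw [GeodesicAt, h1.deriv_eq, (hy1 t ht).deriv, hcc t ht, hcd t ht]
  have hvel : ∀ t ∈ s, velocity γ t ∈ A := fun t ht => by
    rw [velocity_mem_iff ((hγat t ht).of_le (by norm_num)) (hsrc t ht), hcc t ht, hcd t ht]
    exact hdom t ht
  have h0 : (0 : ℝ) ∈ s := ⟨by linarith, hδ0⟩
  refine ⟨γ, s, h0, isGeodesicOn_iff.2 ⟨hso, Set.ordConnected_Ioo, hγC, hvel, ?_⟩, hsrc 0 h0,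
    by rw [hcc 0 h0, hα0], by rw [hcd 0 h0, hα0]⟩
  exact fun t ht e' he' => (hgeo t ht).chg hN.isConnectionOn (hγat t ht) (hsrc t ht) he' (hvel t ht)

/-- The factor `μ` in `(N - N₀)_c^k y^c = μ y^k`. -/
def parallelFactor (N N₀ : Coeffs n M) (e : Chart n M) (p : Model n × Model n) : ℝ :=
  (∑ k, (accel N e p.1 p.2 k - accel N₀ e p.1 p.2 k) * p.2 k) / ∑ k, p.2 k * p.2 k

/-- `N_c^k y^c` and `(N₀)_c^k y^c` differ by a multiple of `y^k`. -/
def ParallelOn (D : Set (TM n M)) (N N₀ : Coeffs n M) : Prop :=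
  ∀ e : Chart n M, ∀ p ∈ dom e D, ∃ f : ℝ, accel N e p.1 p.2 - accel N₀ e p.1 p.2 = f • p.2

theorem ParallelOn.symm (h : ParallelOn D N N₀) : ParallelOn D N₀ N := fun e p hp => by
  obtain ⟨f, hf⟩ := h e p hp
  exact ⟨-f, by rw [neg_smul, ← hf, neg_sub]⟩

theorem ParallelOn.trans {N₁ : Coeffs n M} (h : ParallelOn D N N₀) (h' : ParallelOn D N₀ N₁) :
    ParallelOn D N N₁ := fun e p hp => by
  obtain ⟨f, hf⟩ := h e p hp
  obtain ⟨g, hg⟩ := h' e p hp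
  exact ⟨f + g, by rw [add_smul, ← hf, ← hg, sub_add_sub_cancel]⟩

theorem parallelFactor_eq {p : Model n × Model n} (hp : p.2 ≠ 0) {f : ℝ}
    (h : accel N e p.1 p.2 - accel N₀ e p.1 p.2 = f • p.2) : parallelFactor N N₀ e p = f := by
  have h1 : ∀ k, accel N e p.1 p.2 k - accel N₀ e p.1 p.2 k = f * p.2 k := fun k =>
    congrArg (fun w : Model n => w k) h
  rw [parallelFactor, div_eq_iff (sum_mul_self_ne_zero hp), Finset.mul_sum]
  exact Finset.sum_congr rfl fun k _ => by rw [h1, mul_assoc]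

theorem ParallelOn.accel_sub (h : ParallelOn D N N₀) (hD : ∀ v ∈ D, v.2 ≠ 0)
    {p : Model n × Model n} (hp : p ∈ dom e D) :
    accel N e p.1 p.2 - accel N₀ e p.1 p.2 = parallelFactor N N₀ e p • p.2 := by
  obtain ⟨f, hf⟩ := h e p hp
  rw [parallelFactor_eq (fun h0 => hD _ hp.2 ((coordVec_eq_zero_iff hp.1).2 h0)) hf, hf]

theorem continuousOn_parallelFactor (hN : IsConnectionOn D N) (hN₀ : IsConnectionOn D N₀)
    (hD : ∀ v ∈ D, v.2 ≠ 0) (e : Chart n M) :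
    ContinuousOn (parallelFactor N N₀ e) (dom e D) := by
  have hk : ∀ {N : Coeffs n M}, IsConnectionOn D N → ∀ k : Fin n,
      ContinuousOn (fun p : Model n × Model n => accel N e p.1 p.2 k) (dom e D) := fun h k =>
    (EuclideanSpace.proj k : EuclideanSpace ℝ (Fin n) →L[ℝ] ℝ).continuous.comp_continuousOn
      (h.continuousOn_accel e)
  have hy : ∀ k : Fin n, Continuous fun p : Model n × Model n => p.2 k := fun k => by fun_prop
  refine ContinuousOn.div (continuousOn_finsetSum _ fun k _ =>
    ((hk hN k).sub (hk hN₀ k)).mul (hy k).continuousOn)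
    (continuousOn_finsetSum _ fun k _ => ((hy k).mul (hy k)).continuousOn) fun p hp => ?_
  exact sum_mul_self_ne_zero fun h0 => hD _ hp.2 ((coordVec_eq_zero_iff hp.1).2 h0)

/-- The Hessian terms of the two connections cancel, so the difference of accelerations transforms
as a vector and its factor along y is independent of the chart. -/
theorem parallelFactor_chg (hN : IsConnectionOn D N) (hN₀ : IsConnectionOn D N₀)
    (h : ParallelOn D N N₀) (hD : ∀ v ∈ D, v.2 ≠ 0) {p : Model n × Model n} (hp : p ∈ dom e D)
    (hx : p.1 ∈ overlap e e') :
    parallelFactor N N₀ e' (tchg e e' p) = parallelFactor N N₀ e p := by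
  have hp' : tchg e e' p ∈ dom e' D := mem_dom_chg hp hx
  refine parallelFactor_eq (fun h0 => hD _ hp'.2 ((coordVec_eq_zero_iff hp'.1).2 h0)) ?_
  have h1 := hN.accel_chg (e' := e') (x := p.1) (y := p.2) hp hx
  have h2 := hN₀.accel_chg (e' := e') (x := p.1) (y := p.2) hp hx
  simp only [tchg]
  rw [h1, h2, sub_sub_sub_cancel_right, ← map_sub, h.accel_sub hD hp, map_smul]

/-- Pregeodesics of `N` are pregeodesics of `N₀` if the connections agree up to multiples
of `y`. -/
theorem IsPregeodesicOn.of_parallel (hN : IsConnectionOn D N) (hN₀ : IsConnectionOn D N₀)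
    (h : ParallelOn D N N₀) (hD : ∀ v ∈ D, v.2 ≠ 0) (hc : ∀ e : Chart n M, Conic (dom e D))
    {γ : ℝ → M} {s : Set ℝ} (hγ : IsPregeodesicOn D N γ s) : IsPregeodesicOn D N₀ γ s := by
  obtain ⟨r, φ, hφ, hφ', rfl, hgeo⟩ := hγ
  set σ : ℝ → M := fun t => γ (φ t) with hσ
  obtain ⟨hr, hrc, hreg, hvel, heq⟩ := isGeodesicOn_iff.1 hgeo
  have hat : ∀ t ∈ r, ContMDiffAt 𝓘(ℝ, ℝ) (𝓡 n) 2 σ t := fun t ht =>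
    hreg.contMDiffAt (hr.mem_nhds ht)
  have hat1 : ∀ t ∈ r, ContMDiffAt 𝓘(ℝ, ℝ) (𝓡 n) 1 σ t := fun t ht =>
    (hat t ht).of_le (by norm_num)
  let chart (t : ℝ) : Chart n M := ⟨chartAt (Model n) (σ t), chart_mem_atlas _ _⟩
  have hchart : ∀ t, σ t ∈ (chart t).1.source := fun t => mem_chart_source _ _
  let P (e : Chart n M) (t : ℝ) : Model n × Model n := (chartCurve e σ t, deriv (chartCurve e σ) t)
  have hP : ∀ (e : Chart n M), ∀ t ∈ r, σ t ∈ e.1.source → P e t ∈ dom e D := fun e t ht he =>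
    (velocity_mem_iff (hat1 t ht) he).1 (hvel t ht)
  -- The factor along the curve, in the chart preferred at each instant. That chart may jump with t,
  -- and chart independence is what makes f continuous.
  let f (t : ℝ) : ℝ := parallelFactor N N₀ (chart t) (P (chart t) t)
  have hf : ∀ (e : Chart n M), ∀ t ∈ r, σ t ∈ e.1.source →
      f t = parallelFactor N N₀ e (P e t) := by
    intro e t ht he
    have hov : chartCurve e σ t ∈ overlap e (chart t) := ⟨e.1.map_source he, by
      rw [Set.mem_preimage, chartCurve, e.1.left_inv he]; exact hchart t⟩
    rw [← parallelFactor_chg hN hN₀ h hD (hP e t ht he) hov]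
    have h1 : tvec (chart t) (P (chart t) t).1 (P (chart t) t).2 =
        tvec (chart t) (tchg e (chart t) (P e t)).1 (tchg e (chart t) (P e t)).2 := by
      rw [← velocity_eq (hat1 t ht) (hchart t), velocity_eq (hat1 t ht) he]
      exact (tvec_chg hov _).symm
    have h2 := congrArg (tcoord (chart t)) h1
    rw [tcoord_tvec (hP (chart t) t ht (hchart t)).1,
      tcoord_tvec (p := tchg e (chart t) (P e t)) (mem_dom_chg (hP e t ht he) hov).1] at h2
    simp only [f, h2]
  have hfc : ContinuousOn f r := by
    intro t ht
    have hsrc : ∀ᶠ τ in nhds t, σ τ ∈ (chart t).1.source :=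
      (hat t ht).continuousAt.eventually ((chart t).1.open_source.mem_nhds (hchart t))
    have hx := contDiffAt_chartCurve (by simpa using ENat.LEInfty.out) (hat t ht) (hchart t)
    have hPc : ContinuousAt (P (chart t)) t :=
      hx.continuousAt.prodMk (differentiableAt_deriv hx).continuousAt
    have h1 : ∀ᶠ τ in nhdsWithin t r, P (chart t) τ ∈ dom (chart t) D := by
      filter_upwards [self_mem_nhdsWithin, nhdsWithin_le_nhds hsrc] with τ hτ h2
        using hP _ τ hτ h2
    have h2 : Filter.Tendsto (P (chart t)) (nhdsWithin t r)
        (nhdsWithin (P (chart t) t) (dom (chart t) D)) :=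
      tendsto_nhdsWithin_iff.2 ⟨hPc.tendsto.mono_left nhdsWithin_le_nhds, h1⟩
    have h3 := (continuousOn_parallelFactor hN hN₀ hD (chart t) _
      (hP _ t ht (hchart t))).tendsto.comp h2
    refine Filter.Tendsto.congr' ?_ h3
    filter_upwards [self_mem_nhdsWithin, nhdsWithin_le_nhds hsrc] with τ hτ h4
      using (hf _ τ hτ h4).symm
  -- The new parameter contributes ψ'' σ' = f(ψ) ψ'^2 σ' to the acceleration, which absorbs the
  -- difference between the two geodesic equations.
  obtain ⟨r', ψ, hr', hrc', hψ, hψ', himg, hψ2⟩ := exists_reparam hr hrc hfc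
  have hmaps : ∀ t ∈ r', ψ t ∈ r := fun t ht => himg ▸ Set.mem_image_of_mem ψ ht
  have hψat : ∀ t ∈ r', ContDiffAt ℝ 2 ψ t := fun t ht => hψ.contDiffAt (hr'.mem_nhds ht)
  have hφat : ∀ t ∈ r, DifferentiableAt ℝ φ t := fun t ht =>
    (hφ.contDiffAt (hr.mem_nhds ht)).differentiableAt (by simp)
  refine ⟨r', fun t => φ (ψ t), hφ.comp hψ hmaps, ?_, ?_, ?_⟩
  · intro t ht
    have h1 : HasDerivAt (fun t => φ (ψ t)) _ t := (hφat _ (hmaps t ht)).hasDerivAt.comp t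
      ((hψat t ht).differentiableAt (by simp)).hasDerivAt
    rw [h1.deriv]
    exact mul_pos (hφ' _ (hmaps t ht)) (hψ' t ht)
  · rw [← himg, Set.image_image]
  · have hregψ : ContMDiffOn 𝓘(ℝ, ℝ) (𝓡 n) 2 (fun t => σ (ψ t)) r' :=
      contMDiffOn_comp_reparam hreg hψ himg.le
    have hd : ∀ (e : Chart n M), ∀ t ∈ r', σ (ψ t) ∈ e.1.source →
        deriv (chartCurve e fun τ => σ (ψ τ)) t = deriv ψ t • deriv (chartCurve e σ) (ψ t) :=
      fun e t ht he => (hasDerivAt_chartCurve_comp (hat1 _ (hmaps t ht))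
        ((hψat t ht).differentiableAt (by simp)) he).deriv
    refine isGeodesicOn_iff.2 ⟨hr', hrc', hregψ, ?_, ?_⟩
    · intro t ht
      have hs := hchart (ψ t)
      rw [velocity_mem_iff (e := chart (ψ t))
        ((hregψ.contMDiffAt (hr'.mem_nhds ht)).of_le (by norm_num)) hs, hd _ t ht hs]
      exact hc _ _ (hP _ _ (hmaps t ht) hs) _ (hψ' t ht)
    · intro t ht e he
      have hPe := hP e _ (hmaps t ht) he
      have h1 := hN₀.accel_smul hPe (hψ' t ht)
      have h2 := h.accel_sub hD hPe
      have h3 : accel N e (P e (ψ t)).1 (P e (ψ t)).2 =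
        accel N₀ e (P e (ψ t)).1 (P e (ψ t)).2 +
          parallelFactor N N₀ e (P e (ψ t)) • (P e (ψ t)).2 := by rw [← h2]; abel
      have h4 := heq _ (hmaps t ht) e he
      rw [GeodesicAt] at h4
      rw [GeodesicAt, hd e t ht he, deriv_deriv_chartCurve_comp (hat _ (hmaps t ht)) (hψat t ht) he,
        hψ2 t ht, h4]
      change _ = - accel N₀ e (P e (ψ t)).1 (deriv ψ t • (P e (ψ t)).2)
      change deriv ψ t ^ 2 • -accel N e (P e (ψ t)).1 (P e (ψ t)).2 +
        (f (ψ t) * deriv ψ t ^ 2) • (P e (ψ t)).2 = _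
      rw [h1, h3, hf e _ (hmaps t ht) he]
      module

theorem sharePregeodesics_of_parallel (hN : IsConnectionOn D N) (hN₀ : IsConnectionOn D N₀)
    (h : ParallelOn D N N₀) (hD : ∀ v ∈ D, v.2 ≠ 0) (hc : ∀ e : Chart n M, Conic (dom e D)) :
    SharePregeodesics D N N₀ := fun _ _ =>
  ⟨.of_parallel hN hN₀ h hD hc, .of_parallel hN₀ hN h.symm hD hc⟩

theorem IsGeodesicOn.isPregeodesicOn {γ : ℝ → M} {s : Set ℝ} (h : IsGeodesicOn D N γ s) :
    IsPregeodesicOn D N γ s :=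
  ⟨s, id, contDiffOn_id, by simp, by simp, h⟩

/-- Connections with the same pregeodesics agree up to multiples of `y`. -/
theorem parallelOn_of_sharePregeodesics (hA : IsConicDomain A) (hN : IsNonlinearConnection A N)
    (hN₀ : IsNonlinearConnection A N₀) (h : SharePregeodesics A N N₀) : ParallelOn A N N₀ := by
  intro e p hp
  obtain ⟨γ, s, h0, hgeo, hsrc, hx, hy⟩ := exists_isGeodesicOn hA hN hp
  obtain ⟨r, φ, hφ, hφ', himg, hgeo'⟩ := (h γ s).1 hgeo.isPregeodesicOn
  obtain ⟨t, ht, hφt⟩ : (0 : ℝ) ∈ φ '' r := himg ▸ h0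
  obtain ⟨hs, _, hreg, hvel, heq⟩ := isGeodesicOn_iff.1 hgeo
  obtain ⟨hr, _, hreg', hvel', heq'⟩ := isGeodesicOn_iff.1 hgeo'
  have hat : ContMDiffAt 𝓘(ℝ, ℝ) (𝓡 n) 2 γ (φ t) := by
    rw [hφt]; exact hreg.contMDiffAt (hs.mem_nhds h0)
  have hsrc' : γ (φ t) ∈ e.1.source := by rw [hφt]; exact hsrc
  have hφat : ContDiffAt ℝ 2 φ t := hφ.contDiffAt (hr.mem_nhds ht)
  -- Both geodesic equations are read at the instant when γ has the prescribed velocity; the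
  -- accelerations then differ by φ'' / φ'^2 times that velocity.
  have h1 := heq 0 h0 e hsrc
  have h2 := heq' t ht e hsrc'
  have hx' : chartCurve e (fun τ => γ (φ τ)) t = p.1 := by
    rw [← hx, chartCurve, chartCurve, hφt]
  rw [GeodesicAt, deriv_deriv_chartCurve_comp hat hφat hsrc', (hasDerivAt_chartCurve_comp
    (hat.of_le (by norm_num)) (hφat.differentiableAt (by simp)) hsrc').deriv, hx', hφt, hy,
    hN₀.isConnectionOn.accel_smul hp (hφ' t ht)] at h2
  rw [GeodesicAt, hx, hy] at h1
  rw [h1] at h2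
  have hpos : deriv φ t ^ 2 ≠ 0 := pow_ne_zero _ (hφ' t ht).ne'
  refine ⟨(deriv φ t ^ 2)⁻¹ * deriv (deriv φ) t, ?_⟩
  have h3 : deriv φ t ^ 2 • (accel N e p.1 p.2 - accel N₀ e p.1 p.2) =
      deriv (deriv φ) t • p.2 := by
    rw [smul_sub]
    rw [smul_neg, neg_add_eq_sub, sub_eq_iff_eq_add] at h2
    rw [h2]; abel
  rw [mul_smul, ← h3, smul_smul, inv_mul_cancel₀ hpos, one_smul]

theorem accel_eq_of_shareGeodesics (hA : IsConicDomain A) (hN : IsNonlinearConnection A N)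
    (h : ShareGeodesics A N N₀) {p : Model n × Model n} (hp : p ∈ dom e A) :
    accel N e p.1 p.2 = accel N₀ e p.1 p.2 := by
  obtain ⟨γ, s, h0, hgeo, hsrc, hx, hy⟩ := exists_isGeodesicOn hA hN hp
  have h1 := (isGeodesicOn_iff.1 hgeo).2.2.2.2 0 h0 e hsrc
  have h2 := (isGeodesicOn_iff.1 ((h γ s).1 hgeo)).2.2.2.2 0 h0 e hsrc
  rw [GeodesicAt, hx, hy] at h1 h2
  exact neg_injective (h1.symm.trans h2)

/-- Geodesics of `N` are geodesics of `N₀` if the connections agree along their velocities. -/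
theorem IsGeodesicOn.of_accel_eq {S : Set (TM n M)}
    (h : ∀ e : Chart n M, ∀ p ∈ dom e S, accel N e p.1 p.2 = accel N₀ e p.1 p.2)
    {γ : ℝ → M} {s : Set ℝ} (hγ : IsGeodesicOn D N γ s) (hS : ∀ t ∈ s, velocity γ t ∈ S) :
    IsGeodesicOn D N₀ γ s := by
  obtain ⟨hs, hc, hreg, hvel, heq⟩ := isGeodesicOn_iff.1 hγ
  refine isGeodesicOn_iff.2 ⟨hs, hc, hreg, hvel, fun t ht e he => ?_⟩
  have h1 := (velocity_mem_iff ((hreg.contMDiffAt (hs.mem_nhds ht)).of_le (by norm_num)) he).1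
    (hS t ht)
  have h2 := heq t ht e he
  rw [GeodesicAt] at h2 ⊢
  rw [h2]
  exact congrArg _ (h e _ h1)

theorem shareGeodesics_of_accel_eq
    (h : ∀ e : Chart n M, ∀ p ∈ dom e D, accel N e p.1 p.2 = accel N₀ e p.1 p.2) :
    ShareGeodesics D N N₀ := fun _ _ =>
  ⟨fun hγ => hγ.of_accel_eq h hγ.velocity_mem,
    fun hγ => hγ.of_accel_eq (fun e p hp => (h e p hp).symm) hγ.velocity_mem⟩

end Comparison

/-! ### Extension to the boundary -/

section Boundary

variable {n : ℕ} {M : Type*} [TopologicalSpace M] [ChartedSpace (Model n) M]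
  [IsManifold (𝓡 n) ∞ M] {e e' : Chart n M} {A : Set (TM n M)} {L : TM n M → ℝ}
  {N : Coeffs n M} {W : Set (Model n × Model n)}

theorem mem_or_mem_bdA {v : TM n M} (hv : v ∈ closA A) : v ∈ A ∨ v ∈ bdA A := by
  by_cases h : v ∈ A
  · exact Or.inl h
  · exact Or.inr ⟨hv, h⟩

theorem bdA_subset_closA : bdA A ⊆ closA A := Set.sdiff_subset

/-- Identities between continuous functions extend from `A` to its closure. -/
theorem eqOn_dom_closA (hA : IsConicDomain A) {f g : Model n × Model n → ℝ}
    (hf : ContinuousOn f W) (hg : ContinuousOn g W) (hW : dom e (closA A) ⊆ W)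
    (h : ∀ p ∈ dom e A, f p = g p) : ∀ p ∈ dom e (closA A), f p = g p :=
  Set.EqOn.of_subset_closure h (hf.mono hW) (hg.mono hW) (dom_mono hA.subset_closA)
    dom_closA_subset_closure

/-- Invertibility of g and y ≠ 0 are open conditions that hold on the closure, so the neighbourhood
of smoothness can be shrunk to satisfy them. Homogeneity is not assumed off the closure. -/
theorem IsProper.exists_regularMetric (hL : IsProper A L) (e : Chart n M) :
    ∃ W, dom e (closA A) ⊆ W ∧ RegularMetric L e W ∧ ∀ p ∈ W, p.2 ≠ 0 := by
  obtain ⟨B, hB, hAB, hLB⟩ := hL.extends_smoothly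
  have hs := smoothOn_coordL hLB e
  have ho := isOpen_dom e hB
  have hdet : SmoothOn (dom e B) fun x y => (gMat L e x y).det :=
    SmoothOn.det fun i j => ((hs.dV ho i).dV ho j).const_mul _
  have hW1 : IsOpen (dom e B ∩ (fun p : Model n × Model n => (gMat L e p.1 p.2).det) ⁻¹' {0}ᶜ) :=
    hdet.continuousOn.isOpen_inter_preimage ho isOpen_compl_singleton
  refine ⟨_ ∩ Prod.snd ⁻¹' {0}ᶜ, ?_, ⟨hW1.inter (isOpen_compl_singleton.preimage continuous_snd),
    hs.mono fun p hp => hp.1.1, fun p hp => hp.1.2⟩, fun p hp => hp.2⟩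
  intro p hp
  refine ⟨⟨dom_mono hAB hp, ?_⟩, (mem_dom_closA.1 hp).2.2⟩
  rcases mem_or_mem_bdA hp.2 with h | h
  · exact hL.nondeg e p ⟨hp.1, h⟩
  · exact hL.nondeg_bdry e p ⟨hp.1, h⟩

theorem IsProper.exists_regularPair (hL : IsProper A L) (hN : ExtendsToClosure A N)
    (e : Chart n M) : ∃ W, dom e (closA A) ⊆ W ∧ RegularPair L N e W := by
  obtain ⟨W, hW, R, h0⟩ := hL.exists_regularMetric e
  obtain ⟨B, hB, hAB, hNB⟩ := hN e
  refine ⟨W ∩ B, Set.subset_inter hW hAB, { R.mono (R.isOpen.inter hB) Set.inter_subset_left with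
    smooth_conn := fun i k => (hNB i k).mono Set.inter_subset_right
    vec_ne_zero := fun p hp => h0 p hp.1 }⟩

theorem IsAffineSolution.localSolution (hn : 2 ≤ n) (hL : IsPseudoFinsler A L)
    (hN : IsAffineSolution A L N) (e : Chart n M) : LocalSolution L N e (dom e A) :=
  { hL.conicMetric e with
    smooth_conn := hN.conn.smooth e
    vec_ne_zero := fun _ hp => hL.conic.vec_ne_zero hp
    homog_conn := fun i k p hp c hc => by simpa using hN.conn.homog e p hp c hc i k
    metric_ne_zero := fun p hp => hL.ne_zero _ hp.2
    eqn := hN.eqn e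
    two_le := hn }

/-- A nonlinear connection on `A` whose coefficients extend continuously is a connection on the
closure of `A`. -/
theorem IsNonlinearConnection.isConnectionOn_closA (hA : IsConicDomain A)
    (hN : IsNonlinearConnection A N) (hc : ∀ (e : Chart n M) (i k : Fin n),
      ContinuousOn (fun p : Model n × Model n => N e p.1 p.2 i k) (dom e (closA A))) :
    IsConnectionOn (closA A) N where
  continuousOn := hc
  homog := fun e p hp c hc' i k => by
    have h1 : Continuous fun q : Model n × Model n => (q.1, c • q.2) := by fun_prop
    have h2 := (hc e i k).comp h1.continuousOn (fun q hq => conic_dom_closA hA e q hq c hc')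
    exact eqOn_dom_closA hA h2 (continuousOn_const.mul (hc e i k)) subset_rfl
      (fun q hq => hN.homog e q hq c hc' i k) p hp
  cocycle := fun e e' x y h hx i k => by
    -- The vectors over the overlap form an open set, so A remains dense in its closure after
    -- intersecting with it and both sides can be compared by continuity.
    let s : Set (Model n × Model n) := {p | p.1 ∈ overlap e e'}
    have hso : IsOpen s := (isOpen_overlap e e').preimage continuous_fst
    have hsub : s ∩ dom e A ⊆ s ∩ dom e (closA A) :=
      Set.inter_subset_inter_right _ (dom_mono hA.subset_closA)
    have hcl : s ∩ dom e (closA A) ⊆ closure (s ∩ dom e A) :=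
      (Set.inter_subset_inter_right _ dom_closA_subset_closure).trans hso.inter_closure
    have hchg : ContinuousOn (fun p : Model n × Model n => chg e e' p.1) s :=
      (contDiffOn_chg e e').continuousOn.comp continuousOn_fst fun p hp => hp
    have hD : ∀ e e' : Chart n M, ContinuousOn (fderiv ℝ (chg e e')) (overlap e e') :=
      fun e e' => (contDiffOn_chg e e').continuousOn_fderiv_of_isOpen (isOpen_overlap e e') (by simp)
    have hH : ContinuousOn (chgHess e e') (overlap e e') :=
      ((contDiffOn_chg e e').fderiv_of_isOpen (isOpen_overlap e e')
        (m := ∞) (by simp)).continuousOn_fderiv_of_isOpen (isOpen_overlap e e') (by simp)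
    have hφ : ContinuousOn (fun p : Model n × Model n => fderiv ℝ (chg e e') p.1) s :=
      (hD e e').comp continuousOn_fst fun p hp => hp
    have hψ : ContinuousOn (fun p : Model n × Model n => fderiv ℝ (chg e' e) (chg e e' p.1)) s :=
      (hD e' e).comp hchg fun p hp => chg_mem_overlap hp
    have hη : ContinuousOn (fun p : Model n × Model n => chgHess e e' p.1) s :=
      hH.comp continuousOn_fst fun p hp => hp
    have hcoord : ∀ (k : Fin n) {f : Model n × Model n → Model n} {t : Set (Model n × Model n)},
        ContinuousOn f t → ContinuousOn (fun p => f p k) t := fun k f t hf =>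
      (EuclideanSpace.proj k : EuclideanSpace ℝ (Fin n) →L[ℝ] ℝ).continuous.comp_continuousOn hf
    have hl : ContinuousOn (fun p : Model n × Model n => N e' (chg e e' p.1)
        (fderiv ℝ (chg e e') p.1 p.2) i k) (s ∩ dom e (closA A)) :=
      (hc e' i k).comp ((hchg.prodMk (hφ.clm_apply continuousOn_snd)).mono Set.inter_subset_left)
        fun p hp => mem_dom_chg hp.2 hp.1
    have hr : ContinuousOn (fun p : Model n × Model n =>
        - chgHess e e' p.1 (fderiv ℝ (chg e' e) (chg e e' p.1) (stdVec i)) p.2 k +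
        ∑ c, ∑ a, fderiv ℝ (chg e e') p.1 (stdVec c) k *
          fderiv ℝ (chg e' e) (chg e e' p.1) (stdVec i) a * N e p.1 p.2 a c)
        (s ∩ dom e (closA A)) := by
      refine ContinuousOn.add ?_ ?_
      · exact ((hcoord k ((hη.clm_apply (hψ.clm_apply continuousOn_const)).clm_apply
          continuousOn_snd)).neg).mono Set.inter_subset_left
      · refine continuousOn_finsetSum _ fun c _ => continuousOn_finsetSum _ fun a _ => ?_
        refine ContinuousOn.mul (ContinuousOn.mul ?_ ?_) ((hc e a c).mono Set.inter_subset_right)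
        · exact (hcoord k (hφ.clm_apply continuousOn_const)).mono Set.inter_subset_left
        · exact (hcoord a (hψ.clm_apply continuousOn_const)).mono Set.inter_subset_left
    exact Set.EqOn.of_subset_closure (fun p hp => hN.isConnectionOn.cocycle e e' p.1 p.2 hp.2
      hp.1 i k) hl hr hsub hcl (⟨hx, h⟩ : (x, y) ∈ s ∩ dom e (closA A))

theorem IsProperSolution.isConnectionOn (hL : IsProper A L) (hN : IsProperSolution A L N) :
    IsConnectionOn (closA A) N :=
  hN.conn.isConnectionOn_closA hL.conic fun e i k => by
    obtain ⟨B, -, hAB, hNB⟩ := hN.ext e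
    exact (hNB i k).continuousOn.mono hAB

theorem IsProper.isConnectionOn (hL : IsProper A L) : IsConnectionOn (closA A) (metricConn L) :=
  hL.isNonlinearConnection.isConnectionOn_closA hL.conic fun e i k => by
    obtain ⟨W, hW, R, -⟩ := hL.exists_regularMetric e
    exact (R.smooth_metricConn i k).continuousOn.mono hW

theorem coordL_eq_zero_of_bdA (hL : IsProper A L) {p : Model n × Model n}
    (hp : p ∈ dom e (bdA A)) : coordL L e p.1 p.2 = 0 := hL.zero_bdry _ hp.2

theorem accel_sub_eq_quadJ (p : Model n × Model n) (k : Fin n) :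
    accel N e p.1 p.2 k - accel (metricConn L) e p.1 p.2 k = quadJ L N e k p.1 p.2 := by
  simp only [accel, quadJ, diffJ, ← Finset.sum_sub_distrib, sub_mul]

/-- Continuity of both sides of the transport identity, needed to carry it from A to the closure. -/
theorem continuousOn_sum_dH_sub {q : Model n → Model n → ℝ} (R : RegularMetric L e W)
    (hN : ∀ i k, SmoothOn W fun x y => N e x y i k) (hq : SmoothOn W q) :
    ContinuousOn (fun p : Model n × Model n => ∑ c, dH c (coordL L e) p.1 p.2 * p.2 c -
      ∑ a, dV a (coordL L e) p.1 p.2 * accel N e p.1 p.2 a) W ∧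
    ContinuousOn (fun p : Model n × Model n => q p.1 p.2 * coordL L e p.1 p.2) W := by
  refine ⟨SmoothOn.continuousOn (f := fun x y => ∑ c, dH c (coordL L e) x y * y c -
      ∑ a, dV a (coordL L e) x y * ∑ c, N e x y c a * y c) ?_, (hq.mul R.smooth).continuousOn⟩
  exact (SmoothOn.sum fun c _ => (R.smooth.dH R.isOpen c).mul (smoothOn_snd c)).sub
    (SmoothOn.sum fun a _ => (R.smooth.dV R.isOpen a).mul
      (SmoothOn.sum fun c _ => (hN c a).mul (smoothOn_snd c)))

/-! ### Transport of the metric along geodesics. -/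

/-- The derivative of `L` along the vectors `(y, -N_c^k y^c)` is a continuous multiple of `L`. -/
def TransportsMetric (A : Set (TM n M)) (L : TM n M → ℝ) (N : Coeffs n M) : Prop :=
  ∀ e : Chart n M, ∃ (W : Set (Model n × Model n)) (q : Model n → Model n → ℝ),
    dom e (closA A) ⊆ W ∧ IsOpen W ∧ SmoothOn W (coordL L e) ∧ SmoothOn W q ∧
    ∀ p ∈ dom e (closA A), ∑ c, dH c (coordL L e) p.1 p.2 * p.2 c -
      ∑ a, dV a (coordL L e) p.1 p.2 * accel N e p.1 p.2 a = q p.1 p.2 * coordL L e p.1 p.2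

theorem ConicMetric.sum_dH_sub_metricConn (R : ConicMetric L e W) {x y : Model n}
    (h : (x, y) ∈ W) : ∑ c, dH c (coordL L e) x y * y c -
      ∑ a, dV a (coordL L e) x y * accel (metricConn L) e x y a = 0 := by
  rw [R.sum_dH_coordL_mul h, sub_eq_zero]
  refine Finset.sum_congr rfl fun a _ => ?_
  have h1 := R.sum_metricConn_mul h a
  simp only [accel, h1, mul_comm]

theorem IsProper.transportsMetric (hL : IsProper A L) : TransportsMetric A L (metricConn L) := by
  intro e
  obtain ⟨W, hW, R, -⟩ := hL.exists_regularMetric e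
  refine ⟨W, fun _ _ => 0, hW, R.isOpen, R.smooth, smoothOn_const 0, ?_⟩
  obtain ⟨h1, h2⟩ := continuousOn_sum_dH_sub R R.smooth_metricConn (smoothOn_const 0)
  refine eqOn_dom_closA hL.conic h1 h2 hW fun p hp => ?_
  rw [(hL.conicMetric e).sum_dH_sub_metricConn hp, zero_mul]

/-- Passing from N^L to N adds -L_{·a} Q^a = -2 y_a Q^a = -2 λ L, with λ smooth across the boundary.
-/
theorem IsProperSolution.transportsMetric (hn : 2 ≤ n) (hL : IsProper A L)
    (hN : IsProperSolution A L N) : TransportsMetric A L N := by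
  intro e
  obtain ⟨W, hW, P⟩ := hL.exists_regularPair hN.ext e
  have hq := P.smooth_quotQ.const_mul (-2)
  refine ⟨W, fun x y => -2 * quotQ L N e x y, hW, P.isOpen, P.smooth, hq, ?_⟩
  obtain ⟨h1, h2⟩ := continuousOn_sum_dH_sub P.toRegularMetric P.smooth_conn hq
  refine eqOn_dom_closA hL.conic h1 h2 hW fun p hp => ?_
  have S := hN.toIsAffineSolution.localSolution hn hL.toIsPseudoFinsler e
  have h3 := S.sum_dH_sub_metricConn hp
  have h4 : ∀ a, accel N e p.1 p.2 a =
      accel (metricConn L) e p.1 p.2 a + quadJ L N e a p.1 p.2 := fun a => by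
    rw [← accel_sub_eq_quadJ]; ring
  have h5 : ∑ a, dV a (coordL L e) p.1 p.2 * quadJ L N e a p.1 p.2 =
      2 * (coordL L e p.1 p.2 * quotQ L N e p.1 p.2) := by
    rw [← S.sum_lowY_quadJ hp, Finset.mul_sum]
    exact Finset.sum_congr rfl fun a _ => by rw [S.dV_coordL hp]; ring
  simp only [h4, mul_add, Finset.sum_add_distrib, h5]
  linarith

/-- Along a geodesic of a connection transporting `L`, the function `L` vanishes everywhere or
nowhere. -/
theorem TransportsMetric.eq_zero (hT : TransportsMetric A L N) {γ : ℝ → M} {s : Set ℝ}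
    (hγ : IsGeodesicOn (closA A) N γ s) {t₀ : ℝ} (ht₀ : t₀ ∈ s) (h0 : L (velocity γ t₀) = 0) :
    ∀ t ∈ s, L (velocity γ t) = 0 := by
  obtain ⟨hs, hc, hreg, hvel, heq⟩ := isGeodesicOn_iff.1 hγ
  have hat : ∀ t ∈ s, ContMDiffAt 𝓘(ℝ, ℝ) (𝓡 n) 2 γ t := fun t ht =>
    hreg.contMDiffAt (hs.mem_nhds ht)
  -- Along the geodesic, L satisfies a linear homogeneous equation near each instant t₁. Continuity
  -- of the coefficient at t₁ gives the bound needed for uniqueness.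
  have hlocal : ∀ t₁ ∈ s, ∃ q : ℝ → ℝ, ContinuousAt q t₁ ∧ ∀ᶠ t in nhds t₁,
      HasDerivAt (fun t => L (velocity γ t)) (q t * L (velocity γ t)) t := by
    intro t₁ ht₁
    let e : Chart n M := ⟨chartAt (Model n) (γ t₁), chart_mem_atlas _ _⟩
    have he : γ t₁ ∈ e.1.source := mem_chart_source _ _
    obtain ⟨W, q, hW, hWo, hLs, hqs, hid⟩ := hT e
    let P (t : ℝ) : Model n × Model n := (chartCurve e γ t, deriv (chartCurve e γ) t)
    have hP : ∀ t ∈ s, γ t ∈ e.1.source → P t ∈ dom e (closA A) := fun t ht he =>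
      (velocity_mem_iff ((hat t ht).of_le (by norm_num)) he).1 (hvel t ht)
    have hx : ∀ t ∈ s, γ t ∈ e.1.source → ContDiffAt ℝ 2 (chartCurve e γ) t := fun t ht he =>
      contDiffAt_chartCurve (by simpa using ENat.LEInfty.out) (hat t ht) he
    have hev : ∀ᶠ t in nhds t₁, t ∈ s ∧ γ t ∈ e.1.source :=
      (hs.eventually_mem ht₁).and ((hat t₁ ht₁).continuousAt.eventually
        (e.1.open_source.mem_nhds he))
    refine ⟨fun t => q (P t).1 (P t).2, ?_, ?_⟩
    · have h1 : ContinuousAt P t₁ := (hx t₁ ht₁ he).continuousAt.prodMk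
        (differentiableAt_deriv (hx t₁ ht₁ he)).continuousAt
      have h2 := hqs.continuousOn.continuousAt (hWo.mem_nhds (hW (hP t₁ ht₁ he)))
      exact ContinuousAt.comp (f := P) h2 h1
    · filter_upwards [hev.eventually_nhds] with t ht
      obtain ⟨hts, hte⟩ := ht.self_of_nhds
      have h1 : (fun t => L (velocity γ t)) =ᶠ[nhds t] fun t => coordL L e (P t).1 (P t).2 := by
        filter_upwards [ht] with τ hτ
        rw [velocity_eq ((hat τ hτ.1).of_le (by norm_num)) hτ.2]
        rfl
      have h2 : HasDerivAt P (deriv (chartCurve e γ) t, deriv (deriv (chartCurve e γ)) t) t :=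
        ((hx t hts hte).differentiableAt (by simp)).hasDerivAt.prodMk
          (differentiableAt_deriv (hx t hts hte)).hasDerivAt
      have hPW := hW (hP t hts hte)
      have h3 := ((hLs.differentiableAt hWo hPW).hasFDerivAt.comp_hasDerivAt t
        h2).congr_of_eventuallyEq h1
      have h4 := heq t hts e hte
      rw [GeodesicAt] at h4
      convert! h3 using 1
      have h5 : ((deriv (chartCurve e γ) t, deriv (deriv (chartCurve e γ)) t) :
          Model n × Model n) = (deriv (chartCurve e γ) t, 0) +
            (0, deriv (deriv (chartCurve e γ)) t) := by simp
      rw [h5, map_add, ← sum_dH_mul hLs hWo hPW, ← sum_dV_mul hLs hWo hPW, h4, h1.eq_of_nhds,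
        ← hid _ (hP t hts hte), sub_eq_add_neg, ← Finset.sum_neg_distrib]
      congr 1
      exact Finset.sum_congr rfl fun a _ => by simp [P]
  have hcont : ContinuousOn (fun t => L (velocity γ t)) s := fun t ht => by
    obtain ⟨q, -, hq⟩ := hlocal t ht
    exact hq.self_of_nhds.continuousAt.continuousWithinAt
  set Z : Set ℝ := {t | t ∈ s ∧ L (velocity γ t) = 0} with hZ
  -- Comparison with the zero solution: a zero of L spreads to nearby instants.
  have hZo : IsOpen Z := by
    rw [isOpen_iff_mem_nhds]
    rintro t₁ ⟨ht₁, hz⟩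
    obtain ⟨q, hqc, hq⟩ := hlocal t₁ ht₁
    have hb : ∀ᶠ t in nhds t₁, |q t| < |q t₁| + 1 :=
      hqc.abs.eventually (gt_mem_nhds (lt_add_one _))
    have hlip : ∀ᶠ t in nhds t₁, LipschitzOnWith (Real.toNNReal (|q t₁| + 1))
        (fun x => q t * x) Set.univ := by
      filter_upwards [hb] with t ht
      refine LipschitzOnWith.of_dist_le_mul fun x _ y _ => ?_
      rw [Real.dist_eq, Real.dist_eq, ← mul_sub, abs_mul,
        Real.coe_toNNReal _ (by positivity)]
      exact mul_le_mul_of_nonneg_right ht.le (abs_nonneg _)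
    have := ODE_solution_unique_of_eventually (v := fun t x => q t * x) (s := fun _ => Set.univ)
      (g := fun _ => 0) hlip (hq.mono fun t ht => ⟨ht, Set.mem_univ _⟩)
      (Filter.Eventually.of_forall fun t => ⟨by simpa using hasDerivAt_const t (0 : ℝ),
        Set.mem_univ _⟩) hz
    filter_upwards [this, hs.mem_nhds ht₁] with t h1 h2 using ⟨h2, h1⟩
  -- The zero set is open, and closed in s by continuity, while the interval is connected.
  have hsub : s ⊆ Z := by
    refine hc.isPreconnected.subset_of_closure_inter_subset hZo ⟨t₀, ht₀, ht₀, h0⟩ ?_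
    rintro t ⟨htZ, hts⟩
    refine ⟨hts, ?_⟩
    have hZs : Z ⊆ s := fun τ hτ => hτ.1
    have h1 := ((hcont t hts).mono hZs).mem_closure_image htZ
    have h2 : (fun t => L (velocity γ t)) '' Z ⊆ {0} := by
      rintro _ ⟨τ, hτ, rfl⟩; exact hτ.2
    simpa using closure_mono h2 h1
  exact fun t ht => (hsub ht).2

theorem IsProper.mem_bdA_iff (hL : IsProper A L) {v : TM n M} (hv : v ∈ closA A) :
    v ∈ bdA A ↔ L v = 0 := by
  refine ⟨hL.zero_bdry v, fun h => ?_⟩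
  rcases mem_or_mem_bdA hv with h1 | h1
  · exact absurd h (hL.ne_zero v h1)
  · exact h1

/-- Within the closure the boundary is exactly the zero set of L, which a geodesic meets at every
instant or never. -/
theorem IsProper.causal_character (hL : IsProper A L) (hT : TransportsMetric A L N)
    {γ : ℝ → M} {s : Set ℝ} (hγ : IsGeodesicOn (closA A) N γ s) :
    (∀ t ∈ s, velocity γ t ∈ A) ∨ (∀ t ∈ s, velocity γ t ∈ bdA A) := by
  by_cases h : ∃ t ∈ s, velocity γ t ∈ bdA A
  · obtain ⟨t₀, ht₀, hb⟩ := h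
    have h1 := hT.eq_zero hγ ht₀ (hL.zero_bdry _ hb)
    exact Or.inr fun t ht => (hL.mem_bdA_iff (hγ.velocity_mem t ht)).2 (h1 t ht)
  · push Not at h
    exact Or.inl fun t ht => (mem_or_mem_bdA (hγ.velocity_mem t ht)).resolve_right (h t ht)

theorem IsProper.sign_eq (hL : IsProper A L) (hT : TransportsMetric A L N)
    {γ : ℝ → M} {s : Set ℝ} (hγ : IsGeodesicOn (closA A) N γ s) {t₁ t₂ : ℝ} (h₁ : t₁ ∈ s)
    (h₂ : t₂ ∈ s) :
    SignType.sign (L (velocity γ t₁)) = SignType.sign (L (velocity γ t₂)) := by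
  rcases hL.causal_character hT hγ with h | h
  · rw [sign_pos (hL.pos _ (h t₁ h₁)), sign_pos (hL.pos _ (h t₂ h₂))]
  · rw [hL.zero_bdry _ (h t₁ h₁), hL.zero_bdry _ (h t₂ h₂)]

/-! ### Solutions on the light cone. -/

/-- On the boundary, `𝒥_a^k y^a = (2 λ - τ) y^k`. -/
theorem IsProperSolution.quadJ_eq_of_bdA (hn : 2 ≤ n) (hL : IsProper A L)
    (hN : IsProperSolution A L N) {p : Model n × Model n} (hp : p ∈ dom e (bdA A)) (k : Fin n) :
    quadJ L N e k p.1 p.2 =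
      (2 * quotQ L N e p.1 p.2 - bracketTrace L N e p.1 p.2) * p.2 k := by
  obtain ⟨W, hW, P⟩ := hL.exists_regularPair hN.ext e
  have S := hN.toIsAffineSolution.localSolution hn hL.toIsPseudoFinsler e
  have h1 : SmoothOn W fun x y => (2 * quotQ L N e x y - bracketTrace L N e x y) * y k +
      coordL L e x y * remVec L N e k x y :=
    (((P.smooth_quotQ.const_mul 2).sub P.smooth_bracketTrace).mul (smoothOn_snd k)).add
      (P.smooth.mul (P.smooth_remVec k))
  have h2 := eqOn_dom_closA hL.conic (P.smooth_quadJ k).continuousOn h1.continuousOn hW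
    (fun p hp => S.quadJ_eq hp k) p (dom_mono bdA_subset_closA hp)
  rw [h2, coordL_eq_zero_of_bdA hL hp, zero_mul, add_zero]

theorem IsProperSolution.parallelOn (hn : 2 ≤ n) (hL : IsProper A L)
    (hN : IsProperSolution A L N) : ParallelOn (bdA A) N (metricConn L) := fun e p hp => by
  refine ⟨2 * quotQ L N e p.1 p.2 - bracketTrace L N e p.1 p.2, ?_⟩
  ext k
  exact (accel_sub_eq_quadJ p k).trans (hN.quadJ_eq_of_bdA hn hL hp k)

/-- In Q = (2 λ - τ) y the absence of torsion removes τ, and (2 - n) λ, being a multiple of L,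
vanishes on the boundary; for n ≥ 3 so does λ. -/
theorem IsProperSolution.accel_eq_of_symm (hn : 3 ≤ n) (hL : IsProper A L)
    (hN : IsProperSolution A L N) (hs : IsSymmetricConn A N) {p : Model n × Model n}
    (hp : p ∈ dom e (bdA A)) : accel N e p.1 p.2 = accel (metricConn L) e p.1 p.2 := by
  have hn2 : 2 ≤ n := by omega
  obtain ⟨W, hW, P⟩ := hL.exists_regularPair hN.ext e
  have S := hN.toIsAffineSolution.localSolution hn2 hL.toIsPseudoFinsler e
  have hp' := dom_mono bdA_subset_closA hp
  have h1 : bracketTrace L N e p.1 p.2 = 0 :=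
    eqOn_dom_closA hL.conic (g := fun _ => 0) P.smooth_bracketTrace.continuousOn continuousOn_const
      hW (fun p hp => S.bracketTrace_eq_zero_of_symm hp (hs e p hp)) p hp'
  have h2 : SmoothOn W fun x y => coordL L e x y * (2 * ∑ a, meanCartan L e a x y *
      remVec L N e a x y + ∑ a, dV a (remVec L N e a) x y) :=
    P.smooth.mul (((SmoothOn.sum fun a _ => (P.smooth_meanCartan a).mul
      (P.smooth_remVec a)).const_mul 2).add
      (SmoothOn.sum fun a _ => (P.smooth_remVec a).dV P.isOpen a))
  have h3 := eqOn_dom_closA hL.conic (P.smooth_quotQ.const_mul (2 - (n : ℝ))).continuousOn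
    h2.continuousOn hW (fun p hp => S.symm_quotQ hp fun q hq => hs e q hq) p hp'
  rw [coordL_eq_zero_of_bdA hL hp, zero_mul] at h3
  have h4 : (2 - (n : ℝ)) ≠ 0 := by
    have : (3 : ℝ) ≤ n := by exact_mod_cast hn
    linarith
  have h5 := (mul_eq_zero.1 h3).resolve_left h4
  ext k
  have h6 := hN.quadJ_eq_of_bdA hn2 hL hp k
  rw [h5, h1, ← accel_sub_eq_quadJ] at h6
  linarith

end Boundary

/-! ### Lightlike pregeodesics depend only on the cone -/

section LevelSets

variable {Z : Type*} [NormedAddCommGroup Z] [NormedSpace ℝ Z]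

/-- If an open set is locally bounded by the zeros of a positive function with non-zero
derivative, then near the boundary all zeros belong to its closure. -/
theorem eventually_mem_closure_of_eq_zero {U : Set Z} (hU : IsOpen U) {F : Z → ℝ} {p₀ : Z}
    (hF : ContDiffAt ℝ 1 F p₀) (h0 : F p₀ = 0) (hd : fderiv ℝ F p₀ ≠ 0) (hp₀ : p₀ ∈ closure U)
    (hpos : ∀ p ∈ U, 0 < F p) (hbd : ∀ᶠ p in nhds p₀, p ∈ closure U → p ∉ U → F p = 0) :
    ∀ᶠ p in nhds p₀, F p = 0 → p ∈ closure U := by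
  -- Near p₀ the function increases along w, so lines parallel to w cross the zero set
  -- transversally.
  obtain ⟨w, hw⟩ : ∃ w, 0 < fderiv ℝ F p₀ w := by
    obtain ⟨v, hv⟩ : ∃ v, fderiv ℝ F p₀ v ≠ 0 := by
      by_contra! h
      exact hd (ContinuousLinearMap.ext h)
    rcases hv.lt_or_gt with h | h
    · exact ⟨-v, by rw [map_neg]; linarith⟩
    · exact ⟨v, h⟩
  have hdc : ContinuousAt (fun p => fderiv ℝ F p w) p₀ :=
    (hF.continuousAt_fderiv (by simp)).clm_apply continuousAt_const
  have hev : ∀ᶠ p in nhds p₀, (DifferentiableAt ℝ F p ∧ 0 < fderiv ℝ F p w) ∧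
      (p ∈ closure U → p ∉ U → F p = 0) :=
    (((hF.eventually (by simp)).mono fun p hp => hp.differentiableAt (by simp)).and
      (hdc.eventually (lt_mem_nhds hw))).and hbd
  obtain ⟨ρ, hρ, hball⟩ := Metric.eventually_nhds_iff_ball.1 hev
  have hwn : 0 < ‖w‖ := norm_pos_iff.2 fun h => by simp [h] at hw
  set τ : ℝ := ρ / (2 * ‖w‖) with hτ
  have hτ0 : 0 < τ := by positivity
  have hτw : τ * ‖w‖ = ρ / 2 := by rw [hτ]; field_simp
  have hin : ∀ q ∈ Metric.ball p₀ (ρ / 2), ∀ s ∈ Set.Icc 0 τ, q + s • w ∈ Metric.ball p₀ ρ := by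
    intro q hq s hs
    rw [mem_ball_iff_norm] at hq ⊢
    have h1 : ‖s • w‖ ≤ ρ / 2 := by
      rw [norm_smul, Real.norm_of_nonneg hs.1, ← hτw]
      exact mul_le_mul_of_nonneg_right hs.2 hwn.le
    calc ‖q + s • w - p₀‖ = ‖(q - p₀) + s • w‖ := by congr 1; abel
      _ ≤ ‖q - p₀‖ + ‖s • w‖ := norm_add_le _ _
      _ < ρ := by linarith
  have hmono : ∀ q ∈ Metric.ball p₀ (ρ / 2), StrictMonoOn (fun s : ℝ => F (q + s • w))
      (Set.Icc 0 τ) := by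
    intro q hq
    have h1 : ∀ s ∈ Set.Icc 0 τ, HasDerivAt (fun s : ℝ => F (q + s • w))
        (fderiv ℝ F (q + s • w) w) s := by
      intro s hs
      have h2 : HasDerivAt (fun s : ℝ => q + s • w) w s := by
        simpa using ((hasDerivAt_id s).smul_const w).const_add q
      exact (hball _ (hin q hq s hs)).1.1.hasFDerivAt.comp_hasDerivAt s h2
    refine strictMonoOn_of_deriv_pos (convex_Icc 0 τ)
      (fun s hs => (h1 s hs).continuousAt.continuousWithinAt) fun s hs => ?_
    have hs' := interior_subset hs
    rw [(h1 s hs').deriv]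
    exact (hball _ (hin q hq s hs')).1.2
  -- In this ball U is relatively closed in F > 0, because its remaining boundary points are zeros.
  -- A connected part of F > 0 meeting U therefore lies in U.
  have hsub : ∀ C : Set Z, IsPreconnected C → C ⊆ Metric.ball p₀ ρ → (∀ p ∈ C, 0 < F p) →
      (C ∩ U).Nonempty → C ⊆ U := by
    intro C hC hCb hCp hne
    refine hC.subset_of_closure_inter_subset hU hne ?_
    rintro p ⟨hp, hpC⟩
    by_contra hpU
    exact (hCp p hpC).ne' ((hball p (hCb hpC)).2 hp hpU)
  have hline : ∀ q (I : Set ℝ), IsPreconnected I → IsPreconnected ((fun s : ℝ => q + s • w) '' I) :=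
    fun q I hI => hI.image _ (by fun_prop)
  have hp₀b : p₀ ∈ Metric.ball p₀ (ρ / 2) := Metric.mem_ball_self (by linarith)
  have hτI : τ ∈ Set.Icc 0 τ := ⟨hτ0.le, le_rfl⟩
  have h0I : (0 : ℝ) ∈ Set.Icc 0 τ := ⟨le_rfl, hτ0.le⟩
  have hFτ : 0 < F (p₀ + τ • w) := by
    have := hmono p₀ hp₀b h0I hτI hτ0
    simpa [h0] using this
  have hFc : ContinuousAt F (p₀ + τ • w) :=
    (hball _ (hin p₀ hp₀b τ hτI)).1.1.continuousAt
  obtain ⟨ρ', hρ', hball'⟩ := Metric.eventually_nhds_iff_ball.1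
    ((hFc.eventually (lt_mem_nhds hFτ)).and
      (Metric.isOpen_ball.eventually_mem (hin p₀ hp₀b τ hτI)))
  set δ := min ρ' (ρ / 2) with hδ
  have hδ0 : 0 < δ := lt_min hρ' (by linarith)
  have hδb : Metric.ball p₀ δ ⊆ Metric.ball p₀ (ρ / 2) := Metric.ball_subset_ball (min_le_right _ _)
  have hshift : ∀ q ∈ Metric.ball p₀ δ, q + τ • w ∈ Metric.ball (p₀ + τ • w) ρ' := by
    intro q hq
    rw [mem_ball_iff_norm] at hq ⊢
    rw [add_sub_add_right_eq_sub]
    exact hq.trans_le (min_le_left _ _)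
  -- A point of U close to p₀ climbs along w, inside U, into the small ball around p₀ + τ w. As F >
  -- 0 on that ball, all of it lies in U.
  have htop : Metric.ball (p₀ + τ • w) ρ' ⊆ U := by
    refine hsub _ (convex_ball _ _).isPreconnected (fun p hp => (hball' p hp).2)
      (fun p hp => (hball' p hp).1) ?_
    obtain ⟨a, ha, haU⟩ := mem_closure_iff.1 hp₀ _ Metric.isOpen_ball (Metric.mem_ball_self hδ0)
    refine ⟨a + τ • w, hshift a ha, ?_⟩
    refine hsub _ (hline a (Set.Icc 0 τ) isPreconnected_Icc) ?_ ?_ ⟨a, ⟨0, h0I, by simp⟩, haU⟩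
      ⟨τ, hτI, rfl⟩
    · rintro _ ⟨s, hs, rfl⟩
      exact hin a (hδb ha) s hs
    · rintro _ ⟨s, hs, rfl⟩
      have h1 := (hmono a (hδb ha)).monotoneOn h0I hs hs.1
      simp only [zero_smul, add_zero] at h1
      exact (hpos a haU).trans_le h1
  filter_upwards [Metric.ball_mem_nhds p₀ hδ0] with q hq hFq
  -- From that ball a line descends to the zero q with F > 0 until its end point, so q is a limit of
  -- points of U.
  have hseg : (fun s : ℝ => q + s • w) '' Set.Ioc 0 τ ⊆ U := by
    refine hsub _ (hline q _ isPreconnected_Ioc) ?_ ?_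
      ⟨q + τ • w, ⟨τ, ⟨hτ0, le_rfl⟩, rfl⟩, htop (hshift q hq)⟩
    · rintro _ ⟨s, hs, rfl⟩
      exact hin q (hδb hq) s ⟨hs.1.le, hs.2⟩
    · rintro _ ⟨s, hs, rfl⟩
      have h1 := hmono q (hδb hq) h0I ⟨hs.1.le, hs.2⟩ hs.1
      simpa [hFq] using h1
  refine closure_mono hseg ?_
  have h1 : ContinuousWithinAt (fun s : ℝ => q + s • w) (Set.Ioc 0 τ) 0 :=
    Continuous.continuousWithinAt (by fun_prop)
  have h2 := h1.mem_closure_image (by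
    rw [closure_Ioc hτ0.ne]; exact h0I)
  simpa using h2

/-- The derivative of a function vanishing on a regular level set is a multiple of the derivative
of the defining function. -/
theorem exists_fderiv_eq_smul [CompleteSpace Z] {F h : Z → ℝ} {p₀ : Z} (hF : ContDiffAt ℝ 1 F p₀)
    (hh : ContDiffAt ℝ 1 h p₀) (h0 : F p₀ = 0) (hd : fderiv ℝ F p₀ ≠ 0)
    (hz : ∀ᶠ p in nhds p₀, F p = 0 → h p = 0) : ∃ c : ℝ, fderiv ℝ h p₀ = c • fderiv ℝ F p₀ := by
  -- A function vanishing on the level set is trivially extremal on it, so Lagrange multipliers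
  -- apply; as dF ≠ 0, the multiplier of dh is non-zero.
  have hex : IsLocalExtrOn h {p | F p = F p₀} p₀ := by
    left
    have h1 : h p₀ = 0 := hz.self_of_nhds h0
    filter_upwards [nhdsWithin_le_nhds hz, self_mem_nhdsWithin] with p hp hp'
    rw [h1, hp (hp'.trans h0)]
  obtain ⟨a, b, hab, heq⟩ := hex.exists_multipliers_of_hasStrictFDerivAt_1d
    (hF.hasStrictFDerivAt (by simp)) (hh.hasStrictFDerivAt (by simp))
  have hb : b ≠ 0 := by
    rintro rfl
    rw [zero_smul, add_zero, smul_eq_zero] at heq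
    exact hab (by rw [heq.resolve_right hd]; rfl)
  refine ⟨-(b⁻¹ * a), ?_⟩
  have h1 : b • fderiv ℝ h p₀ = -(a • fderiv ℝ F p₀) := eq_neg_of_add_eq_zero_right heq
  rw [neg_smul, mul_smul, ← smul_neg, ← h1, smul_smul, inv_mul_cancel₀ hb, one_smul]

end LevelSets

section Cone

variable {n : ℕ} {M : Type*} [TopologicalSpace M] [ChartedSpace (Model n) M]
  [IsManifold (𝓡 n) ∞ M] {e : Chart n M} {A : Set (TM n M)} {L L' : TM n M → ℝ}

theorem IsProper.dV_coordL (hL : IsProper A L) {p : Model n × Model n}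
    (hp : p ∈ dom e (closA A)) (a : Fin n) :
    dV a (coordL L e) p.1 p.2 = 2 * lowY L e a p.1 p.2 := by
  obtain ⟨W, hW, R, -⟩ := hL.exists_regularMetric e
  exact eqOn_dom_closA hL.conic (R.smooth.dV R.isOpen a).continuousOn
    ((R.smooth_lowY a).const_mul 2).continuousOn hW
    (fun p hp => (hL.conicMetric e).dV_coordL hp a) p hp

/-- The vertical derivative of L is 2 y_a, non-zero even where L = 0. Hence the boundary of A is cut
out regularly by L, already in each fibre. -/
theorem IsProper.exists_dV_ne_zero (hL : IsProper A L) {p : Model n × Model n}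
    (hp : p ∈ dom e (closA A)) : ∃ a, dV a (coordL L e) p.1 p.2 ≠ 0 := by
  obtain ⟨W, hW, R, hy⟩ := hL.exists_regularMetric e
  obtain ⟨a, ha⟩ := R.exists_lowY_ne_zero (x := p.1) (y := p.2) (hW hp) (hy _ (hW hp))
  exact ⟨a, by rw [hL.dV_coordL hp]; exact mul_ne_zero two_ne_zero ha⟩

theorem IsProper.fderiv_ne_zero (hL : IsProper A L) {p : Model n × Model n}
    (hp : p ∈ dom e (closA A)) : fderivL L e p ≠ 0 := fun h => by
  obtain ⟨W, hW, R, -⟩ := hL.exists_regularMetric e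
  obtain ⟨a, ha⟩ := hL.exists_dV_ne_zero hp
  rw [dV_eq R.smooth R.isOpen (hW hp)] at ha
  exact ha (congrArg (fun T : Model n × Model n →L[ℝ] ℝ => T (0, stdVec a)) h)

/-- The direction `(y, -N_c^k y^c)` of the metric connection. -/
def sprayDir (L : TM n M → ℝ) (e : Chart n M) (p : Model n × Model n) : Model n × Model n :=
  (p.2, - accel (metricConn L) e p.1 p.2)

theorem apply_sprayDir {W : Set (Model n × Model n)} {f : Model n → Model n → ℝ}
    (hf : SmoothOn W f) (hW : IsOpen W) {p : Model n × Model n} (hp : p ∈ W) :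
    fderiv ℝ (fun p : Model n × Model n => f p.1 p.2) p (sprayDir L e p) =
      ∑ c, dH c f p.1 p.2 * p.2 c -
        ∑ a, dV a f p.1 p.2 * accel (metricConn L) e p.1 p.2 a := by
  have h1 : sprayDir L e p = (p.2, 0) + (0, - accel (metricConn L) e p.1 p.2) := by
    simp [sprayDir]
  rw [h1, map_add, ← sum_dH_mul hf hW hp, ← sum_dV_mul hf hW hp, sub_eq_add_neg,
    ← Finset.sum_neg_distrib]
  congr 1
  exact Finset.sum_congr rfl fun a _ => by simp

theorem IsProper.fderivL_sprayDir (hL : IsProper A L) {p : Model n × Model n}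
    (hp : p ∈ dom e (closA A)) : fderivL L e p (sprayDir L e p) = 0 := by
  obtain ⟨W, hW, R, -⟩ := hL.exists_regularMetric e
  have h1 := (continuousOn_sum_dH_sub R R.smooth_metricConn (smoothOn_const 0)).1
  rw [fderivL, apply_sprayDir R.smooth R.isOpen (hW hp)]
  exact eqOn_dom_closA hL.conic h1 continuousOn_const hW
    (fun p hp => (hL.conicMetric e).sum_dH_sub_metricConn hp) p hp

/-- The Euler-Lagrange equations on the closure of `A`. -/
theorem IsProper.fderiv_dV_sprayDir (hL : IsProper A L) {p : Model n × Model n}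
    (hp : p ∈ dom e (closA A)) (a : Fin n) :
    fderiv ℝ (fun p : Model n × Model n => dV a (coordL L e) p.1 p.2) p (sprayDir L e p) =
      dH a (coordL L e) p.1 p.2 := by
  obtain ⟨W, hW, R, -⟩ := hL.exists_regularMetric e
  have hs := R.smooth.dV R.isOpen a
  rw [apply_sprayDir hs R.isOpen (hW hp)]
  have h1 : SmoothOn W fun x y => ∑ c, dH c (dV a (coordL L e)) x y * y c -
      ∑ b, dV b (dV a (coordL L e)) x y * ∑ c, metricConn L e x y c b * y c :=
    (SmoothOn.sum fun c _ => (hs.dH R.isOpen c).mul (smoothOn_snd c)).sub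
      (SmoothOn.sum fun b _ => (hs.dV R.isOpen b).mul
        (SmoothOn.sum fun c _ => (R.smooth_metricConn c b).mul (smoothOn_snd c)))
  refine eqOn_dom_closA hL.conic h1.continuousOn (R.smooth.dH R.isOpen a).continuousOn hW
    (fun q hq => ?_) p hp
  have C := hL.conicMetric e
  have h2 := C.gMat_metricSpray hq a
  have h3 : ∑ b, dV b (dV a (coordL L e)) q.1 q.2 * ∑ c, metricConn L e q.1 q.2 c b * q.2 c =
      4 * ∑ i, gMat L e q.1 q.2 a i * metricSpray L e q.1 q.2 i := by
    rw [Finset.mul_sum]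
    refine Finset.sum_congr rfl fun b _ => ?_
    rw [C.sum_metricConn_mul hq]
    simp only [gMat, Matrix.of_apply]
    ring
  rw [h3, h2]
  ring

/-- A smooth function vanishing on the boundary of `A` has there a derivative proportional to that
of `L`. -/
theorem IsProper.exists_fderiv_eq_smul (hL : IsProper A L) {p : Model n × Model n}
    (hp : p ∈ dom e (bdA A)) {h : Model n × Model n → ℝ} (hh : ContDiffAt ℝ 1 h p)
    (hz : ∀ q ∈ dom e (bdA A), h q = 0) : ∃ c : ℝ, fderiv ℝ h p = c • fderivL L e p := by
  obtain ⟨W, hW, R, hy⟩ := hL.exists_regularMetric e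
  have hpc := dom_mono bdA_subset_closA hp
  have hF : ContDiffAt ℝ 1 (fun p : Model n × Model n => coordL L e p.1 p.2) p :=
    (R.smooth.contDiffAt R.isOpen (hW hpc)).of_le (by simp)
  have hd := hL.fderiv_ne_zero hpc
  have hmem : ∀ᶠ q in nhds p, q.1 ∈ e.1.target ∧ q.2 ≠ 0 :=
    ((e.1.open_target.preimage continuous_fst).eventually_mem hp.1).and
      ((isOpen_compl_singleton.preimage continuous_snd).eventually_mem (mem_dom_closA.1 hpc).2.2)
  have hbd : ∀ q : Model n × Model n, q.1 ∈ e.1.target ∧ q.2 ≠ 0 → q ∈ closure (dom e A) →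
      q ∉ dom e A → q ∈ dom e (bdA A) := fun q hq h1 h2 =>
    ⟨hq.1, (mem_dom_closA.2 ⟨hq.1, h1, hq.2⟩).2, fun h3 => h2 ⟨hq.1, h3⟩⟩
  -- The extension of L could a priori vanish outside the closure of A; this excludes such zeros
  -- near p and identifies the level set with the boundary.
  have hev := eventually_mem_closure_of_eq_zero (isOpen_dom e hL.conic.isOpen) hF
    (coordL_eq_zero_of_bdA hL hp) hd (dom_closA_subset_closure hpc) (fun q hq => hL.pos _ hq.2)
    (hmem.mono fun q hq h1 h2 => coordL_eq_zero_of_bdA hL (hbd q hq h1 h2))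
  refine Palatini.exists_fderiv_eq_smul hF hh (coordL_eq_zero_of_bdA hL hp) hd ?_
  filter_upwards [hev, hmem] with q h1 h2 h3
  exact hz q (hbd q h2 (h1 h3) fun h4 => (hL.pos _ h4.2).ne' h3)

/-- The metric connections of two metrics with the same cone agree on it up to multiples
of `y`. -/
theorem IsProper.parallelOn_metricConn (hL : IsProper A L) (hL' : IsProper A L') :
    ParallelOn (bdA A) (metricConn L) (metricConn L') := by
  intro e p hp
  obtain ⟨W, hW, R, -⟩ := hL.exists_regularMetric e
  obtain ⟨W', hW', R', -⟩ := hL'.exists_regularMetric e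
  have hcl : dom e (bdA A) ⊆ dom e (closA A) := dom_mono bdA_subset_closA
  have hpc := hcl hp
  obtain ⟨a₀, ha₀⟩ := hL.exists_dV_ne_zero hpc
  have hprop : ∀ q ∈ dom e (bdA A), ∃ c : ℝ, fderivL L' e q = c • fderivL L e q := fun q hq =>
    hL.exists_fderiv_eq_smul hq
      ((R'.smooth.contDiffAt R'.isOpen (hW' (hcl hq))).of_le (by simp))
      fun q hq => coordL_eq_zero_of_bdA hL' hq
  have hdV : ∀ q ∈ dom e (bdA A), ∀ c : ℝ, fderivL L' e q = c • fderivL L e q → ∀ a,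
      dV a (coordL L' e) q.1 q.2 = c * dV a (coordL L e) q.1 q.2 := fun q hq c hc a => by
    rw [dV_eq R'.smooth R'.isOpen (hW' (hcl hq)), dV_eq R.smooth R.isOpen (hW (hcl hq))]
    exact congrArg (fun T => T (0, stdVec a)) hc
  have hdH : ∀ q ∈ dom e (bdA A), ∀ c : ℝ, fderivL L' e q = c • fderivL L e q → ∀ a,
      dH a (coordL L' e) q.1 q.2 = c * dH a (coordL L e) q.1 q.2 := fun q hq c hc a => by
    rw [dH_eq R'.smooth R'.isOpen (hW' (hcl hq)), dH_eq R.smooth R.isOpen (hW (hcl hq))]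
    exact congrArg (fun T => T (stdVec a, 0)) hc
  obtain ⟨σ, hσ⟩ := hprop p hp
  have hσ0 : σ ≠ 0 := by
    rintro rfl
    exact hL'.fderiv_ne_zero hpc (by rw [hσ, zero_smul])
  -- The spray direction of L' annihilates dL', hence the proportional dL: it is tangent to the
  -- cone.
  have hS : fderivL L e p (sprayDir L' e p) = 0 := by
    have h1 := hL'.fderivL_sprayDir hpc
    rw [hσ] at h1
    exact (mul_eq_zero.1 h1).resolve_left hσ0
  let D (L : TM n M → ℝ) (a : Fin n) : Model n × Model n →L[ℝ] ℝ :=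
    fderiv ℝ (fun p : Model n × Model n => dV a (coordL L e) p.1 p.2) p
  have hdiff : ∀ a, HasFDerivAt (fun p : Model n × Model n => dV a (coordL L e) p.1 p.2)
      (D L a) p := fun a =>
    ((R.smooth.dV R.isOpen a).differentiableAt R.isOpen (hW hpc)).hasFDerivAt
  have hdiff' : ∀ a, HasFDerivAt (fun p : Model n × Model n => dV a (coordL L' e) p.1 p.2)
      (D L' a) p := fun a =>
    ((R'.smooth.dV R'.isOpen a).differentiableAt R'.isOpen (hW' hpc)).hasFDerivAt
  have hcd : ∀ a, ContDiffAt ℝ 1 (fun p : Model n × Model n => dV a (coordL L e) p.1 p.2) p :=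
    fun a => ((R.smooth.dV R.isOpen a).contDiffAt R.isOpen (hW hpc)).of_le (by simp)
  have hcd' : ∀ a, ContDiffAt ℝ 1 (fun p : Model n × Model n => dV a (coordL L' e) p.1 p.2) p :=
    fun a => ((R'.smooth.dV R'.isOpen a).contDiffAt R'.isOpen (hW' hpc)).of_le (by simp)
  -- The minor L_{·a₀} L'_{·a} - L'_{·a₀} L_{·a} vanishes on the boundary, so its derivative along
  -- the tangent spray direction of L' is zero. The Euler-Lagrange equations of L' then make the
  -- defect of those of L along this direction proportional to L_{·a}.
  have key : ∀ a, dV a₀ (coordL L e) p.1 p.2 *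
      (D L a (sprayDir L' e p) - dH a (coordL L e) p.1 p.2) =
      (D L a₀ (sprayDir L' e p) - dH a₀ (coordL L e) p.1 p.2) * dV a (coordL L e) p.1 p.2 := by
    intro a
    obtain ⟨c, hc⟩ := hL.exists_fderiv_eq_smul hp
      (((hcd a₀).mul (hcd' a)).sub ((hcd' a₀).mul (hcd a))) fun q hq => by
        obtain ⟨c, hc⟩ := hprop q hq
        simp only [hdV q hq c hc]; ring
    have h1 := (((hdiff a₀).mul (hdiff' a)).sub ((hdiff' a₀).mul (hdiff a))).fderiv.symm.trans hc
    have h2 := congrArg (fun T => T (sprayDir L' e p)) h1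
    simp only [_root_.sub_apply, _root_.add_apply, _root_.smul_apply, smul_eq_mul, hS,
      mul_zero] at h2
    rw [show D L' a (sprayDir L' e p) = _ from hL'.fderiv_dV_sprayDir hpc a,
      show D L' a₀ (sprayDir L' e p) = _ from hL'.fderiv_dV_sprayDir hpc a₀, hdH p hp σ hσ,
      hdH p hp σ hσ, hdV p hp σ hσ, hdV p hp σ hσ] at h2
    refine mul_left_cancel₀ hσ0 ?_
    linear_combination -h2
  set κ := (D L a₀ (sprayDir L' e p) - dH a₀ (coordL L e) p.1 p.2) /
    dV a₀ (coordL L e) p.1 p.2 with hκ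
  refine ⟨κ, ?_⟩
  have h1 : ∀ a, ∑ i, gMat L e p.1 p.2 a i *
      (accel (metricConn L) e p.1 p.2 - accel (metricConn L') e p.1 p.2) i =
      ∑ i, gMat L e p.1 p.2 a i * (κ • p.2) i := by
    intro a
    have h2 : sprayDir L' e p = sprayDir L e p +
        (0, accel (metricConn L) e p.1 p.2 - accel (metricConn L') e p.1 p.2) := by
      refine Prod.ext (by simp [sprayDir]) ?_
      simp only [sprayDir, Prod.snd_add]
      abel
    -- The two spray directions differ by a vertical vector, so the same defect is 2 g_{ai} times
    -- the difference of accelerations.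
    have h3 : D L a (sprayDir L' e p) = dH a (coordL L e) p.1 p.2 +
        2 * ∑ i, gMat L e p.1 p.2 a i *
          (accel (metricConn L) e p.1 p.2 - accel (metricConn L') e p.1 p.2) i := by
      rw [h2, map_add, show D L a (sprayDir L e p) = _ from hL.fderiv_dV_sprayDir hpc a]
      congr 1
      refine (sum_dV_mul (R.smooth.dV R.isOpen a) R.isOpen (hW hpc) _).symm.trans ?_
      rw [Finset.mul_sum]
      refine Finset.sum_congr rfl fun i _ => ?_
      simp only [gMat, Matrix.of_apply]
      ring
    have h4 : ∑ i, gMat L e p.1 p.2 a i * (κ • p.2) i = κ * lowY L e a p.1 p.2 := by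
      rw [lowY, Finset.mul_sum]
      exact Finset.sum_congr rfl fun i _ => by simp; ring
    have h5 := key a
    rw [h3, hL.dV_coordL hpc a, add_sub_cancel_left] at h5
    rw [h4, hκ, div_mul_eq_mul_div, eq_div_iff ha₀]
    linarith
  have h6 := R.gMat_injective (x := p.1) (y := p.2) (hW hpc) h1
  ext i
  exact congrFun h6 i

end Cone

/-! ### One-forms given by components -/

section OneForm

variable {n : ℕ} {M : Type*} [TopologicalSpace M] [ChartedSpace (Model n) M]
  [IsManifold (𝓡 n) ∞ M] {e : Chart n M} {A : Set (TM n M)} {L : TM n M → ℝ} {N N₀ : Coeffs n M}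

/-- The preferred chart at a point. -/
def prefChart (n : ℕ) {M : Type*} [TopologicalSpace M] [ChartedSpace (Model n) M] (p : M) :
    Chart n M :=
  ⟨chartAt (Model n) p, chart_mem_atlas _ _⟩

theorem mem_prefChart_source (p : M) : p ∈ (prefChart n p).1.source := mem_chart_source _ p

/-- The anisotropic one-form with components `a_i` in the preferred charts. -/
def formOfComp (a : Chart n M → Fin n → Model n → Model n → ℝ) : OneForm n M := fun p u =>
  ∑ i, a (prefChart n p) i (tcoord (prefChart n p) ⟨p, u⟩).1 (tcoord (prefChart n p) ⟨p, u⟩).2 •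
    (EuclideanSpace.proj i : EuclideanSpace ℝ (Fin n) →L[ℝ] ℝ).comp
      (mfderiv (𝓡 n) 𝓘(ℝ, Model n) (prefChart n p).1 p : TangentSpace (𝓡 n) p →L[ℝ] Model n)

/-- The form is defined at each point through the preferred chart there; the hypothesis is the
covector law relating other charts to it. -/
theorem formComp_formOfComp {a : Chart n M → Fin n → Model n → Model n → ℝ}
    (ha : ∀ (e e' : Chart n M) (x y : Model n), (x, y) ∈ dom e A → x ∈ overlap e e' → ∀ j,
      a e j x y = ∑ i, a e' i (chg e e' x) (fderiv ℝ (chg e e') x y) *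
        fderiv ℝ (chg e e') x (stdVec j) i)
    {x y : Model n} (h : (x, y) ∈ dom e A) (j : Fin n) :
    formComp (formOfComp a) e j x y = a e j x y := by
  set e' := prefChart n (e.1.symm x) with he'
  have hx : x ∈ overlap e e' := ⟨h.1, mem_prefChart_source _⟩
  have hc : ∀ w, tcoord e' (tvec e x w) = (chg e e' x, fderiv ℝ (chg e e') x w) := fun w => by
    rw [← tvec_chg hx]
    exact tcoord_tvec (p := (chg e e' x, fderiv ℝ (chg e e') x w)) (chg_mem_overlap hx).1
  have h1 : formComp (formOfComp a) e j x y = ∑ i, a e' i (tcoord e' (tvec e x y)).1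
      (tcoord e' (tvec e x y)).2 * (tcoord e' (tvec e x (stdVec j))).2 i := by
    simp only [formComp, formOfComp]
    rw [sum_apply]
    rfl
  rw [h1, hc, hc, ha e e' x y h hx j]

theorem formComp_sum_mul (𝒜 : OneForm n M) (e : Chart n M) (x y : Model n) :
    ∑ i, formComp 𝒜 e i x y * y i =
      𝒜 (e.1.symm x) (coordVec e x y) (coordVec e x y) :=
  (clm_apply_sum ((𝒜 (e.1.symm x) (coordVec e x y)).comp
    (mfderiv 𝓘(ℝ, Model n) (𝓡 n) e.1.symm x : Model n →L[ℝ] TangentSpace (𝓡 n) (e.1.symm x)))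
      y).symm

theorem IsTranslate.accel_sub {𝒜 : OneForm n M} (h : IsTranslate A N N₀ 𝒜)
    {p : Model n × Model n} (hp : p ∈ dom e A) : accel N e p.1 p.2 - accel N₀ e p.1 p.2 =
      𝒜 (e.1.symm p.1) (coordVec e p.1 p.2) (coordVec e p.1 p.2) • p.2 := by
  ext k
  simp only [accel, PiLp.sub_apply, PiLp.smul_apply, smul_eq_mul, ← Finset.sum_sub_distrib,
    ← formComp_sum_mul, Finset.sum_mul]
  exact Finset.sum_congr rfl fun i _ => by rw [h e p hp i k]; ring

theorem IsTranslate.parallelOn {𝒜 : OneForm n M} (h : IsTranslate A N N₀ 𝒜) :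
    ParallelOn A N N₀ := fun _ _ hp => ⟨_, h.accel_sub hp⟩

/-- A translate has the same geodesics if and only if `𝒜_a y^a = 0`. -/
theorem IsTranslate.shareGeodesics_iff (hA : IsConicDomain A) (hN : IsNonlinearConnection A N)
    {𝒜 : OneForm n M} (h : IsTranslate A N N₀ 𝒜) : ShareGeodesics A N N₀ ↔
      ∀ (p : M) (u : TangentSpace (𝓡 n) p), (⟨p, u⟩ : TM n M) ∈ A → 𝒜 p u u = 0 := by
  constructor
  · intro hs p u hu
    have hv := tvec_tcoord (e := prefChart n p) (v := (⟨p, u⟩ : TM n M)) (mem_prefChart_source p)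
    have hd := tcoord_mem_dom (e := prefChart n p) (v := (⟨p, u⟩ : TM n M))
      (mem_prefChart_source p) hu
    have h1 := h.accel_sub hd
    rw [accel_eq_of_shareGeodesics hA hN hs hd, sub_self] at h1
    have h2 := (smul_eq_zero.1 h1.symm).resolve_right (hA.vec_ne_zero hd)
    have h3 : ∀ v w : TM n M, v = w → 𝒜 v.1 v.2 v.2 = 𝒜 w.1 w.2 w.2 := by
      rintro v _ rfl; rfl
    exact (h3 _ _ hv).symm.trans h2
  · intro h0
    refine shareGeodesics_of_accel_eq fun e p hp => sub_eq_zero.1 ?_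
    rw [h.accel_sub hp, h0 _ _ hp.2, zero_smul]

/-- The factors of `N_i^k - (N₀)_i^k = a_i y^k` change like the components of a one-form. -/
theorem comp_chg_of_sub_eq (hA : IsConicDomain A) (hN : IsConnectionOn A N)
    (hN₀ : IsConnectionOn A N₀) {a : Chart n M → Fin n → Model n → Model n → ℝ}
    (ha : ∀ e : Chart n M, ∀ p ∈ dom e A, ∀ i k : Fin n,
      N e p.1 p.2 i k - N₀ e p.1 p.2 i k = a e i p.1 p.2 * p.2 k)
    {e e' : Chart n M} {x y : Model n} (h : (x, y) ∈ dom e A) (hx : x ∈ overlap e e')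
    (i : Fin n) : a e' i (chg e e' x) (fderiv ℝ (chg e e') x y) =
      ∑ c, a e c x y * fderiv ℝ (chg e' e) (chg e e' x) (stdVec i) c := by
  have h' := mem_dom_chg (p := (x, y)) h hx
  -- The inhomogeneous terms cancel in the difference of the two transformation laws. Both sides are
  -- multiples of the same non-zero vector.
  have key : ∀ k, a e' i (chg e e' x) (fderiv ℝ (chg e e') x y) * fderiv ℝ (chg e e') x y k =
      (∑ c, a e c x y * fderiv ℝ (chg e' e) (chg e e' x) (stdVec i) c) *
        fderiv ℝ (chg e e') x y k := by
    intro k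
    have ha' : ∀ c k, N e x y c k - N₀ e x y c k = a e c x y * y k := ha e _ h
    rw [← ha e' _ h' i k, hN.cocycle e e' x y h hx, hN₀.cocycle e e' x y h hx,
      add_sub_add_left_eq_sub, clm_apply_coord _ y k, Finset.sum_mul_sum]
    simp only [← Finset.sum_sub_distrib, ← mul_sub, ha']
    rw [Finset.sum_comm]
    exact Finset.sum_congr rfl fun c _ => Finset.sum_congr rfl fun d _ => by ring
  have h0 := hA.vec_ne_zero h'
  by_contra hne
  exact h0 (by ext k; exact mul_left_cancel₀ (sub_ne_zero.2 hne) (by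
    rw [sub_mul]; simp [key k]))

theorem ParallelOn.exists_quadJ (h : ParallelOn A N (metricConn L)) {p : Model n × Model n}
    (hp : p ∈ dom e A) : ∃ f : ℝ, ∀ k, quadJ L N e k p.1 p.2 = f * p.2 k := by
  obtain ⟨f, hf⟩ := h e p hp
  exact ⟨f, fun k => (accel_sub_eq_quadJ p k).symm.trans (congrArg (fun v : Model n => v k) hf)⟩

/-- Parallelism gives J_i^k = q_i y^k in every chart with q smooth and of degree zero; the q_i glue
because a factor of y ≠ 0 is unique. -/
theorem IsPseudoFinsler.exists_isTranslate (hn : 2 ≤ n) (hL : IsPseudoFinsler A L)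
    (hN : IsAffineSolution A L N) (h : ParallelOn A N (metricConn L)) :
    ∃ 𝒜 : OneForm n M, IsAnisotropicForm A 𝒜 ∧ IsTranslate A N (metricConn L) 𝒜 := by
  have S := fun e => hN.localSolution hn hL e
  have hJ : ∀ e : Chart n M, ∀ p ∈ dom e A, ∀ i k : Fin n,
      N e p.1 p.2 i k - metricConn L e p.1 p.2 i k = quotJ L N e i p.1 p.2 * p.2 k :=
    fun e p hp i k => ((S e).diffJ_eq_of_parallel hp (fun p hp => h.exists_quadJ hp) i k).1
  have hcomp : ∀ e : Chart n M, ∀ p ∈ dom e A, ∀ i,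
      formComp (formOfComp (quotJ L N)) e i p.1 p.2 = quotJ L N e i p.1 p.2 := by
    refine fun e p hp i => formComp_formOfComp (fun e e' x y h hx j => ?_) hp i
    have h1 := comp_chg_of_sub_eq hL.conic hN.conn.isConnectionOn
      hL.isNonlinearConnection.isConnectionOn hJ (mem_dom_chg (p := (x, y)) h hx)
      (chg_mem_overlap hx) j
    simpa only [chg_chg hx, fderiv_chg_fderiv_chg hx] using h1
  refine ⟨formOfComp (quotJ L N), ⟨fun e i => ?_, fun p u hu c hc => ?_⟩, fun e p hp i k => ?_⟩
  · exact ContDiffOn.congr ((S e).toRegularPair.smooth_quotJ i) fun p hp => hcomp e p hp i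
  · have hd := tcoord_mem_dom (e := prefChart n p) (v := (⟨p, u⟩ : TM n M))
      (mem_prefChart_source p) hu
    have h1 : tcoord (prefChart n p) ⟨p, c • u⟩ = ((tcoord (prefChart n p) ⟨p, u⟩).1,
        c • (tcoord (prefChart n p) ⟨p, u⟩).2) := Prod.ext rfl (map_smul _ _ _)
    refine Finset.sum_congr rfl fun i _ => ?_
    have h2 := (S (prefChart n p)).homog_quotJ i _ hd c hc
    rw [h1]
    simp only at h2 ⊢
    rw [h2]
    simp
  · rw [hcomp e p hp i, ← hJ e p hp i k, add_sub_cancel]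

theorem IsAffineSolution.meanLandsbergVanishes (hn : 2 ≤ n) (hL : IsPseudoFinsler A L)
    (hN : IsAffineSolution A L N) (h : ParallelOn A N (metricConn L)) :
    MeanLandsbergVanishes A L := fun e _ hp i =>
  (hN.localSolution hn hL e).meanLandsberg_eq_zero_of_parallel hp (fun _ hq => h.exists_quadJ hq) i

theorem ParallelOn.refl (A : Set (TM n M)) (N : Coeffs n M) : ParallelOn A N N :=
  fun _ _ _ => ⟨0, by rw [sub_self, zero_smul]⟩

/-- For J = 0 only the Landsberg term of the equation is left. -/
theorem isAffineSolution_metricConn (hL : IsPseudoFinsler A L) (h : MeanLandsbergVanishes A L) :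
    IsAffineSolution A L (metricConn L) where
  conn := hL.isNonlinearConnection
  eqn := fun e p hp i j => by
    have h1 : ∀ i j, diffJ L (metricConn L) e i j = fun _ _ => 0 := fun i j => by
      ext x y; exact sub_self _
    have h2 : ∀ i (x y : Model n), dV i (fun _ _ => (0 : ℝ)) x y = 0 := fun i x y => by simp [dV]
    simp [affineLHS, bracket, h1, h2, h e p hp]

end OneForm

/-! ### Lightlike geodesics -/

section Lightlike

variable {n : ℕ} {M : Type*} [TopologicalSpace M] [ChartedSpace (Model n) M]
  [IsManifold (𝓡 n) ∞ M] {A : Set (TM n M)} {L L' : TM n M → ℝ} {N N₀ : Coeffs n M}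

/-- One lightlike instant forces the whole geodesic onto the boundary, so the accelerations need to
agree only there. -/
theorem IsGeodesicOn.of_accel_eq_bdA (hL : IsProper A L) (hT : TransportsMetric A L N)
    (h : ∀ e : Chart n M, ∀ p ∈ dom e (bdA A), accel N e p.1 p.2 = accel N₀ e p.1 p.2)
    {γ : ℝ → M} {s : Set ℝ} {t₀ : ℝ} (ht₀ : t₀ ∈ s) (hb : velocity γ t₀ ∈ bdA A)
    (hγ : IsGeodesicOn (closA A) N γ s) : IsGeodesicOn (closA A) N₀ γ s :=
  hγ.of_accel_eq h ((hL.causal_character hT hγ).resolve_left fun h1 => hb.2 (h1 t₀ ht₀))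

theorem IsProperSolution.isGeodesicOn_iff_of_symm (hn : 3 ≤ n) (hL : IsProper A L)
    (hN : IsProperSolution A L N) (hs : IsSymmetricConn A N) {γ : ℝ → M} {s : Set ℝ} {t₀ : ℝ}
    (ht₀ : t₀ ∈ s) (hb : velocity γ t₀ ∈ bdA A) :
    IsGeodesicOn (closA A) N γ s ↔ IsGeodesicOn (closA A) (metricConn L) γ s :=
  ⟨.of_accel_eq_bdA hL (hN.transportsMetric (by omega) hL)
    (fun _ _ hp => hN.accel_eq_of_symm hn hL hs hp) ht₀ hb,
   .of_accel_eq_bdA hL hL.transportsMetric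
    (fun _ _ hp => (hN.accel_eq_of_symm hn hL hs hp).symm) ht₀ hb⟩

/-- On the boundary N is parallel to N^L, and N^L to the metric connection of any proper metric with
the same cone; parallelism is transitive. -/
theorem IsProperSolution.sharePregeodesics_bdA (hn : 2 ≤ n) (hL : IsProper A L)
    (hL' : IsProper A L') (hN : IsProperSolution A L N) :
    SharePregeodesics (bdA A) N (metricConn L') :=
  sharePregeodesics_of_parallel ((hN.isConnectionOn hL).mono bdA_subset_closA)
    (hL'.isConnectionOn.mono bdA_subset_closA)
    ((hN.parallelOn hn hL).trans (hL.parallelOn_metricConn hL')) (fun _ hv => hv.1.2)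
    (conic_dom_bdA hL.conic)

end Lightlike

end Palatini

end

theorem theoremD {n : ℕ} (hn : 2 ≤ n) {M : Type*} [TopologicalSpace M]
    [ChartedSpace (EuclideanSpace ℝ (Fin n)) M] [IsManifold (𝓡 n) ∞ M] [T2Space M]
    [SecondCountableTopology M] [ConnectedSpace M]
    (A : Set (TM n M)) (L : TM n M → ℝ) (hL : IsPseudoFinsler A L) :
    -- the metric connection is a solution iff the mean Landsberg tensor vanishes
    (IsAffineSolution A L (metricConn L) ↔ MeanLandsbergVanishes A L) ∧
    -- solutions sharing (pre)geodesics with the metric connection, when it vanishes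
    (MeanLandsbergVanishes A L → ∀ N : Coeffs n M, IsAffineSolution A L N →
      (SharePregeodesics A N (metricConn L) ↔
        ∃ 𝒜 : OneForm n M, IsAnisotropicForm A 𝒜 ∧ IsTranslate A N (metricConn L) 𝒜) ∧
      (∀ 𝒜 : OneForm n M, IsAnisotropicForm A 𝒜 → IsTranslate A N (metricConn L) 𝒜 →
        (ShareGeodesics A N (metricConn L) ↔
          ∀ (p : M) (u : TangentSpace (𝓡 n) p), (⟨p, u⟩ : TM n M) ∈ A → 𝒜 p u u = 0))) ∧
    -- when it does not vanish
    (¬ MeanLandsbergVanishes A L → ¬ IsAffineSolution A L (metricConn L) ∧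
      ∀ N : Coeffs n M, IsAffineSolution A L N → ¬ SharePregeodesics A N (metricConn L)) ∧
    -- geodesics of proper solutions keep the sign of the metric
    (IsProper A L → ∀ N : Coeffs n M, IsProperSolution A L N →
      ∀ (γ : ℝ → M) (s : Set ℝ), IsGeodesicOn (closA A) N γ s → ∀ t₁ ∈ s, ∀ t₂ ∈ s,
        SignType.sign (L (velocity γ t₁)) = SignType.sign (L (velocity γ t₂))) ∧
    -- causal character and lightlike (pre)geodesics in the Lorentz-Finsler case
    (IsLorentzFinsler A L → ∀ N : Coeffs n M, IsProperSolution A L N →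
      (∀ (γ : ℝ → M) (s : Set ℝ), IsGeodesicOn (closA A) N γ s →
        (∀ t ∈ s, velocity γ t ∈ A) ∨ (∀ t ∈ s, velocity γ t ∈ bdA A)) ∧
      (3 ≤ n → IsSymmetricConn A N →
        ∀ (γ : ℝ → M) (s : Set ℝ), ∀ t₀ ∈ s, velocity γ t₀ ∈ bdA A →
          (IsGeodesicOn (closA A) N γ s ↔ IsGeodesicOn (closA A) (metricConn L) γ s)) ∧
      SharePregeodesics (bdA A) N (metricConn L) ∧
      (∀ L' : TM n M → ℝ, IsLorentzFinsler A L' →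
        SharePregeodesics (bdA A) N (metricConn L'))) := by
  have hpar : ∀ N : Coeffs n M, IsAffineSolution A L N → SharePregeodesics A N (metricConn L) →
      ParallelOn A N (metricConn L) := fun N hN =>
    parallelOn_of_sharePregeodesics hL.conic hN.conn hL.isNonlinearConnection
  -- N^L is parallel to itself, so the direct implication is a case of the result on parallel
  -- solutions.
  have hiff : IsAffineSolution A L (metricConn L) ↔ MeanLandsbergVanishes A L :=
    ⟨fun h => h.meanLandsbergVanishes hn hL (.refl A _), isAffineSolution_metricConn hL⟩
  refine ⟨hiff, fun _ N hN => ⟨⟨fun h => hL.exists_isTranslate hn hN (hpar N hN h), ?_⟩,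
    fun 𝒜 _ h => h.shareGeodesics_iff hL.conic hN.conn⟩, fun h => ⟨mt hiff.1 h,
    fun N hN hs => h (hN.meanLandsbergVanishes hn hL (hpar N hN hs))⟩, ?_, ?_⟩
  · rintro ⟨𝒜, -, h⟩
    exact sharePregeodesics_of_parallel hN.conn.isConnectionOn
      hL.isNonlinearConnection.isConnectionOn h.parallelOn (fun v hv => hL.conic.ne_zero v.1 v.2 hv)
      hL.conic.conic_dom
  · intro hP N hN γ s hγ t₁ h₁ t₂ h₂
    exact hP.sign_eq (hN.transportsMetric hn hP) hγ h₁ h₂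
  · intro hLF N hN
    have hP := hLF.toIsProper
    exact ⟨fun γ s hγ => hP.causal_character (hN.transportsMetric hn hP) hγ,
      fun h3 hs γ s t₀ ht₀ hb => hN.isGeodesicOn_iff_of_symm h3 hP hs ht₀ hb,
      hN.sharePregeodesics_bdA hn hP hP,
      fun L' hL' => hN.sharePregeodesics_bdA hn hP hL'.toIsProper⟩
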